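/- **Setting.** $\mathbb H^1=\mathbb R^3$ is the Heisenberg group with product $(x,y,z)(x',y',z')=(x+x',\,y+y',\,z+z'+2x'y-2xy')$, dilations $\delta_t(x,y,z)=(tx,ty,t^2z)$, projection $\pi(x,y,z)=(x,y)$, homogeneous norm $\rho_\infty(x,y,z)=\max\{\sqrt{x^2+y^2},|z|^{1/2}\}$ and distance $d_\infty(A,B)=\rho_\infty(B^{-1}A)$. Write $\dim_h$ and $\mathcal H^2_\infty$ for the Hausdorff dimension and the $2$-dimensional Hausdorff measure with respect to $d_\infty$, and $\dim_E$ for the Hausdorff dimension with respect to the Euclidean distance. A map $F:\mathbb H^1\to\mathbb R^2$ is in $C^1_H(\mathbb H^1,\mathbb R^2)$ if at every $A$ there is a continuous group homomorphism $D_hF(A):\mathbb H^1\to\mathbb R^2$, commuting with dilations, such that $F(Ah)-F(A)-D_hF(A)(h)=o(\rho_\infty(h))$ as $h\to0$, and $A\mapsto D_hF(A)$ is continuous for the norm $\|L\|=\sup_{P\ne0}\|L(P)\|/\rho_\infty(P)$. A *vertical curve* is a simple arc of the form $\Gamma=U\cap F^{-1}(0)$, where $F\in C^1_H(\mathbb H^1,\mathbb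 R^2)$, $F(0)=0$, $U$ is a compact neighbourhood of $0\in\mathbb H^1$, and $D_hF(A)$ is surjective for all $A\in U$. For a continuous plane curve $\gamma=(x,y):[0,T]\to\mathbb R^2$ let $Z_{x,y}(t)=2\int_0^t(x\,dy-y\,dx)$, i.e. the limit (when it exists and is finite) of $2\sum_i \big(x(t_i)y(t_{i+1})-y(t_i)x(t_{i+1})\big)$ over subdivisions $0=t_0<\dots<t_N=t$ as the mesh tends to $0$. If $Z_{x,y}(t)$ exists for all $t\in[0,T]$, a *vertical lift* of $\gamma$ is a curve $[0,T]\ni t\mapsto(x(t),y(t),z_0-Z_{x,y}(t)+t)$ with $z_0\in\mathbb R$. A *quasi-helix of exponent $\alpha$* is a map $\gamma:[0,1]\to\mathbb R^2$ such that for some $0<c<\infty$ and all $s,t\in[0,1]$, $c^{-1}|t-s|^\alpha\le\|\gamma(t)-\gamma(s)\|\le c|t-s|^\alpha$. Given $h=(h_n)_{n\ge0}$ in $(0,\tfrac12)$, put $l_n=2^{-n(1/2+h_n)}$. A *von Koch curve with exponents $h$* is a uniform limit $\gamma:[0,1]\to\mathbb R^2$ of curves $\gamma_n$, where $\gamma_n$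 maps each dyadic interval $[\frac i{2^n},\frac{i+1}{2^n}]$, $0\le i<2^n$, affinely onto a segment $[A^n_i,A^n_{i+1}]$ of length $l_n$, where $A^{n+1}_{2i}=A^n_i$, and where the new vertex $A^{n+1}_{2i+1}$ lies strictly to the left of the oriented segment $[A^n_i,A^n_{i+1}]$ if $n$ is even and strictly to the right if $n$ is odd. **Statement.** The Euclidean Hausdorff dimension of vertical curves can take every value in $[1,2]$. More precisely, for every $\beta\in[1,2]$ there is a vertical curve $\Gamma$ with $\dim_E\Gamma=\beta$ such that: * if $\beta<2$, then $\Gamma$ is the image of a vertical lift of a quasi-helix $\gamma:[0,1]\to\mathbb R^2$ of exponent $1/\beta$; * if $\beta=2$, then there are a non-increasing sequence $(h_n)$ in $(0,\tfrac12)$ with $h_n\to0$ and $\sum_n2^{-nh_n}<\infty$, a von Koch curve $\gamma:[0,1]\to\mathbb R^2$ with exponents $(h_n)$, and $T>0$, such that $\Gamma$ is the image of a vertical lift of the reparametrized curve $[0,T]\ni t\mapsto\gamma(t/T)$. Moreover $\Gamma$ is $2$-Ahlfors regular, i.e. there is $0<C<\infty$ such that every subarc $[A,B]$ of $\Gamma$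 satisfies $C^{-1}d_\infty(A,B)^2\le\mathcal H^2_\infty([A,B])\le C\,d_\infty(A,B)^2$, and $\dim_h\Gamma=\dim_E\Gamma=\dim_E\pi(\Gamma)=2$. -/

import Mathlib

open Filter Topology MeasureTheory Set
open scoped ENNReal

/-- The Euclidean plane. -/
abbrev Plane : Type := EuclideanSpace ℝ (Fin 2)

/-- The first Heisenberg group, in exponential coordinates `(x, y, z)` on `ℝ³`. -/
@[ext]
structure Heis where
  x : ℝ
  y : ℝ
  z : ℝ

namespace Heis

/-- `(x,y,z)(x',y',z') = (x + x', y + y', z + z' + 2 x' y - 2 x y')`. -/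
instance : Mul Heis :=
  ⟨fun A B => ⟨A.x + B.x, A.y + B.y, A.z + B.z + 2 * (B.x * A.y) - 2 * (A.x * B.y)⟩⟩

instance : One Heis := ⟨⟨0, 0, 0⟩⟩

instance : Inv Heis := ⟨fun A => ⟨-A.x, -A.y, -A.z⟩⟩

@[simp] lemma mul_x (A B : Heis) : (A * B).x = A.x + B.x := rfl
@[simp] lemma mul_y (A B : Heis) : (A * B).y = A.y + B.y := rfl
@[simp] lemma mul_z (A B : Heis) :
    (A * B).z = A.z + B.z + 2 * (B.x * A.y) - 2 * (A.x * B.y) := rfl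
@[simp] lemma one_x : (1 : Heis).x = 0 := rfl
@[simp] lemma one_y : (1 : Heis).y = 0 := rfl
@[simp] lemma one_z : (1 : Heis).z = 0 := rfl
@[simp] lemma inv_x (A : Heis) : (A⁻¹).x = -A.x := rfl
@[simp] lemma inv_y (A : Heis) : (A⁻¹).y = -A.y := rfl
@[simp] lemma inv_z (A : Heis) : (A⁻¹).z = -A.z := rfl

instance : Group Heis :=
  Group.ofLeftAxioms
    (fun A B C => by ext <;> simp <;> ring)
    (fun A => by ext <;> simp)
    (fun A => by ext <;> simp)

/-- The dilation `δ_t (x,y,z) = (t x, t y, t² z)`. -/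
def dilate (t : ℝ) (A : Heis) : Heis := ⟨t * A.x, t * A.y, t ^ 2 * A.z⟩

/-- The projection `π (x,y,z) = (x,y)` to the horizontal plane. -/
noncomputable def proj (A : Heis) : Plane := !₂[A.x, A.y]

/-- The identification of the underlying space with Euclidean `ℝ³`. -/
noncomputable def toEuclid (A : Heis) : EuclideanSpace ℝ (Fin 3) := !₂[A.x, A.y, A.z]

/-- The homogeneous norm `ρ_∞ (x,y,z) = max (√(x² + y²)) (√|z|)`. -/
noncomputable def rho (A : Heis) : ℝ := max √(A.x ^ 2 + A.y ^ 2) √|A.z|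

lemma rho_nonneg (A : Heis) : 0 ≤ rho A := le_max_of_le_left (Real.sqrt_nonneg _)

lemma rho_inv (A : Heis) : rho A⁻¹ = rho A := by simp [rho]

lemma rho_one : rho 1 = 0 := by simp [rho]

lemma eq_one_of_rho_eq_zero {A : Heis} (h : rho A = 0) : A = 1 := by
  have h1 : √(A.x ^ 2 + A.y ^ 2) ≤ 0 := h ▸ le_max_left _ _
  have h2 : √|A.z| ≤ 0 := h ▸ le_max_right _ _
  have h1' := Real.sqrt_eq_zero'.1 (le_antisymm h1 (Real.sqrt_nonneg _))
  have h2' := Real.sqrt_eq_zero'.1 (le_antisymm h2 (Real.sqrt_nonneg _))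
  ext
  · simp only [one_x]; nlinarith [sq_nonneg A.x, sq_nonneg A.y]
  · simp only [one_y]; nlinarith [sq_nonneg A.x, sq_nonneg A.y]
  · simpa using abs_eq_zero.1 (le_antisymm h2' (abs_nonneg _))

lemma hor_sq_le (A : Heis) : A.x ^ 2 + A.y ^ 2 ≤ rho A ^ 2 :=
  (Real.sqrt_le_left (rho_nonneg A)).1 (le_max_left _ _)

lemma abs_z_le (A : Heis) : |A.z| ≤ rho A ^ 2 :=
  (Real.sqrt_le_left (rho_nonneg A)).1 (le_max_right _ _)

lemma rho_mul_le (A B : Heis) : rho (A * B) ≤ rho A + rho B := by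
  have hA := rho_nonneg A
  have hB := rho_nonneg B
  have a1 := hor_sq_le A
  have b1 := hor_sq_le B
  have a2 := abs_le.1 (abs_z_le A)
  have b2 := abs_le.1 (abs_z_le B)
  have hprod : (A.x ^ 2 + A.y ^ 2) * (B.x ^ 2 + B.y ^ 2) ≤ (rho A * rho B) ^ 2 := by
    rw [mul_pow]
    exact mul_le_mul a1 b1 (by positivity) (by positivity)
  have hab : 0 ≤ rho A * rho B := mul_nonneg hA hB
  have c1 : A.x * B.x + A.y * B.y ≤ rho A * rho B :=
    (abs_le_of_sq_le_sq' (by nlinarith [sq_nonneg (A.x * B.y - A.y * B.x)]) hab).2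
  have c2 := abs_le_of_sq_le_sq' (a := B.x * A.y - A.x * B.y) (b := rho A * rho B)
    (by nlinarith [sq_nonneg (A.x * B.x + A.y * B.y)]) hab
  refine max_le ?_ ?_
  · refine Real.sqrt_le_iff.2 ⟨by positivity, ?_⟩
    simp only [mul_x, mul_y]
    nlinarith
  · refine Real.sqrt_le_iff.2 ⟨by positivity, ?_⟩
    simp only [mul_z]
    refine abs_le.2 ⟨?_, ?_⟩ <;> nlinarith [c2.1, c2.2, a2.1, a2.2, b2.1, b2.2]

/-- The left-invariant homogeneous distance `d_∞ (A, B) = ρ_∞ (B⁻¹ A)`. -/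
noncomputable instance : MetricSpace Heis where
  dist A B := rho (B⁻¹ * A)
  dist_self A := by simp [rho_one]
  dist_comm A B := by
    rw [← rho_inv, mul_inv_rev, inv_inv]
  dist_triangle A B C := by
    have := rho_mul_le (C⁻¹ * B) (B⁻¹ * A)
    rw [show C⁻¹ * B * (B⁻¹ * A) = C⁻¹ * A by group] at this
    linarith
  eq_of_dist_eq_zero {A B} h := by
    have := eq_one_of_rho_eq_zero h
    exact (inv_mul_eq_one.1 this).symm

noncomputable instance : MeasurableSpace Heis := borel Heis

instance : BorelSpace Heis := ⟨rfl⟩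

end Heis

/-- Horizontal (homogeneous) homomorphisms from the Heisenberg group to the plane: continuous
group homomorphisms that commute with the dilations. -/
structure HorizHom where
  toFun : Heis → Plane
  map_mul : ∀ A B, toFun (A * B) = toFun A + toFun B
  map_dilate : ∀ t : ℝ, 0 < t → ∀ A, toFun (Heis.dilate t A) = t • toFun A
  continuous_toFun : Continuous toFun

/-- `L` is the horizontal (Pansu) differential of `F` at `A`:
`F (A h) - F A - L h = o(ρ_∞ h)` as `h` tends to the neutral element. -/
def HasHorizDerivAt (F : Heis → Plane) (L : HorizHom) (A : Heis) : Prop :=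
  (fun h : Heis => F (A * h) - F A - L.toFun h) =o[𝓝 1] Heis.rho

/-- `F` belongs to `C¹_H(ℍ¹, ℝ²)`, with horizontal differential `D`. The second clause is the
continuity of `D` for the norm `‖L‖ = sup_{P ≠ 1} ‖L P‖ / ρ_∞ P`. -/
def IsC1HWith (F : Heis → Plane) (D : Heis → HorizHom) : Prop :=
  (∀ A, HasHorizDerivAt F (D A) A) ∧
  ∀ A, ∀ ε > 0, ∀ᶠ B in 𝓝 A, ∀ P, ‖(D B).toFun P - (D A).toFun P‖ ≤ ε * Heis.rho P

/-- The image of a simple (injective, continuous) curve parametrized by `[0,1]`. -/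
def IsSimpleArc (Γ : Set Heis) : Prop :=
  ∃ c : ℝ → Heis, ContinuousOn c (Icc 0 1) ∧ InjOn c (Icc 0 1) ∧ c '' Icc 0 1 = Γ

/-- A vertical curve: a simple arc `U ∩ F⁻¹(0)`, where `F ∈ C¹_H(ℍ¹, ℝ²)` vanishes at the neutral
element, `U` is a compact neighbourhood of the neutral element, and the horizontal differential
of `F` is surjective at every point of `U`. -/
def IsVerticalCurve (Γ : Set Heis) : Prop :=
  ∃ (F : Heis → Plane) (D : Heis → HorizHom) (U : Set Heis),
    IsC1HWith F D ∧ F 1 = 0 ∧ U ∈ 𝓝 1 ∧ IsCompact U ∧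
    (∀ A ∈ U, Function.Surjective (D A).toFun) ∧ Γ = U ∩ F ⁻¹' {0} ∧ IsSimpleArc Γ

/-- `Z` is the value of `Z_{x,y}(t) = 2 ∫₀ᵗ (x dy - y dx)` for `γ = (x, y)`, the limit of the sums
`2 ∑ (x(τᵢ) y(τᵢ₊₁) - y(τᵢ) x(τᵢ₊₁))` over all subdivisions `0 = τ₀ < τ₁ < ⋯ < τ_N = t` as the
mesh tends to zero. -/
def HasLevyArea (γ : ℝ → Plane) (t Z : ℝ) : Prop :=
  ∀ ε > 0, ∃ δ > 0, ∀ (N : ℕ) (τ : ℕ → ℝ), τ 0 = 0 → τ N = t →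
    (∀ i < N, τ i < τ (i + 1) ∧ τ (i + 1) - τ i < δ) →
    |2 * ∑ i ∈ Finset.range N, (γ (τ i) 0 * γ (τ (i + 1)) 1 - γ (τ i) 1 * γ (τ (i + 1)) 0) - Z| < ε

/-- `Γ`, on `[0,T]`, is a vertical lift of the continuous plane curve `γ = (x, y)`:
`Γ(t) = (x(t), y(t), z₀ - Z_{x,y}(t) + t)`, where all the `Z_{x,y}(t)` exist. -/
def IsVerticalLift (T : ℝ) (γ : ℝ → Plane) (Γ : ℝ → Heis) : Prop :=
  ContinuousOn γ (Icc 0 T) ∧ ∃ (Z : ℝ → ℝ) (z₀ : ℝ), ∀ t ∈ Icc 0 T,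
    HasLevyArea γ t (Z t) ∧ Γ t = ⟨γ t 0, γ t 1, z₀ - Z t + t⟩

/-- `γ : [0,1] → ℝ²` is a quasi-helix of exponent `α`. -/
def IsQuasiHelix (α : ℝ) (γ : ℝ → Plane) : Prop :=
  ∃ c > 0, ∀ s ∈ Icc (0 : ℝ) 1, ∀ t ∈ Icc (0 : ℝ) 1,
    c⁻¹ * |t - s| ^ α ≤ ‖γ t - γ s‖ ∧ ‖γ t - γ s‖ ≤ c * |t - s| ^ α

/-- The length `l_n = 2^{-n (1/2 + h_n)}` of the segments at step `n`. -/
noncomputable def kochLength (h : ℕ → ℝ) (n : ℕ) : ℝ := (2 : ℝ) ^ (-((n : ℝ) * (1 / 2 + h n)))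

/-- `det (u, v)` for plane vectors. -/
def planeDet (u v : Plane) : ℝ := u 0 * v 1 - u 1 * v 0

/-- `γ : [0,1] → ℝ²` is a curve of von Koch type with exponents `h`: it is the uniform limit of
the curves `g n`, where `g n` maps the `i`-th dyadic interval of length `2⁻ⁿ` affinely onto the
segment from `A n i` to `A n (i+1)`, of length `l_n`. Going from step `n` to step `n+1`, the
vertices are kept and a new vertex is added over each segment, all on the same side of the
(oriented) segments, and this side alternates with `n`. -/
def IsKochCurve (h : ℕ → ℝ) (γ : ℝ → Plane) : Prop :=
  ∃ (A : ℕ → ℕ → Plane) (g : ℕ → ℝ → Plane),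
    (∀ n, ∀ i < 2 ^ n, dist (A n i) (A n (i + 1)) = kochLength h n) ∧
    (∀ n, ∀ i ≤ 2 ^ n, A (n + 1) (2 * i) = A n i) ∧
    (∀ n, ∀ i < 2 ^ n,
      0 < (-1) ^ n * planeDet (A n (i + 1) - A n i) (A (n + 1) (2 * i + 1) - A n i)) ∧
    (∀ n, ∀ i : ℕ, i < 2 ^ n → ∀ θ ∈ Icc (0 : ℝ) 1,
      g n (((i : ℝ) + θ) / 2 ^ n) = (1 - θ) • A n i + θ • A n (i + 1)) ∧
    TendstoUniformlyOn g γ atTop (Icc 0 1)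

/-- The curve `Γ : [0,T] → ℍ¹` is `p`-Ahlfors regular for the distance `d_∞`: the Hausdorff
measure of each subarc is comparable with the `p`-th power of the distance of its endpoints. -/
def IsAhlforsRegularCurve (p T : ℝ) (Γ : ℝ → Heis) : Prop :=
  ∃ C : ℝ, 0 < C ∧ ∀ s ∈ Icc 0 T, ∀ t ∈ Icc 0 T, s ≤ t →
    ENNReal.ofReal (C⁻¹ * dist (Γ s) (Γ t) ^ p) ≤ μH[p] (Γ '' Icc s t) ∧
    μH[p] (Γ '' Icc s t) ≤ ENNReal.ofReal (C * dist (Γ s) (Γ t) ^ p)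

/-! For a lift `Γ(t) = (γ(t), z₀ - Z(t) + t)` the vertical coordinate of `Γ(s)⁻¹ Γ(t)` is `(t - s) -
(Z(t) - Z(s) - 2 det(γ(s), γ(t)))`. If the bracket is at most `(t - s)/2` and `‖γ(t) - γ(s)‖² = o(|t
- s|)`, then `d_∞(Γ(s), Γ(t))²` is comparable with `|t - s|` and horizontal displacements are
negligible with respect to `d_∞`. `IsVerticalParam` records this situation, and the intrinsic claims
follow from it. Being bi-Hölder of exponent `1/2`, `Γ` is 2-Ahlfors regular of dimension 2
(`isAhlforsRegularCurve`, `dimH_image`).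

That `Γ` is a vertical curve (`isVerticalCurve`) is a Whitney-type extension. The projection `π`
restricted to `Γ` is extended to the whole group by averages weighted by a power of the inverse
distance (`projExt`). Since `π` varies little along `Γ`, the extension has horizontal differential
zero on `Γ` and small near it, so `F = π - projExt` has differential close to `π`. Then `F` vanishes
on `Γ`, and on a horizontal slice `Γ(t)v` with `v` small it vanishes only at `v = 0`.

Such lifts exist as soon as `∑ 2ⁿ Lₙ² < ∞`, where `Lₙ` bounds the oscillation of `γ` at time scale
`2⁻ⁿ`: a dyadic sewing lemma (`exists_sewing`) builds `Z`, and shrinking `γ` or lengthening the time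
interval makes the bracket small (`exists_isVerticalParam`).

The plane curves are of von Koch type, with bumps of relative height `τₙ / 2`, where `τₙ < 1` is
non-decreasing. Nested quadrilaterals bound the oscillation by the side length
(`norm_curve_sub_le`), and cones separating the two children of a cell give a lower bound with the
loss `1 - τₙ` (`exists_le_norm_curve_sub`). A constant `τ` gives a quasi-helix of exponent `1/β`
when `β < 2`. For `β = 2` the sides are `2^(-n/2 - √n/4)`: the series still converges, and the loss
is subexponential in `n`, so the inverse of `γ` is Hölder of every exponent below 2. The Euclidean
dimension of `Γ` is bounded below through `π`, and above because the vertical coordinate is as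
Hölder as `γ` (`dist_toEuclid_le`). -/

namespace Heis

/-! ### Topology of the Heisenberg group and elementary bounds for the gauge -/

lemma dist_eq_rho (A B : Heis) : dist A B = rho (B⁻¹ * A) := rfl

lemma dist_mul_left_self (A h : Heis) : dist (A * h) A = rho h := by
  rw [dist_eq_rho, inv_mul_cancel_left]

lemma continuous_coord_mk : Continuous fun p : ℝ × ℝ × ℝ => (⟨p.1, p.2.1, p.2.2⟩ : Heis) := by
  refine continuous_iff_continuousAt.2 fun p => ?_
  refine tendsto_iff_dist_tendsto_zero.2 ?_
  have h : Continuous fun q : ℝ × ℝ × ℝ =>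
      dist (⟨q.1, q.2.1, q.2.2⟩ : Heis) ⟨p.1, p.2.1, p.2.2⟩ := by
    simp only [dist_eq_rho, rho, mul_x, mul_y, mul_z, inv_x, inv_y, inv_z]
    fun_prop
  simpa using h.tendsto p

lemma continuous_x : Continuous x := by
  refine continuous_iff_continuousAt.2 fun A => ?_
  refine tendsto_iff_dist_tendsto_zero.2 ?_
  refine squeeze_zero (fun _ => dist_nonneg) (fun B => ?_)
    (tendsto_iff_dist_tendsto_zero.1 (tendsto_id (α := Heis) (x := 𝓝 A)))
  rw [id, dist_eq_rho, Real.dist_eq]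
  refine abs_le_of_sq_le_sq ?_ (rho_nonneg _)
  have := hor_sq_le (A⁻¹ * B)
  simp only [mul_x, mul_y, inv_x, inv_y] at this
  nlinarith [sq_nonneg (-A.y + B.y)]

lemma continuous_y : Continuous y := by
  refine continuous_iff_continuousAt.2 fun A => ?_
  refine tendsto_iff_dist_tendsto_zero.2 ?_
  refine squeeze_zero (fun _ => dist_nonneg) (fun B => ?_)
    (tendsto_iff_dist_tendsto_zero.1 (tendsto_id (α := Heis) (x := 𝓝 A)))
  rw [id, dist_eq_rho, Real.dist_eq]
  refine abs_le_of_sq_le_sq ?_ (rho_nonneg _)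
  have := hor_sq_le (A⁻¹ * B)
  simp only [mul_x, mul_y, inv_x, inv_y] at this
  nlinarith [sq_nonneg (-A.x + B.x)]

lemma continuous_z : Continuous z := by
  refine continuous_iff_continuousAt.2 fun A => ?_
  have h1 : Tendsto (fun B => (A⁻¹ * B).z) (𝓝 A) (𝓝 0) := by
    refine squeeze_zero_norm (a := fun B => dist B A ^ 2) (fun B => ?_) ?_
    · exact abs_z_le _
    · simpa using (tendsto_iff_dist_tendsto_zero.1 (tendsto_id (α := Heis) (x := 𝓝 A))).pow 2
  have h2 : Tendsto (fun B : Heis => A.z + (A⁻¹ * B).z - 2 * (B.x * -A.y) + 2 * (-A.x * B.y))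
      (𝓝 A) (𝓝 (A.z + 0 - 2 * (A.x * -A.y) + 2 * (-A.x * A.y))) := by
    have hx := continuous_x.tendsto A
    have hy := continuous_y.tendsto A
    exact ((h1.const_add _).sub ((hx.mul_const _).const_mul 2)).add ((hy.const_mul _).const_mul 2)
  refine (h2.congr fun B => ?_).trans (by ring_nf; exact le_rfl)
  simp only [mul_z, inv_x, inv_y, inv_z]
  ring

/-- Exponential coordinates identify the Heisenberg group with `ℝ³` as a topological space. -/
def coordHomeo : Heis ≃ₜ ℝ × ℝ × ℝ where
  toFun A := (A.x, A.y, A.z)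
  invFun p := ⟨p.1, p.2.1, p.2.2⟩
  left_inv _ := rfl
  right_inv _ := rfl
  continuous_toFun := continuous_x.prodMk (continuous_y.prodMk continuous_z)
  continuous_invFun := continuous_coord_mk

lemma continuous_iff_coord {X : Type*} [TopologicalSpace X] {f : X → Heis} :
    Continuous f ↔ Continuous (fun a => (f a).x) ∧ Continuous (fun a => (f a).y) ∧
      Continuous (fun a => (f a).z) := by
  rw [← coordHomeo.comp_continuous_iff]
  exact ⟨fun h => ⟨h.fst, h.snd.fst, h.snd.snd⟩, fun h => h.1.prodMk (h.2.1.prodMk h.2.2)⟩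

instance : ContinuousMul Heis := ⟨by
  have hx := continuous_x
  have hy := continuous_y
  have hz := continuous_z
  refine continuous_iff_coord.2 ⟨?_, ?_, ?_⟩ <;> simp only [mul_x, mul_y, mul_z] <;> fun_prop⟩

instance : ContinuousInv Heis := ⟨by
  have hx := continuous_x
  have hy := continuous_y
  have hz := continuous_z
  refine continuous_iff_coord.2 ⟨?_, ?_, ?_⟩ <;> simp only [inv_x, inv_y, inv_z] <;> fun_prop⟩

lemma continuous_rho : Continuous rho := by
  have hx := continuous_x
  have hy := continuous_y
  have hz := continuous_z
  unfold rho
  fun_prop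

lemma abs_x_le (A : Heis) : |A.x| ≤ rho A :=
  abs_le_of_sq_le_sq (by nlinarith [hor_sq_le A, sq_nonneg A.y]) (rho_nonneg A)

lemma abs_y_le (A : Heis) : |A.y| ≤ rho A :=
  abs_le_of_sq_le_sq (by nlinarith [hor_sq_le A, sq_nonneg A.x]) (rho_nonneg A)

lemma rho_dilate {t : ℝ} (ht : 0 ≤ t) (A : Heis) : rho (dilate t A) = t * rho A := by
  have h1 : (t * A.x) ^ 2 + (t * A.y) ^ 2 = t ^ 2 * (A.x ^ 2 + A.y ^ 2) := by ring
  rw [rho, rho, mul_max_of_nonneg _ _ ht]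
  simp only [dilate]
  rw [h1, abs_mul, abs_of_nonneg (sq_nonneg t), Real.sqrt_mul (sq_nonneg t),
    Real.sqrt_mul (sq_nonneg t), Real.sqrt_sq ht]

lemma norm_proj_sq (A : Heis) : ‖proj A‖ ^ 2 = A.x ^ 2 + A.y ^ 2 := by
  rw [EuclideanSpace.norm_sq_eq]
  simp [proj, Fin.sum_univ_two]

lemma norm_proj_le (A : Heis) : ‖proj A‖ ≤ rho A :=
  le_of_sq_le_sq (by rw [norm_proj_sq]; exact hor_sq_le A) (rho_nonneg A)

lemma proj_mul (A B : Heis) : proj (A * B) = proj A + proj B := by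
  ext i; fin_cases i <;> simp [proj]

lemma rho_of_z_eq_zero {A : Heis} (h : A.z = 0) : rho A = ‖proj A‖ := by
  rw [rho, h, ← norm_proj_sq, Real.sqrt_sq (norm_nonneg _)]
  simp

lemma eventually_rho_lt {r : ℝ} (hr : 0 < r) : ∀ᶠ h in 𝓝 (1 : Heis), rho h < r :=
  continuous_rho.continuousAt.eventually_lt continuousAt_const (by rwa [rho_one])

end Heis

/-! ### Horizontal differentials -/

open Heis

/-- The horizontal homomorphism `(x, y, z) ↦ x u + y v`. -/
noncomputable def HorizHom.ofPair (u v : Plane) : HorizHom where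
  toFun A := A.x • u + A.y • v
  map_mul A B := by simp only [mul_x, mul_y]; module
  map_dilate t _ A := by simp only [dilate]; module
  continuous_toFun := by
    have hx := continuous_x
    have hy := continuous_y
    fun_prop

/-- The Euclidean derivative determines the horizontal derivative. -/
lemma HasFDerivAt.hasHorizDerivAt {f : ℝ × ℝ × ℝ → Plane} {f' : ℝ × ℝ × ℝ →L[ℝ] Plane} {A : Heis}
    (h : HasFDerivAt f f' (A.x, A.y, A.z)) :
    HasHorizDerivAt (fun P => f (P.x, P.y, P.z))
      (HorizHom.ofPair (f' (1, 0, 2 * A.y)) (f' (0, 1, -(2 * A.x)))) A := by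
  -- `φ h` is the increment of the coordinates from `A` to `A * h`; it is only `O(ρ)`, because of
  -- the cross terms.
  set φ : Heis → ℝ × ℝ × ℝ := fun h => (h.x, h.y, h.z + 2 * (h.x * A.y) - 2 * (A.x * h.y)) with hφ
  have hφc : Tendsto φ (𝓝 1) (𝓝 0) := by
    have hx := continuous_x
    have hy := continuous_y
    have hz := continuous_z
    have : Continuous φ := by fun_prop
    simpa [hφ, Prod.zero_eq_mk] using this.tendsto 1
  have hφO : φ =O[𝓝 1] rho := by
    refine Asymptotics.IsBigO.of_bound (2 + 2 * |A.y| + 2 * |A.x|) ?_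
    filter_upwards [eventually_rho_lt one_pos] with h hh
    have h0 := rho_nonneg h
    have hx := abs_x_le h
    have hy := abs_y_le h
    have hz : |h.z| ≤ rho h := (abs_z_le h).trans (by nlinarith)
    have e1 : 0 ≤ |A.x| * rho h := by positivity
    have e2 : 0 ≤ |A.y| * rho h := by positivity
    rw [Real.norm_of_nonneg h0, hφ, Prod.norm_mk, Prod.norm_mk]
    simp only [Real.norm_eq_abs]
    refine max_le (by nlinarith) (max_le (by nlinarith) ?_)
    calc |h.z + 2 * (h.x * A.y) - 2 * (A.x * h.y)|
        ≤ |h.z + 2 * (h.x * A.y)| + |2 * (A.x * h.y)| := abs_sub _ _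
      _ ≤ |h.z| + |2 * (h.x * A.y)| + |2 * (A.x * h.y)| := by gcongr; exact abs_add_le _ _
      _ = |h.z| + 2 * (|h.x| * |A.y|) + 2 * (|A.x| * |h.y|) := by simp [abs_mul]
      _ ≤ rho h + 2 * (rho h * |A.y|) + 2 * (|A.x| * rho h) := by gcongr
      _ ≤ _ := by nlinarith
  have h1 := (hasFDerivAt_iff_isLittleO_nhds_zero.1 h).comp_tendsto hφc
  have h2 := h1.trans_isBigO hφO
  -- The vertical derivative is multiplied by `h.z = O(ρ²)`, so only the fields `∂x + 2y ∂z` and `∂y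
  -- - 2x ∂z` survive.
  have h3 : (fun h : Heis => h.z • f' (0, 0, 1)) =o[𝓝 1] rho := by
    refine Asymptotics.IsLittleO.of_bound fun c hc => ?_
    have hr : 0 < c / (‖f' (0, 0, 1)‖ + 1) := by positivity
    filter_upwards [eventually_rho_lt hr] with h hh
    have h0 := rho_nonneg h
    rw [norm_smul, Real.norm_of_nonneg h0, Real.norm_eq_abs]
    rw [lt_div_iff₀ (by positivity)] at hh
    calc |h.z| * ‖f' (0, 0, 1)‖ ≤ rho h ^ 2 * ‖f' (0, 0, 1)‖ := by gcongr; exact abs_z_le h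
      _ ≤ c * rho h := by nlinarith [norm_nonneg (f' (0, 0, 1))]
  refine (h2.add h3).congr' (Eventually.of_forall fun h => ?_) EventuallyEq.rfl
  have e : φ h = h.x • (1, 0, 2 * A.y) + h.y • (0, 1, -(2 * A.x)) + h.z • (0, 0, 1) := by
    simp only [hφ, Prod.smul_mk, Prod.mk_add_mk, smul_eq_mul]
    ext <;> simp; ring
  have e2 : f' (φ h) = h.x • f' (1, 0, 2 * A.y) + h.y • f' (0, 1, -(2 * A.x))
      + h.z • f' (0, 0, 1) := by
    rw [e]; simp only [map_add, map_smul]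
  simp only [Function.comp_apply, e2, HorizHom.ofPair, mul_x, mul_y, mul_z]
  have e3 : (A.x, A.y, A.z) + φ h
      = (A.x + h.x, A.y + h.y, A.z + h.z + 2 * (h.x * A.y) - 2 * (A.x * h.y)) := by
    simp only [hφ, Prod.mk_add_mk]; ring_nf
  rw [e3]
  abel

/-- Along `δ_t P` with `t → 0` both sides scale by `t`, so a local Lipschitz bound at `A` becomes a
bound of the differential on the whole group. -/
lemma HasHorizDerivAt.norm_le_of_eventually_le {F : Heis → Plane} {L : HorizHom} {A : Heis}
    (hF : HasHorizDerivAt F L A) {κ : ℝ}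
    (h : ∀ᶠ h in 𝓝 (1 : Heis), ‖F (A * h) - F A‖ ≤ κ * rho h) (P : Heis) :
    ‖L.toFun P‖ ≤ κ * rho P := by
  refine le_of_forall_pos_le_add fun ε hε => ?_
  have hε' : 0 < ε / (rho P + 1) := div_pos hε (by linarith [rho_nonneg P])
  have hc : Continuous fun t : ℝ => dilate t P := by
    refine continuous_iff_coord.2 ⟨?_, ?_, ?_⟩ <;> simp only [dilate] <;> fun_prop
  have ht : Tendsto (fun t : ℝ => dilate t P) (𝓝[>] 0) (𝓝 1) := by
    have := hc.tendsto 0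
    rw [show dilate 0 P = 1 by ext <;> simp [dilate]] at this
    exact this.mono_left nhdsWithin_le_nhds
  have h1 := ht.eventually (h.and (hF.bound hε'))
  obtain ⟨t, ⟨h2, h3⟩, ht0⟩ := (h1.and self_mem_nhdsWithin).exists
  have ht0 : 0 < t := ht0
  rw [rho_dilate ht0.le] at h2
  rw [Real.norm_of_nonneg (rho_nonneg _), rho_dilate ht0.le, L.map_dilate t ht0] at h3
  have h4 : ‖t • L.toFun P‖ ≤ κ * (t * rho P) + ε / (rho P + 1) * (t * rho P) := by
    have := norm_sub_le (F (A * dilate t P) - F A)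
      (F (A * dilate t P) - F A - t • L.toFun P)
    rw [sub_sub_cancel] at this
    linarith
  rw [norm_smul, Real.norm_of_nonneg ht0.le] at h4
  have h5 : ε / (rho P + 1) * rho P ≤ ε := by
    rw [div_mul_eq_mul_div, div_le_iff₀ (by linarith [rho_nonneg P])]
    nlinarith [rho_nonneg P]
  refine le_of_mul_le_mul_left ?_ ht0
  nlinarith

/-! ### Differentiation under the integral sign -/

section ParametricIntegral

variable {H E : Type*} [NormedAddCommGroup H] [NormedSpace ℝ H] [ProperSpace H]
  [NormedAddCommGroup E] [NormedSpace ℝ E]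

/-- Differentiation under the integral sign for a kernel with continuous partial derivative on
`V × ℝ`, with continuity of the derivative. -/
lemma hasFDerivAt_intervalIntegral_of_continuousOn {V : Set H} (hV : IsOpen V) {F : H → ℝ → E}
    {F' : H → ℝ → H →L[ℝ] E} (a b : ℝ) (hF : ContinuousOn (Function.uncurry F) (V ×ˢ univ))
    (hF' : ContinuousOn (Function.uncurry F') (V ×ˢ univ))
    (hd : ∀ p ∈ V, ∀ t, HasFDerivAt (fun p => F p t) (F' p t) p) {p : H} (hp : p ∈ V) :
    HasFDerivAt (fun p => ∫ t in a..b, F p t) (∫ t in a..b, F' p t) p ∧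
      ContinuousAt (fun p => ∫ t in a..b, F' p t) p := by
  obtain ⟨r, hr, hrV⟩ := Metric.nhds_basis_closedBall.mem_iff.1 (hV.mem_nhds hp)
  have hKV : Metric.closedBall p r ×ˢ uIcc a b ⊆ V ×ˢ (univ : Set ℝ) :=
    prod_mono hrV (subset_univ _)
  have hK : IsCompact (Metric.closedBall p r ×ˢ uIcc a b) :=
    (isCompact_closedBall p r).prod isCompact_uIcc
  obtain ⟨B, hB⟩ := hK.exists_bound_of_continuousOn (hF'.mono hKV)
  have hs : Metric.closedBall p r ∈ 𝓝 p := Metric.closedBall_mem_nhds p hr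
  have hsec : ∀ q ∈ V, Continuous (F q) := fun q hq => by
    refine continuous_iff_continuousAt.2 fun t => ?_
    exact (hF.continuousAt ((hV.prod isOpen_univ).mem_nhds ⟨hq, mem_univ t⟩)).comp
      (f := fun t => (q, t)) (by fun_prop)
  have hsec' : ∀ q ∈ V, Continuous (F' q) := fun q hq => by
    refine continuous_iff_continuousAt.2 fun t => ?_
    exact (hF'.continuousAt ((hV.prod isOpen_univ).mem_nhds ⟨hq, mem_univ t⟩)).comp
      (f := fun t => (q, t)) (by fun_prop)
  have hbd : ∀ q ∈ Metric.closedBall p r, ∀ t ∈ uIoc a b, ‖F' q t‖ ≤ B := fun q hq t ht =>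
    hB (q, t) ⟨hq, uIoc_subset_uIcc ht⟩
  have hmem : ∀ᶠ q in 𝓝 p, q ∈ Metric.closedBall p r := hs
  constructor
  · refine intervalIntegral.hasFDerivAt_integral_of_dominated_of_fderiv_le
      (bound := fun _ => B) hs ?_ ((hsec p hp).intervalIntegrable _ _)
      (hsec' p hp).aestronglyMeasurable ?_ intervalIntegrable_const ?_
    · filter_upwards [hmem] with q hq using (hsec q (hrV hq)).aestronglyMeasurable
    · exact Eventually.of_forall fun t ht q hq => hbd q hq t ht
    · exact Eventually.of_forall fun t _ q hq => hd q (hrV hq) t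
  · refine intervalIntegral.continuousAt_of_dominated_interval (bound := fun _ => B) ?_ ?_
      intervalIntegrable_const ?_
    · filter_upwards [hmem] with q hq using (hsec' q (hrV hq)).aestronglyMeasurable
    · filter_upwards [hmem] with q hq
      exact Eventually.of_forall fun t ht => hbd q hq t ht
    · refine Eventually.of_forall fun t _ => ?_
      exact (hF'.continuousAt ((hV.prod isOpen_univ).mem_nhds ⟨hp, mem_univ t⟩)).comp
        (f := fun q => (q, t)) (by fun_prop)

end ParametricIntegral

/-! ### The Korányi gauge, a polynomial substitute for `ρ_∞⁴` -/

namespace Heis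

/-- The fourth power of the Korányi norm. -/
def koranyi (A : Heis) : ℝ := (A.x ^ 2 + A.y ^ 2) ^ 2 + A.z ^ 2

lemma rho_pow_four_le_koranyi (A : Heis) : rho A ^ 4 ≤ koranyi A := by
  have h : rho A ^ 2 ≤ √(koranyi A) := by
    rcases max_choice √(A.x ^ 2 + A.y ^ 2) √|A.z| with h | h <;> rw [rho, h]
    · rw [Real.sq_sqrt (by positivity)]
      exact Real.le_sqrt_of_sq_le (by unfold koranyi; nlinarith [sq_nonneg A.z])
    · rw [Real.sq_sqrt (abs_nonneg _)]
      exact Real.le_sqrt_of_sq_le (by rw [sq_abs]; unfold koranyi; nlinarith [sq_nonneg (A.x ^ 2 + A.y ^ 2)])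
  calc rho A ^ 4 = (rho A ^ 2) ^ 2 := by ring
    _ ≤ √(koranyi A) ^ 2 := by gcongr
    _ = koranyi A := Real.sq_sqrt (by unfold koranyi; positivity)

lemma koranyi_le (A : Heis) : koranyi A ≤ 2 * rho A ^ 4 := by
  have h1 := hor_sq_le A
  have h2 := abs_z_le A
  have h3 : (A.x ^ 2 + A.y ^ 2) ^ 2 ≤ (rho A ^ 2) ^ 2 := by gcongr
  have h4 : |A.z| ^ 2 ≤ (rho A ^ 2) ^ 2 := by gcongr
  rw [sq_abs] at h4
  unfold koranyi
  nlinarith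

lemma rho_pos {A : Heis} (h : A ≠ 1) : 0 < rho A :=
  lt_of_le_of_ne (rho_nonneg A) fun h' => h (eq_one_of_rho_eq_zero h'.symm)

lemma koranyi_pos {A : Heis} (h : A ≠ 1) : 0 < koranyi A :=
  (pow_pos (rho_pos h) 4).trans_le (rho_pow_four_le_koranyi A)

/-- `koranyi` is homogeneous of degree 4, so a right translation by `h` changes it by `O(ρ(h)
ρ(q)³)`. In the proof `u` and `v` are the increments of `x² + y²` and of `z`. -/
lemma abs_koranyi_mul_sub_le {q h : Heis} (hh : rho h ≤ rho q) :
    |koranyi (q * h) - koranyi q| ≤ 70 * rho h * rho q ^ 3 := by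
  set R := rho q
  set η := rho h
  have hη : 0 ≤ η := rho_nonneg h
  have hR : 0 ≤ R := rho_nonneg q
  have a1 := abs_x_le q
  have a2 := abs_y_le q
  have b1 := abs_x_le h
  have b2 := abs_y_le h
  have s1 := hor_sq_le q
  have s2 := hor_sq_le h
  have z1 := abs_z_le q
  have z2 := abs_z_le h
  have hηη : η ^ 2 ≤ η * R := by nlinarith
  have m1 : |q.x * h.x| ≤ η * R := by rw [abs_mul, mul_comm η]; gcongr
  have m2 : |q.y * h.y| ≤ η * R := by rw [abs_mul, mul_comm η]; gcongr
  have m3 : |h.x * q.y| ≤ η * R := by rw [abs_mul]; gcongr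
  have m4 : |q.x * h.y| ≤ η * R := by rw [abs_mul, mul_comm η]; gcongr
  rw [abs_le] at m1 m2 m3 m4 z1 z2
  have hRR : η * R ≤ R ^ 2 := by nlinarith
  set u := 2 * (q.x * h.x) + 2 * (q.y * h.y) + (h.x ^ 2 + h.y ^ 2) with hu
  set v := h.z + 2 * (h.x * q.y) - 2 * (q.x * h.y) with hv
  set S := q.x ^ 2 + q.y ^ 2 with hS
  have hu' : |u| ≤ 5 * (η * R) := abs_le.2 ⟨by nlinarith [sq_nonneg h.x, sq_nonneg h.y], by linarith⟩
  have hv' : |v| ≤ 5 * (η * R) := abs_le.2 ⟨by linarith, by linarith⟩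
  have hS0 : 0 ≤ S := by positivity
  have hu2 : |2 * S + u| ≤ 7 * R ^ 2 := by
    rw [abs_le] at hu' ⊢
    constructor <;> linarith
  have hv2 : |2 * q.z + v| ≤ 7 * R ^ 2 := by
    rw [abs_le] at hv' ⊢
    constructor <;> linarith
  have e : koranyi (q * h) - koranyi q = u * (2 * S + u) + v * (2 * q.z + v) := by
    simp only [koranyi, mul_x, mul_y, mul_z, hu, hv, hS]; ring
  calc |koranyi (q * h) - koranyi q| ≤ |u| * |2 * S + u| + |v| * |2 * q.z + v| := by
        rw [e, ← abs_mul, ← abs_mul]; exact abs_add_le _ _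
    _ ≤ 5 * (η * R) * (7 * R ^ 2) + 5 * (η * R) * (7 * R ^ 2) := by gcongr
    _ = _ := by ring

end Heis

/-! ### Parametrizations by vertical displacement -/

/-- A parametrization of a compact piece of a vertical curve, normalized so that time is comparable
with the vertical displacement. -/
structure IsVerticalParam (T : ℝ) (c : ℝ → Heis) : Prop where
  pos : 0 < T
  cont : Continuous c
  mem : ∀ t, c t ∈ c '' Icc 0 T
  z_bound : ∀ s ∈ Icc 0 T, ∀ t ∈ Icc 0 T, s ≤ t →
    (t - s) / 2 ≤ ((c s)⁻¹ * c t).z ∧ ((c s)⁻¹ * c t).z ≤ 2 * (t - s)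
  holder : ∃ K, ∀ s ∈ Icc 0 T, ∀ t ∈ Icc 0 T, ‖proj (c t) - proj (c s)‖ ^ 2 ≤ K * |t - s|
  small : ∀ ε > 0, ∃ δ > 0, ∀ s ∈ Icc 0 T, ∀ t ∈ Icc 0 T, |t - s| ≤ δ →
    ‖proj (c t) - proj (c s)‖ ^ 2 ≤ ε * |t - s|
  mid : c (T / 2) = 1

namespace IsVerticalParam

variable {T : ℝ} {c : ℝ → Heis}

lemma proj_inv_mul (A B : Heis) : proj (A⁻¹ * B) = proj B - proj A := by
  ext i; fin_cases i <;> simp [proj] <;> ring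

lemma half_le_dist_sq (hc : IsVerticalParam T c) {s t : ℝ} (hs : s ∈ Icc 0 T) (ht : t ∈ Icc 0 T) :
    |t - s| ≤ 2 * dist (c s) (c t) ^ 2 := by
  wlog hst : s ≤ t generalizing s t
  · rw [abs_sub_comm, dist_comm]; exact this ht hs (le_of_not_ge hst)
  have h1 := (hc.z_bound s hs t ht hst).1
  have h2 := (le_abs_self _).trans (abs_z_le ((c s)⁻¹ * c t))
  rw [abs_of_nonneg (by linarith), dist_comm, dist_eq_rho]
  linarith

/-- Stated for an arbitrary map because the continuity required by `IsVerticalParam` is itself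
deduced from this bound. -/
lemma exists_dist_sq_le_of_bounds {K : ℝ}
    (hz : ∀ s ∈ Icc 0 T, ∀ t ∈ Icc 0 T, s ≤ t →
      (t - s) / 2 ≤ ((c s)⁻¹ * c t).z ∧ ((c s)⁻¹ * c t).z ≤ 2 * (t - s))
    (hK : ∀ s ∈ Icc 0 T, ∀ t ∈ Icc 0 T, ‖proj (c t) - proj (c s)‖ ^ 2 ≤ K * |t - s|) :
    ∃ K ≥ 1, ∀ s ∈ Icc 0 T, ∀ t ∈ Icc 0 T, dist (c s) (c t) ^ 2 ≤ K * |t - s| := by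
  refine ⟨max K 2, (by norm_num : (1 : ℝ) ≤ 2).trans (le_max_right _ _), fun s hs t ht => ?_⟩
  wlog hst : s ≤ t generalizing s t
  · rw [abs_sub_comm, dist_comm]; exact this t ht s hs (le_of_not_ge hst)
  have h1 := hz s hs t ht hst
  have h2 := hK s hs t ht
  rw [abs_of_nonneg (sub_nonneg.2 hst)] at h2 ⊢
  have h3 : K * (t - s) ≤ max K 2 * (t - s) := by gcongr; exact le_max_left _ _
  have h4 : 2 * (t - s) ≤ max K 2 * (t - s) := by gcongr; exact le_max_right _ _
  rw [dist_comm, dist_eq_rho]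
  have h5 : 0 ≤ max K 2 * (t - s) :=
    mul_nonneg (zero_le_two.trans (le_max_right _ _)) (sub_nonneg.2 hst)
  have h6 : rho ((c s)⁻¹ * c t) ≤ √(max K 2 * (t - s)) := by
    refine max_le ?_ ?_ <;> apply Real.sqrt_le_sqrt
    · rw [← norm_proj_sq, proj_inv_mul]; linarith
    · exact abs_le.2 ⟨by linarith, by linarith⟩
  calc _ ≤ √(max K 2 * (t - s)) ^ 2 := by gcongr; exact rho_nonneg _
    _ = _ := Real.sq_sqrt h5

lemma exists_dist_sq_le (hc : IsVerticalParam T c) :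
    ∃ K ≥ 1, ∀ s ∈ Icc 0 T, ∀ t ∈ Icc 0 T, dist (c s) (c t) ^ 2 ≤ K * |t - s| :=
  hc.holder.elim fun _ hK => exists_dist_sq_le_of_bounds hc.z_bound hK

lemma isCompact_image (hc : IsVerticalParam T c) : IsCompact (c '' Icc 0 T) :=
  isCompact_Icc.image hc.cont

lemma nonempty_image (hc : IsVerticalParam T c) : (c '' Icc 0 T).Nonempty :=
  (nonempty_Icc.2 hc.pos.le).image c

lemma exists_nearest (hc : IsVerticalParam T c) (P : Heis) :
    ∃ t ∈ Icc 0 T, Metric.infDist P (c '' Icc 0 T) = dist P (c t) := by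
  obtain ⟨_, ⟨t, ht, rfl⟩, h⟩ := hc.isCompact_image.exists_infDist_eq_dist hc.nonempty_image P
  exact ⟨t, ht, h⟩

lemma infDist_pos (hc : IsVerticalParam T c) {P : Heis} (hP : P ∉ c '' Icc 0 T) :
    0 < Metric.infDist P (c '' Icc 0 T) :=
  (hc.isCompact_image.isClosed.notMem_iff_infDist_pos hc.nonempty_image).1 hP

lemma infDist_le (hc : IsVerticalParam T c) (P : Heis) (t : ℝ) :
    Metric.infDist P (c '' Icc 0 T) ≤ dist P (c t) :=
  Metric.infDist_le_dist_of_mem (hc.mem t)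

/-- Horizontal displacements along the curve are negligible with respect to the distance. -/
lemma exists_norm_proj_sub_le (hc : IsVerticalParam T c) {ε : ℝ} (hε : 0 < ε) :
    ∃ r > 0, ∀ s ∈ Icc 0 T, ∀ t ∈ Icc 0 T, dist (c s) (c t) < r →
      ‖proj (c t) - proj (c s)‖ ≤ ε * dist (c s) (c t) := by
  obtain ⟨δ, hδ, h⟩ := hc.small (ε ^ 2 / 2) (by positivity)
  refine ⟨√(δ / 2), by positivity, fun s hs t ht hst => ?_⟩
  have h1 := hc.half_le_dist_sq hs ht
  have h2 : dist (c s) (c t) ^ 2 < δ / 2 := (Real.lt_sqrt dist_nonneg).1 hst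
  have h3 := h s hs t ht (by linarith)
  refine le_of_sq_le_sq ?_ (by positivity)
  nlinarith [sq_nonneg ε]

/-! ### Weights decaying like the inverse eighth power of the distance -/

/-- The interpolation weight. -/
noncomputable def weight (c : ℝ → Heis) (P : Heis) (t : ℝ) : ℝ := ((koranyi ((c t)⁻¹ * P)) ^ 2)⁻¹

lemma inv_mul_ne_one (hc : IsVerticalParam T c) {P : Heis} (hP : P ∉ c '' Icc 0 T) (t : ℝ) :
    (c t)⁻¹ * P ≠ 1 := fun h => hP (by rw [← inv_mul_eq_one.1 h]; exact hc.mem t)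

lemma weight_pos (hc : IsVerticalParam T c) {P : Heis} (hP : P ∉ c '' Icc 0 T) (t : ℝ) :
    0 < weight c P t :=
  inv_pos.2 (pow_pos (koranyi_pos (hc.inv_mul_ne_one hP t)) 2)

lemma continuous_weight (hc : IsVerticalParam T c) {P : Heis} (hP : P ∉ c '' Icc 0 T) :
    Continuous (weight c P) := by
  have h1 := hc.cont
  have hx := continuous_x
  have hy := continuous_y
  have hz := continuous_z
  have hg : Continuous koranyi := by unfold koranyi; fun_prop
  unfold weight
  refine Continuous.inv₀ (by fun_prop) fun t => ?_
  exact (pow_pos (koranyi_pos (hc.inv_mul_ne_one hP t)) 2).ne'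

/-- The total mass of the interpolation weight. -/
noncomputable def mass (T : ℝ) (c : ℝ → Heis) (P : Heis) : ℝ := ∫ t in (0 : ℝ)..T, weight c P t

lemma mass_pos (hc : IsVerticalParam T c) {P : Heis} (hP : P ∉ c '' Icc 0 T) : 0 < mass T c P :=
  intervalIntegral.intervalIntegral_pos_of_pos ((hc.continuous_weight hP).intervalIntegrable _ _)
    (hc.weight_pos hP) hc.pos

/-- As `c s` is a nearest point, the triangle inequality gives `dist (c s) (c t) ≤ 2 dist P (c t)`,
and time is controlled by the squared distance along the curve. With `le_weight`, the weight is thus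
comparable with `(d² + |t - s|)⁻⁴`. -/
lemma le_dist_sq (hc : IsVerticalParam T c) {P : Heis} {s t : ℝ} (hs : s ∈ Icc 0 T)
    (ht : t ∈ Icc 0 T) (hPs : Metric.infDist P (c '' Icc 0 T) = dist P (c s)) :
    (dist P (c s) ^ 2 + |t - s|) / 16 ≤ dist P (c t) ^ 2 := by
  have h1 := hc.half_le_dist_sq hs ht
  have h2 : dist P (c s) ≤ dist P (c t) := hPs ▸ hc.infDist_le P t
  have h3 : dist (c s) (c t) ≤ 2 * dist P (c t) := by
    have := dist_triangle_left (c s) (c t) P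
    linarith
  have h4 : dist (c s) (c t) ^ 2 ≤ (2 * dist P (c t)) ^ 2 := by gcongr
  have h5 : dist P (c s) ^ 2 ≤ dist P (c t) ^ 2 := by gcongr
  nlinarith

lemma weight_le (hc : IsVerticalParam T c) {P : Heis} (hP : P ∉ c '' Icc 0 T) {s t : ℝ}
    (hs : s ∈ Icc 0 T) (ht : t ∈ Icc 0 T) (hPs : Metric.infDist P (c '' Icc 0 T) = dist P (c s)) :
    weight c P t ≤ 16 ^ 4 * ((dist P (c s) ^ 2 + |t - s|) ^ 4)⁻¹ := by
  have hd : 0 < dist P (c s) := hPs ▸ hc.infDist_pos hP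
  have h1 := hc.le_dist_sq hs ht hPs
  have h2 := rho_pow_four_le_koranyi ((c t)⁻¹ * P)
  rw [← dist_eq_rho] at h2
  have h3 : 0 < (dist P (c s) ^ 2 + |t - s|) / 16 := by positivity
  have h4 : ((dist P (c s) ^ 2 + |t - s|) / 16) ^ 4 ≤ koranyi ((c t)⁻¹ * P) ^ 2 :=
    calc _ ≤ (dist P (c t) ^ 2) ^ 4 := by gcongr
      _ = (dist P (c t) ^ 4) ^ 2 := by ring
      _ ≤ _ := by gcongr
  calc weight c P t ≤ (((dist P (c s) ^ 2 + |t - s|) / 16) ^ 4)⁻¹ := inv_anti₀ (by positivity) h4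
    _ = _ := by rw [div_pow, inv_div, div_eq_mul_inv]

lemma le_weight (hc : IsVerticalParam T c) {K : ℝ} (hK1 : 1 ≤ K)
    (hK : ∀ s ∈ Icc 0 T, ∀ t ∈ Icc 0 T, dist (c s) (c t) ^ 2 ≤ K * |t - s|) {P : Heis}
    (hP : P ∉ c '' Icc 0 T) {s t : ℝ} (hs : s ∈ Icc 0 T) (ht : t ∈ Icc 0 T) :
    (4 * (2 * K) ^ 4)⁻¹ * ((dist P (c s) ^ 2 + |t - s|) ^ 4)⁻¹ ≤ weight c P t := by
  have h2 := koranyi_le ((c t)⁻¹ * P)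
  rw [← dist_eq_rho] at h2
  have hg := koranyi_pos (hc.inv_mul_ne_one hP t)
  have h1 : dist P (c t) ^ 2 ≤ 2 * K * (dist P (c s) ^ 2 + |t - s|) := by
    have h3 : dist P (c t) ^ 2 ≤ (dist P (c s) + dist (c s) (c t)) ^ 2 := by
      gcongr; exact dist_triangle _ _ _
    have h4 := hK s hs t ht
    nlinarith [sq_nonneg (dist P (c s) - dist (c s) (c t)), sq_nonneg (dist P (c s))]
  rw [← mul_inv]
  refine inv_anti₀ (by positivity) ?_
  calc koranyi ((c t)⁻¹ * P) ^ 2 ≤ (2 * dist P (c t) ^ 4) ^ 2 := by gcongr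
    _ = 4 * (dist P (c t) ^ 2) ^ 4 := by ring
    _ ≤ 4 * (2 * K * (dist P (c s) ^ 2 + |t - s|)) ^ 4 := by gcongr
    _ = _ := by ring

lemma integral_inv_sq_le {D a : ℝ} (hD : 0 < D) (ha : 0 ≤ a) :
    ∫ u in (0 : ℝ)..a, ((D + u) ^ 2)⁻¹ ≤ D⁻¹ := by
  have h : ∀ u ∈ uIcc 0 a, HasDerivAt (fun u => -(D + u)⁻¹) (((D + u) ^ 2)⁻¹) u := by
    intro u hu
    rw [uIcc_of_le ha] at hu
    have h1 : D + u ≠ 0 := by linarith [hu.1]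
    have := (((hasDerivAt_id u).const_add D).inv h1).neg
    simp only [neg_div, neg_neg, one_div] at this
    exact this
  rw [intervalIntegral.integral_eq_sub_of_hasDerivAt h]
  · have : 0 ≤ (D + a)⁻¹ := by positivity
    simp; linarith
  · refine ContinuousOn.intervalIntegrable ?_
    rw [uIcc_of_le ha]
    refine ContinuousOn.inv₀ (by fun_prop) fun u hu => ?_
    have : 0 < D + u := by linarith [hu.1]
    positivity

lemma integral_inv_sq_abs_le {D s : ℝ} (hD : 0 < D) (hs : s ∈ Icc 0 T) :
    ∫ t in (0 : ℝ)..T, ((D + |t - s|) ^ 2)⁻¹ ≤ 2 * D⁻¹ := by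
  have hcont : Continuous fun t => ((D + |t - s|) ^ 2)⁻¹ :=
    Continuous.inv₀ (by fun_prop) fun t => by positivity
  rw [← intervalIntegral.integral_add_adjacent_intervals (b := s)
    (hcont.intervalIntegrable _ _) (hcont.intervalIntegrable _ _)]
  have h1 : ∫ t in (0 : ℝ)..s, ((D + |t - s|) ^ 2)⁻¹ = ∫ u in (0 : ℝ)..s, ((D + u) ^ 2)⁻¹ := by
    have := intervalIntegral.integral_comp_sub_left (a := 0) (b := s)
      (fun u => ((D + u) ^ 2)⁻¹) s
    rw [sub_self, sub_zero] at this
    rw [← this]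
    refine intervalIntegral.integral_congr fun t ht => ?_
    rw [uIcc_of_le hs.1] at ht
    rw [abs_of_nonpos (by linarith [ht.2]), neg_sub]
  have h2 : ∫ t in s..T, ((D + |t - s|) ^ 2)⁻¹ = ∫ u in (0 : ℝ)..(T - s), ((D + u) ^ 2)⁻¹ := by
    have := intervalIntegral.integral_comp_sub_right (a := s) (b := T)
      (fun u => ((D + u) ^ 2)⁻¹) s
    rw [sub_self] at this
    rw [← this]
    refine intervalIntegral.integral_congr fun t ht => ?_
    rw [uIcc_of_le hs.2] at ht
    rw [abs_of_nonneg (by linarith [ht.1])]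
  rw [h1, h2]
  have := integral_inv_sq_le hD hs.1
  have := integral_inv_sq_le hD (sub_nonneg.2 hs.2)
  linarith

/-- First moment of the weight around a nearest point. -/
lemma exists_integral_weight_mul_abs_le (hc : IsVerticalParam T c) :
    ∃ C > 0, ∀ P ∉ c '' Icc 0 T, ∀ s ∈ Icc 0 T,
      Metric.infDist P (c '' Icc 0 T) = dist P (c s) → dist P (c s) ^ 2 ≤ T / 2 →
      ∫ t in (0 : ℝ)..T, weight c P t * |t - s| ≤ C * dist P (c s) ^ 2 * mass T c P := by
  obtain ⟨K, hK1, hK⟩ := hc.exists_dist_sq_le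
  have hK0 : 0 < K := by linarith
  refine ⟨16 ^ 4 * 2 * (16 * (4 * (2 * K) ^ 4)), by positivity, fun P hP s hs hPs hd => ?_⟩
  have hd0 : 0 < dist P (c s) := hPs ▸ hc.infDist_pos hP
  set D := dist P (c s) ^ 2 with hD
  have hD0 : 0 < D := by positivity
  have hwc := hc.continuous_weight hP
  -- Against `(D + u)⁻⁴`, where `u = |t - s|` and `D = d²`, the first moment is at most of order
  -- `D⁻²`, while the mass below is at least of order `D⁻³`.
  have up : ∫ t in (0 : ℝ)..T, weight c P t * |t - s| ≤ 16 ^ 4 * D⁻¹ * (2 * D⁻¹) := by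
    calc ∫ t in (0 : ℝ)..T, weight c P t * |t - s|
        ≤ ∫ t in (0 : ℝ)..T, 16 ^ 4 * D⁻¹ * ((D + |t - s|) ^ 2)⁻¹ := by
          refine intervalIntegral.integral_mono_on hc.pos.le
            ((by fun_prop : Continuous fun t => weight c P t * |t - s|).intervalIntegrable _ _)
            ((Continuous.intervalIntegrable (continuous_const.mul
              (Continuous.inv₀ (by fun_prop) fun t => by positivity)) _ _)) fun t ht => ?_
          have h1 := hc.weight_le hP hs ht hPs
          rw [← hD] at h1
          have hu : 0 ≤ |t - s| := abs_nonneg _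
          calc weight c P t * |t - s| ≤ 16 ^ 4 * ((D + |t - s|) ^ 4)⁻¹ * |t - s| := by gcongr
            _ ≤ 16 ^ 4 * ((D + |t - s|) ^ 4)⁻¹ * (D + |t - s|) := by gcongr; linarith
            _ = 16 ^ 4 * (D + |t - s|)⁻¹ * ((D + |t - s|) ^ 2)⁻¹ := by
              have : D + |t - s| ≠ 0 := by positivity
              field_simp
            _ ≤ 16 ^ 4 * D⁻¹ * ((D + |t - s|) ^ 2)⁻¹ := by gcongr; linarith
      _ = 16 ^ 4 * D⁻¹ * ∫ t in (0 : ℝ)..T, ((D + |t - s|) ^ 2)⁻¹ :=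
          intervalIntegral.integral_const_mul _ _
      _ ≤ _ := by gcongr; exact integral_inv_sq_abs_le hD0 hs
  have low : (16 * (4 * (2 * K) ^ 4))⁻¹ * (D ^ 3)⁻¹ ≤ mass T c P := by
    -- An interval of length `D` with an endpoint at `s` fits into `[0, T]` on one side, since `D ≤
    -- T / 2`. On it the weight has its maximal order `D⁻⁴`.
    obtain ⟨a, b, ha, hb, hab, hle⟩ : ∃ a b, 0 ≤ a ∧ b ≤ T ∧ b - a = D ∧
        ∀ t ∈ Icc a b, |t - s| ≤ D := by
      rcases le_total s (T / 2) with h | h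
      · exact ⟨s, s + D, hs.1, by linarith, by ring, fun t ht =>
          abs_le.2 ⟨by linarith [ht.1], by linarith [ht.2]⟩⟩
      · exact ⟨s - D, s, by linarith, hs.2, by ring, fun t ht =>
          abs_le.2 ⟨by linarith [ht.1], by linarith [ht.2]⟩⟩
    have hab' : a ≤ b := by linarith
    calc (16 * (4 * (2 * K) ^ 4))⁻¹ * (D ^ 3)⁻¹
        = ∫ _ in a..b, (4 * (2 * K) ^ 4)⁻¹ * ((D + D) ^ 4)⁻¹ := by
          rw [intervalIntegral.integral_const, hab, smul_eq_mul]
          field_simp; norm_num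
      _ ≤ ∫ t in a..b, weight c P t := by
          refine intervalIntegral.integral_mono_on hab' intervalIntegrable_const
            (hwc.intervalIntegrable _ _) fun t ht => ?_
          refine le_trans ?_ (hc.le_weight hK1 hK hP hs (t := t)
            ⟨ha.trans ht.1, ht.2.trans hb⟩)
          have := hle t ht
          rw [← hD]
          gcongr
      _ ≤ mass T c P := by
          refine intervalIntegral.integral_mono_interval ha hab' hb
            (Eventually.of_forall fun t => (hc.weight_pos hP t).le) (hwc.intervalIntegrable _ _)
  calc _ ≤ 16 ^ 4 * D⁻¹ * (2 * D⁻¹) := up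
    _ = 16 ^ 4 * 2 * (16 * (4 * (2 * K) ^ 4)) * D *
        ((16 * (4 * (2 * K) ^ 4))⁻¹ * (D ^ 3)⁻¹) := by field_simp
    _ ≤ _ := by gcongr

/-- The weighted mean oscillation of the horizontal projection around a nearest point is small with
respect to the distance. -/
lemma exists_integral_oscillation_le (hc : IsVerticalParam T c) {ε : ℝ} (hε : 0 < ε) :
    ∃ r > 0, ∀ P ∉ c '' Icc 0 T, Metric.infDist P (c '' Icc 0 T) < r → ∃ s ∈ Icc 0 T,
      Metric.infDist P (c '' Icc 0 T) = dist P (c s) ∧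
      ∫ t in (0 : ℝ)..T, weight c P t * ‖proj (c t) - proj (c s)‖
        ≤ ε * Metric.infDist P (c '' Icc 0 T) * mass T c P := by
  obtain ⟨C, hC, hmom⟩ := hc.exists_integral_weight_mul_abs_le
  set ε' := ε / (1 + C) with hε'
  have hε'0 : 0 < ε' := by positivity
  obtain ⟨δ, hδ, hsmall⟩ := hc.small (ε' ^ 2) (by positivity)
  obtain ⟨K, hK⟩ := hc.holder
  -- The constant `B` serves for `|t - s| > δ`, where the global Hölder bound `√(K |t - s|)` is
  -- dominated by a linear one.
  set B := √(max K 0 / δ) with hB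
  have hB0 : 0 ≤ B := Real.sqrt_nonneg _
  have hT := hc.pos
  refine ⟨min (√(T / 2)) (ε / (2 * (B * C + 1))), by positivity, fun P hP hPr => ?_⟩
  obtain ⟨s, hs, hPs⟩ := hc.exists_nearest P
  refine ⟨s, hs, hPs, ?_⟩
  have hd0 : 0 < dist P (c s) := hPs ▸ hc.infDist_pos hP
  rw [hPs] at hPr ⊢
  set d := dist P (c s) with hd
  have hdT : d ^ 2 ≤ T / 2 := by
    have := (Real.lt_sqrt hd0.le).1 (hPr.trans_le (min_le_left _ _))
    exact this.le
  have hdr : d * (2 * (B * C + 1)) ≤ ε :=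
    (le_div_iff₀ (by positivity)).1 (hPr.le.trans (min_le_right _ _))
  have hwc := hc.continuous_weight hP
  have hW := hc.mass_pos hP
  have hm := hmom P hP s hs hPs hdT
  have hpc : Continuous fun t => proj (c t) := by
    have h1 := hc.cont
    have hx := continuous_x
    have hy := continuous_y
    unfold proj
    fun_prop
  have key : ∀ t ∈ Icc 0 T, ‖proj (c t) - proj (c s)‖
      ≤ ε' * d / 2 + (ε' / (2 * d) + B) * |t - s| := by
    intro t ht
    have hu : 0 ≤ |t - s| := abs_nonneg _
    rcases le_or_gt |t - s| δ with h | h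
    · have h1 := hsmall s hs t ht h
      -- Arithmetic-geometric mean: `ε' √|t - s|` is linearized at the scale `|t - s| = d²`, so that
      -- the first moment suffices.
      have h2 : ‖proj (c t) - proj (c s)‖ ≤ ε' * d / 2 + ε' / (2 * d) * |t - s| := by
        refine le_of_sq_le_sq (h1.trans ?_) (by positivity)
        have : (ε' * d / 2 + ε' / (2 * d) * |t - s|) ^ 2 - ε' ^ 2 * |t - s|
            = (ε' * d / 2 - ε' / (2 * d) * |t - s|) ^ 2 := by field_simp; ring
        nlinarith [sq_nonneg (ε' * d / 2 - ε' / (2 * d) * |t - s|)]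
      nlinarith [mul_nonneg hB0 hu]
    · have h1 : ‖proj (c t) - proj (c s)‖ ≤ B * |t - s| := by
        refine le_of_sq_le_sq ((hK s hs t ht).trans ?_) (by positivity)
        rw [mul_pow, hB, Real.sq_sqrt (by positivity)]
        have h2 : 1 ≤ |t - s| / δ := (one_le_div hδ).2 h.le
        calc K * |t - s| ≤ max K 0 * |t - s| := by gcongr; exact le_max_left _ _
          _ ≤ max K 0 * |t - s| * (|t - s| / δ) := le_mul_of_one_le_right (by positivity) h2
          _ = _ := by ring
      have : 0 ≤ ε' * d / 2 + ε' / (2 * d) * |t - s| := by positivity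
      nlinarith
  calc ∫ t in (0 : ℝ)..T, weight c P t * ‖proj (c t) - proj (c s)‖
      ≤ ∫ t in (0 : ℝ)..T, (ε' * d / 2 * weight c P t
          + (ε' / (2 * d) + B) * (weight c P t * |t - s|)) := by
        refine intervalIntegral.integral_mono_on hc.pos.le
          ((by fun_prop : Continuous _).intervalIntegrable _ _)
          ((by fun_prop : Continuous _).intervalIntegrable _ _) fun t ht => ?_
        calc _ ≤ weight c P t * (ε' * d / 2 + (ε' / (2 * d) + B) * |t - s|) :=
              mul_le_mul_of_nonneg_left (key t ht) (hc.weight_pos hP t).le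
          _ = _ := by ring
    _ = ε' * d / 2 * mass T c P
          + (ε' / (2 * d) + B) * ∫ t in (0 : ℝ)..T, weight c P t * |t - s| := by
        rw [intervalIntegral.integral_add ((by fun_prop : Continuous _).intervalIntegrable _ _)
          ((by fun_prop : Continuous _).intervalIntegrable _ _),
          intervalIntegral.integral_const_mul, intervalIntegral.integral_const_mul, mass]
    _ ≤ ε' * d / 2 * mass T c P + (ε' / (2 * d) + B) * (C * d ^ 2 * mass T c P) := by gcongr
    _ = (ε' * (1 + C) / 2 + B * C * d) * d * mass T c P := by field_simp; ring
    _ ≤ ε * d * mass T c P := by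
        have : ε' * (1 + C) = ε := by rw [hε']; field_simp
        rw [this]
        gcongr
        nlinarith

/-! ### Extension of the projection by weighted averages -/

open Classical in
/-- The extension of the horizontal projection from the curve by weighted averages. -/
noncomputable def projExt (T : ℝ) (c : ℝ → Heis) (P : Heis) : Plane :=
  if P ∈ c '' Icc 0 T then proj P
  else (mass T c P)⁻¹ • ∫ t in (0 : ℝ)..T, weight c P t • proj (c t)

lemma projExt_of_mem {P : Heis} (hP : P ∈ c '' Icc 0 T) : projExt T c P = proj P := if_pos hP

lemma projExt_of_notMem {P : Heis} (hP : P ∉ c '' Icc 0 T) :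
    projExt T c P = (mass T c P)⁻¹ • ∫ t in (0 : ℝ)..T, weight c P t • proj (c t) := if_neg hP

lemma continuous_proj : Continuous proj := by
  have hx := continuous_x
  have hy := continuous_y
  unfold proj
  fun_prop

/-- The normalized weights have total mass one, so constants pass through the average; `v` will be
the value at a nearest point, which leaves only oscillations. -/
lemma projExt_sub (hc : IsVerticalParam T c) {P : Heis} (hP : P ∉ c '' Icc 0 T) (v : Plane) :
    projExt T c P - v
      = (mass T c P)⁻¹ • ∫ t in (0 : ℝ)..T, weight c P t • (proj (c t) - v) := by
  have hwc := hc.continuous_weight hP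
  have hpc := continuous_proj.comp hc.cont
  have hW := hc.mass_pos hP
  have h1 : Continuous fun t => weight c P t • proj (c t) := hwc.smul hpc
  have h2 : Continuous fun t => weight c P t • v := hwc.smul continuous_const
  simp only [smul_sub]
  rw [intervalIntegral.integral_sub (h1.intervalIntegrable _ _) (h2.intervalIntegrable _ _), intervalIntegral.integral_smul_const,
    projExt_of_notMem hP, smul_sub, ← mass, smul_smul (mass T c P)⁻¹, inv_mul_cancel₀ hW.ne',
    one_smul]

lemma norm_integral_weight_smul_le (hc : IsVerticalParam T c) {P : Heis} (hP : P ∉ c '' Icc 0 T)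
    (v : Plane) : ‖∫ t in (0 : ℝ)..T, weight c P t • (proj (c t) - v)‖
      ≤ ∫ t in (0 : ℝ)..T, weight c P t * ‖proj (c t) - v‖ := by
  refine (intervalIntegral.norm_integral_le_integral_norm hc.pos.le).trans_eq ?_
  refine intervalIntegral.integral_congr fun t _ => ?_
  simp only [norm_smul, Real.norm_of_nonneg (hc.weight_pos hP t).le]

/-- Off the curve, the extension is close to its value at a nearest point. -/
lemma exists_norm_projExt_sub_le (hc : IsVerticalParam T c) {ε : ℝ} (hε : 0 < ε) :
    ∃ r > 0, ∀ P ∉ c '' Icc 0 T, Metric.infDist P (c '' Icc 0 T) < r → ∃ s ∈ Icc 0 T,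
      Metric.infDist P (c '' Icc 0 T) = dist P (c s) ∧
      ‖projExt T c P - proj (c s)‖ ≤ ε * dist P (c s) := by
  obtain ⟨r, hr, h⟩ := hc.exists_integral_oscillation_le hε
  refine ⟨r, hr, fun P hP hPr => ?_⟩
  obtain ⟨s, hs, hPs, hle⟩ := h P hP hPr
  refine ⟨s, hs, hPs, ?_⟩
  have hW := hc.mass_pos hP
  rw [hc.projExt_sub hP, norm_smul, Real.norm_of_nonneg (inv_pos.2 hW).le, inv_mul_le_iff₀ hW]
  rw [hPs] at hle
  linarith [hc.norm_integral_weight_smul_le hP (proj (c s))]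

/-- At the points of the curve, the increments of the extension are uniformly negligible. -/
lemma exists_norm_projExt_mul_sub_le (hc : IsVerticalParam T c) {ε : ℝ} (hε : 0 < ε) :
    ∃ r > 0, ∀ A ∈ c '' Icc 0 T, ∀ h : Heis, rho h < r →
      ‖projExt T c (A * h) - projExt T c A‖ ≤ ε * rho h := by
  obtain ⟨r₁, hr₁, h₁⟩ := hc.exists_norm_projExt_sub_le (half_pos hε)
  obtain ⟨r₂, hr₂, h₂⟩ := hc.exists_norm_proj_sub_le (by positivity : 0 < ε / 4)
  refine ⟨min r₁ (r₂ / 2), by positivity, ?_⟩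
  rintro _ ⟨a, ha, rfl⟩ h hh
  have hd : dist (c a * h) (c a) = rho h := dist_mul_left_self _ _
  have hh1 := hh.trans_le (min_le_left _ _)
  have hh2 := hh.trans_le (min_le_right _ _)
  have h0 := rho_nonneg h
  rw [projExt_of_mem (mem_image_of_mem c ha)]
  by_cases hP : c a * h ∈ c '' Icc 0 T
  · rw [projExt_of_mem hP]
    obtain ⟨b, hb, hbe⟩ := hP
    rw [← hbe] at hd ⊢
    rw [dist_comm] at hd
    have := h₂ a ha b hb (by rw [hd]; linarith)
    rw [hd] at this
    nlinarith
  · have hi : Metric.infDist (c a * h) (c '' Icc 0 T) ≤ rho h := hd ▸ hc.infDist_le _ a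
    obtain ⟨s, hs, hPs, hle⟩ := h₁ _ hP (hi.trans_lt hh1)
    rw [hPs] at hi
    -- The point nearest to `c a * h` is no farther from it than `c a`, hence within `2 ρ(h)` of `c
    -- a`.
    have h3 : dist (c a) (c s) ≤ 2 * rho h := by
      have := dist_triangle_left (c a) (c s) (c a * h)
      linarith
    have h4 := h₂ a ha s hs (by linarith)
    calc ‖projExt T c (c a * h) - proj (c a)‖
        ≤ ‖projExt T c (c a * h) - proj (c s)‖ + ‖proj (c s) - proj (c a)‖ :=
          norm_sub_le_norm_sub_add_norm_sub _ _ _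
      _ ≤ ε / 2 * dist (c a * h) (c s) + ε / 4 * dist (c a) (c s) := add_le_add hle h4
      _ ≤ ε / 2 * rho h + ε / 4 * (2 * rho h) := by gcongr
      _ = ε * rho h := by ring

/-- The weight is homogeneous of degree `-8` in `(c t)⁻¹ * P`, so its relative variation is `O(ρ(h)
/ ρ((c t)⁻¹ * P))`, and the denominator is at least the distance `d` to the curve, whatever `t`. -/
lemma abs_weight_mul_sub_le (hc : IsVerticalParam T c) {P : Heis} (hP : P ∉ c '' Icc 0 T) {h : Heis}
    (hh : 140 * rho h ≤ Metric.infDist P (c '' Icc 0 T)) (t : ℝ) :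
    |weight c (P * h) t - weight c P t|
      ≤ 700 * (rho h / Metric.infDist P (c '' Icc 0 T)) * weight c P t := by
  set d := Metric.infDist P (c '' Icc 0 T)
  have hd : 0 < d := hc.infDist_pos hP
  have hdR : d ≤ rho ((c t)⁻¹ * P) := by rw [← dist_eq_rho]; exact hc.infDist_le P t
  have h0 := rho_nonneg h
  have h1 := abs_koranyi_mul_sub_le (q := (c t)⁻¹ * P) (h := h) (by linarith)
  have h2 := rho_pow_four_le_koranyi ((c t)⁻¹ * P)
  unfold weight
  rw [← mul_assoc]
  set R := rho ((c t)⁻¹ * P)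
  set M := koranyi ((c t)⁻¹ * P)
  set M' := koranyi ((c t)⁻¹ * P * h)
  have hR : 0 < R := hd.trans_le hdR
  have hM : 0 < M := (pow_pos hR 4).trans_le h2
  set x := 70 * (rho h / d) with hx
  have hx0 : 0 ≤ x := by positivity
  have hx1 : x ≤ 1 / 2 := by
    rw [hx, ← mul_div_assoc, div_le_iff₀ hd]; linarith
  have h3 : |M' - M| ≤ x * M := by
    refine h1.trans ?_
    calc 70 * rho h * R ^ 3 = 70 * (rho h / R) * R ^ 4 := by field_simp
      _ ≤ 70 * (rho h / d) * M := by gcongr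
  have h4 := abs_le.1 h3
  have hM' : M / 2 ≤ M' := by nlinarith
  have hM'0 : 0 < M' := by linarith
  have e : (M' ^ 2)⁻¹ - (M ^ 2)⁻¹ = (M - M') * (M + M') * ((M' ^ 2)⁻¹ * (M ^ 2)⁻¹) := by
    field_simp
    ring
  rw [e, abs_mul, abs_mul, abs_sub_comm, abs_of_pos (by positivity : 0 < M + M'),
    abs_of_pos (by positivity : 0 < (M' ^ 2)⁻¹ * (M ^ 2)⁻¹)]
  have h5 : M + M' ≤ 5 / 2 * M := by nlinarith
  have h6 : (M' ^ 2)⁻¹ ≤ ((M / 2) ^ 2)⁻¹ := by gcongr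
  calc |M' - M| * (M + M') * ((M' ^ 2)⁻¹ * (M ^ 2)⁻¹)
      ≤ x * M * (5 / 2 * M) * (((M / 2) ^ 2)⁻¹ * (M ^ 2)⁻¹) := by gcongr
    _ = 10 * x * (M ^ 2)⁻¹ := by field_simp; ring
    _ = _ := by rw [hx]; ring

/-- Off the curve and near it, the extension has a small local Lipschitz constant. -/
lemma exists_eventually_norm_projExt_mul_sub_le (hc : IsVerticalParam T c) {ε : ℝ} (hε : 0 < ε) :
    ∃ r > 0, ∀ P ∉ c '' Icc 0 T, Metric.infDist P (c '' Icc 0 T) < r →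
      ∀ᶠ h in 𝓝 (1 : Heis), ‖projExt T c (P * h) - projExt T c P‖ ≤ ε * rho h := by
  -- The constant is `2800 = 4 · 700`: the relative variation of the weights is `κ = 700 ρ(h) / d`,
  -- and the quotient rule costs a factor 4.
  obtain ⟨r, hr, hosc⟩ := hc.exists_integral_oscillation_le (by positivity : 0 < ε / 2800)
  refine ⟨r, hr, fun P hP hPr => ?_⟩
  obtain ⟨s, hs, hPs, hle⟩ := hosc P hP hPr
  set d := Metric.infDist P (c '' Icc 0 T) with hdd
  have hd : 0 < d := hc.infDist_pos hP
  filter_upwards [eventually_rho_lt (by positivity : 0 < d / 1400)] with h hh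
  have h0 := rho_nonneg h
  have hQ : P * h ∉ c '' Icc 0 T := by
    intro hQ
    have h1 := Metric.infDist_le_dist_of_mem (x := P) hQ
    rw [dist_comm, dist_mul_left_self] at h1
    linarith
  set κ := 700 * (rho h / d) with hκ
  have hκ0 : 0 ≤ κ := by positivity
  have hκ1 : κ ≤ 1 / 2 := by
    rw [hκ, ← mul_div_assoc, div_le_iff₀ hd]; linarith
  have hw := hc.abs_weight_mul_sub_le hP (h := h) (by rw [← hdd]; linarith)
  rw [← hdd, ← hκ] at hw
  have hwP := hc.continuous_weight hP
  have hwQ := hc.continuous_weight hQ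
  have hpc := continuous_proj.comp hc.cont
  set W := mass T c P with hW
  set W' := mass T c (P * h) with hW'
  have hW0 : 0 < W := hc.mass_pos hP
  have hmass : |W' - W| ≤ κ * W := by
    rw [hW, hW', mass, mass, ← intervalIntegral.integral_sub (hwQ.intervalIntegrable _ _)
      (hwP.intervalIntegrable _ _), ← intervalIntegral.integral_const_mul]
    refine (intervalIntegral.abs_integral_le_integral_abs hc.pos.le).trans ?_
    exact intervalIntegral.integral_mono_on hc.pos.le
      ((hwQ.sub hwP).abs.intervalIntegrable _ _) ((hwP.const_mul κ).intervalIntegrable _ _)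
      fun t _ => hw t
  have hW'1 : W / 2 ≤ W' := by nlinarith [(abs_le.1 hmass).1]
  have hW'0 : 0 < W' := by linarith
  set v := proj (c s)
  set I := ∫ t in (0 : ℝ)..T, weight c P t * ‖proj (c t) - v‖
  set a := ∫ t in (0 : ℝ)..T, weight c (P * h) t • (proj (c t) - v) with ha
  set b := ∫ t in (0 : ℝ)..T, weight c P t • (proj (c t) - v) with hb
  have hbI : ‖b‖ ≤ I := hc.norm_integral_weight_smul_le hP v
  have hpv : Continuous fun t => proj (c t) - v := hpc.sub continuous_const
  have hQv : Continuous fun t => weight c (P * h) t • (proj (c t) - v) := hwQ.smul hpv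
  have hPv : Continuous fun t => weight c P t • (proj (c t) - v) := hwP.smul hpv
  have hab : ‖a - b‖ ≤ κ * I := by
    rw [ha, hb, ← intervalIntegral.integral_sub (hQv.intervalIntegrable _ _)
      (hPv.intervalIntegrable _ _), ← intervalIntegral.integral_const_mul]
    refine (intervalIntegral.norm_integral_le_integral_norm hc.pos.le).trans ?_
    refine intervalIntegral.integral_mono_on hc.pos.le
      ((hQv.sub hPv).norm.intervalIntegrable _ _)
      (((hwP.mul hpv.norm).const_mul κ).intervalIntegrable _ _) fun t _ => ?_
    rw [← sub_smul, norm_smul, Real.norm_eq_abs, ← mul_assoc]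
    exact mul_le_mul_of_nonneg_right (hw t) (norm_nonneg _)
  -- Variation of the integral and of the mass are separated. With `v` subtracted both terms carry
  -- the factor `I ≤ (ε / 2800) d W`, whose `d` cancels the `1 / d` in `κ`.
  have e : projExt T c (P * h) - projExt T c P
      = W'⁻¹ • (a - b) + ((W - W') * (W'⁻¹ * W⁻¹)) • b := by
    rw [← sub_sub_sub_cancel_right _ _ v, hc.projExt_sub hQ, hc.projExt_sub hP, ← ha, ← hb,
      ← hW, ← hW', smul_sub]
    have : (W - W') * (W'⁻¹ * W⁻¹) = W'⁻¹ - W⁻¹ := by field_simp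
    rw [this, sub_smul]
    abel
  have hI0 : 0 ≤ I := (norm_nonneg b).trans hbI
  have hinv : W'⁻¹ ≤ 2 * W⁻¹ := by
    calc W'⁻¹ ≤ (W / 2)⁻¹ := by gcongr
      _ = _ := by field_simp
  calc ‖projExt T c (P * h) - projExt T c P‖
      ≤ ‖W'⁻¹ • (a - b)‖ + ‖((W - W') * (W'⁻¹ * W⁻¹)) • b‖ := by rw [e]; exact norm_add_le _ _
    _ = W'⁻¹ * ‖a - b‖ + |W' - W| * (W'⁻¹ * W⁻¹) * ‖b‖ := by
        rw [norm_smul, norm_smul, Real.norm_of_nonneg (by positivity), Real.norm_eq_abs, abs_mul,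
          abs_of_pos (by positivity : 0 < W'⁻¹ * W⁻¹), abs_sub_comm]
    _ ≤ 2 * W⁻¹ * (κ * I) + κ * W * (2 * W⁻¹ * W⁻¹) * I := by gcongr
    _ = 4 * κ * W⁻¹ * I := by field_simp; ring
    _ ≤ 4 * κ * W⁻¹ * (ε / 2800 * d * W) := by gcongr
    _ = ε * rho h := by rw [hκ]; field_simp; norm_num; ring

/-! ### Smoothness of the extension off the curve -/

/-- The weight as a function of the coordinates of both points. -/
noncomputable def coordKernel (r : (ℝ × ℝ × ℝ) × ℝ × ℝ × ℝ) : ℝ :=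
  ((koranyi ((coordHomeo.symm r.2)⁻¹ * coordHomeo.symm r.1)) ^ 2)⁻¹

lemma contDiff_coord_koranyi : ContDiff ℝ 1 fun r : (ℝ × ℝ × ℝ) × ℝ × ℝ × ℝ =>
    koranyi ((coordHomeo.symm r.2)⁻¹ * coordHomeo.symm r.1) := by
  simp only [koranyi, coordHomeo, Homeomorph.symm, Homeomorph.homeomorph_mk_coe, Equiv.symm,
    Equiv.coe_fn_mk, mul_x, mul_y, mul_z, inv_x, inv_y, inv_z]
  fun_prop

/-- The kernel is `C¹` in both points wherever the gauge does not vanish. The curve enters only as a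
continuous parameter, so its roughness does not matter and one may differentiate under the integral.
-/
lemma contDiffAt_integral_weight (hc : IsVerticalParam T c) {E : Type*} [NormedAddCommGroup E]
    [NormedSpace ℝ E] {ψ : ℝ → E} (hψ : Continuous ψ) {P : Heis} (hP : P ∉ c '' Icc 0 T) :
    ContDiffAt ℝ 1 (fun p => ∫ t in (0 : ℝ)..T, weight c (coordHomeo.symm p) t • ψ t)
      (coordHomeo P) := by
  set V : Set (ℝ × ℝ × ℝ) := coordHomeo.symm ⁻¹' (c '' Icc 0 T)ᶜ with hVdef
  have hV : IsOpen V := hc.isCompact_image.isClosed.isOpen_compl.preimage coordHomeo.symm.continuous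
  set O : Set ((ℝ × ℝ × ℝ) × ℝ × ℝ × ℝ) :=
    {r | koranyi ((coordHomeo.symm r.2)⁻¹ * coordHomeo.symm r.1) ≠ 0}
  have hO : IsOpen O := isOpen_ne_fun contDiff_coord_koranyi.continuous continuous_const
  have hk : ContDiffOn ℝ 1 coordKernel O := fun r hr =>
    ((contDiff_coord_koranyi.contDiffAt.pow 2).inv (pow_ne_zero 2 hr)).contDiffWithinAt
  have hk' := hk.continuousOn_fderiv_of_isOpen hO le_rfl
  have hcc : Continuous fun t => coordHomeo (c t) := coordHomeo.continuous.comp hc.cont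
  have hmem : ∀ p ∈ V, ∀ t, (p, coordHomeo (c t)) ∈ O := by
    intro p hp t
    simp only [O, mem_ofPred_eq, Homeomorph.symm_apply_apply]
    exact (koranyi_pos (hc.inv_mul_ne_one hp t)).ne'
  have hmaps : MapsTo (fun q : (ℝ × ℝ × ℝ) × ℝ => (q.1, coordHomeo (c q.2))) (V ×ˢ univ) O :=
    fun q hq => hmem q.1 hq.1 q.2
  have hmapc : ContinuousOn (fun q : (ℝ × ℝ × ℝ) × ℝ => (q.1, coordHomeo (c q.2)))
      (V ×ˢ univ) := (continuous_fst.prodMk (hcc.comp continuous_snd)).continuousOn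
  set F' : ℝ × ℝ × ℝ → ℝ → (ℝ × ℝ × ℝ) →L[ℝ] E := fun p t =>
    ((fderiv ℝ coordKernel (p, coordHomeo (c t))).comp
      (ContinuousLinearMap.inl ℝ (ℝ × ℝ × ℝ) (ℝ × ℝ × ℝ))).smulRight (ψ t) with hF'
  have hwk : ∀ p t, weight c (coordHomeo.symm p) t = coordKernel (p, coordHomeo (c t)) := by
    intro p t
    simp [weight, coordKernel]
  have key := fun {p : ℝ × ℝ × ℝ} (hp : p ∈ V) => hasFDerivAt_intervalIntegral_of_continuousOn hV
    (F := fun p t => weight c (coordHomeo.symm p) t • ψ t) (F' := F') 0 T ?_ ?_ ?_ hp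
  · refine contDiffAt_one_iff.2 ⟨fun p => ∫ t in (0 : ℝ)..T, F' p t, V, ?_, ?_, ?_⟩
    · exact hV.mem_nhds (by simpa [hVdef] using hP)
    · exact fun p hp => (key hp).2.continuousWithinAt
    · exact fun p hp => (key hp).1
  · simp only [hwk]
    exact (hk.continuousOn.comp hmapc hmaps).smul (by fun_prop)
  · have h1 : ContinuousOn (fun q : (ℝ × ℝ × ℝ) × ℝ =>
        fderiv ℝ coordKernel (q.1, coordHomeo (c q.2))) (V ×ˢ univ) := hk'.comp hmapc hmaps
    have h2 := h1.clm_comp (continuousOn_const (c :=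
      ContinuousLinearMap.inl ℝ (ℝ × ℝ × ℝ) (ℝ × ℝ × ℝ)))
    exact ((ContinuousLinearMap.smulRightL ℝ (ℝ × ℝ × ℝ) E).continuous.comp_continuousOn
      h2).clm_apply (hψ.comp continuous_snd).continuousOn
  · intro p hp t
    have h2 : HasFDerivAt coordKernel (fderiv ℝ coordKernel (p, coordHomeo (c t)))
        (p, coordHomeo (c t)) :=
      ((hk.contDiffAt (hO.mem_nhds (hmem p hp t))).differentiableAt one_ne_zero).hasFDerivAt
    have h3 : HasFDerivAt (fun p : ℝ × ℝ × ℝ => (p, coordHomeo (c t)))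
      (ContinuousLinearMap.inl ℝ (ℝ × ℝ × ℝ) (ℝ × ℝ × ℝ)) p := hasFDerivAt_prodMk_left _ _
    simp only [hwk]
    exact (h2.comp p h3).smul_const (ψ t)

/-- The weighted average of the projection, in coordinates. -/
noncomputable def coordAverage (T : ℝ) (c : ℝ → Heis) (p : ℝ × ℝ × ℝ) : Plane :=
  (mass T c (coordHomeo.symm p))⁻¹ •
    ∫ t in (0 : ℝ)..T, weight c (coordHomeo.symm p) t • proj (c t)

lemma contDiffAt_coordAverage (hc : IsVerticalParam T c) {P : Heis} (hP : P ∉ c '' Icc 0 T) :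
    ContDiffAt ℝ 1 (coordAverage T c) (coordHomeo P) := by
  have h1 := hc.contDiffAt_integral_weight (ψ := fun _ => (1 : ℝ)) continuous_const hP
  have h2 := hc.contDiffAt_integral_weight (continuous_proj.comp hc.cont) hP
  simp only [smul_eq_mul, mul_one] at h1
  refine ContDiffAt.smul (ContDiffAt.inv h1 ?_) h2
  simpa [mass] using (hc.mass_pos hP).ne'

/-- The horizontal differential of the extension, off the curve. -/
noncomputable def projExtDeriv (T : ℝ) (c : ℝ → Heis) (P : Heis) : HorizHom :=
  HorizHom.ofPair (fderiv ℝ (coordAverage T c) (coordHomeo P) (1, 0, 2 * P.y))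
    (fderiv ℝ (coordAverage T c) (coordHomeo P) (0, 1, -(2 * P.x)))

lemma eventually_mul_notMem (hc : IsVerticalParam T c) {P : Heis} (hP : P ∉ c '' Icc 0 T) :
    ∀ᶠ h in 𝓝 (1 : Heis), P * h ∉ c '' Icc 0 T := by
  have h1 : Tendsto (fun h => P * h) (𝓝 1) (𝓝 P) := by
    simpa using (continuous_const_mul P).tendsto 1
  exact h1.eventually (hc.isCompact_image.isClosed.isOpen_compl.mem_nhds hP)

lemma hasHorizDerivAt_projExt (hc : IsVerticalParam T c) {P : Heis} (hP : P ∉ c '' Icc 0 T) :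
    HasHorizDerivAt (projExt T c) (projExtDeriv T c P) P := by
  have h1 := ((hc.contDiffAt_coordAverage hP).differentiableAt one_ne_zero).hasFDerivAt
  have h2 := HasFDerivAt.hasHorizDerivAt (A := P) h1
  refine Asymptotics.IsLittleO.congr' h2 ?_ EventuallyEq.rfl
  filter_upwards [hc.eventually_mul_notMem hP] with h hh
  rw [projExt_of_notMem hP, projExt_of_notMem hh]
  rfl

lemma proj_eq_ofPair (P : Heis) : proj P = (HorizHom.ofPair !₂[1, 0] !₂[0, 1]).toFun P := by
  ext i; fin_cases i <;> simp [proj, HorizHom.ofPair]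

/-! ### The defining function `π - projExt` -/

open Classical in
/-- The horizontal differential of `proj - projExt`. -/
noncomputable def defectDeriv (T : ℝ) (c : ℝ → Heis) (P : Heis) : HorizHom :=
  if P ∈ c '' Icc 0 T then HorizHom.ofPair !₂[1, 0] !₂[0, 1]
  else HorizHom.ofPair
    (!₂[1, 0] - fderiv ℝ (coordAverage T c) (coordHomeo P) (1, 0, 2 * P.y))
    (!₂[0, 1] - fderiv ℝ (coordAverage T c) (coordHomeo P) (0, 1, -(2 * P.x)))

lemma defectDeriv_of_mem {P : Heis} (hP : P ∈ c '' Icc 0 T) (Q : Heis) :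
    (defectDeriv T c P).toFun Q = proj Q := by
  rw [defectDeriv, if_pos hP, proj_eq_ofPair]

lemma defectDeriv_of_notMem {P : Heis} (hP : P ∉ c '' Icc 0 T) (Q : Heis) :
    (defectDeriv T c P).toFun Q = proj Q - (projExtDeriv T c P).toFun Q := by
  rw [defectDeriv, if_neg hP, proj_eq_ofPair]
  simp only [HorizHom.ofPair, projExtDeriv]
  module

lemma hasHorizDerivAt_defect (hc : IsVerticalParam T c) (A : Heis) :
    HasHorizDerivAt (fun P => proj P - projExt T c P) (defectDeriv T c A) A := by
  by_cases hA : A ∈ c '' Icc 0 T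
  · refine Asymptotics.IsLittleO.of_bound fun ε hε => ?_
    obtain ⟨r, hr, h⟩ := hc.exists_norm_projExt_mul_sub_le hε
    filter_upwards [eventually_rho_lt hr] with q hq
    rw [defectDeriv_of_mem hA, proj_mul, Real.norm_of_nonneg (rho_nonneg q)]
    refine le_of_eq_of_le ?_ (h A hA q hq)
    rw [← norm_neg]
    congr 1
    abel
  · refine Asymptotics.IsLittleO.congr' (hc.hasHorizDerivAt_projExt hA).neg_left
      (Eventually.of_forall fun q => ?_) EventuallyEq.rfl
    simp only
    rw [defectDeriv_of_notMem hA, proj_mul]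
    abel

/-- The small local Lipschitz constant of `projExt` near the curve passes to its differential. This
yields both the continuity of the differential at points of the curve and its surjectivity nearby.
-/
lemma exists_norm_defectDeriv_sub_le (hc : IsVerticalParam T c) {ε : ℝ} (hε : 0 < ε) :
    ∃ r > 0, ∀ P, Metric.infDist P (c '' Icc 0 T) < r → ∀ Q,
      ‖(defectDeriv T c P).toFun Q - proj Q‖ ≤ ε * rho Q := by
  obtain ⟨r, hr, h⟩ := hc.exists_eventually_norm_projExt_mul_sub_le hε
  refine ⟨r, hr, fun P hPr Q => ?_⟩
  by_cases hP : P ∈ c '' Icc 0 T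
  · rw [defectDeriv_of_mem hP, sub_self, norm_zero]
    exact mul_nonneg hε.le (rho_nonneg Q)
  · rw [defectDeriv_of_notMem hP, sub_sub_cancel_left, norm_neg]
    exact (hc.hasHorizDerivAt_projExt hP).norm_le_of_eventually_le (h P hP hPr) Q

lemma isC1HWith_defect (hc : IsVerticalParam T c) :
    IsC1HWith (fun P => proj P - projExt T c P) (defectDeriv T c) := by
  refine ⟨hc.hasHorizDerivAt_defect, fun A ε hε => ?_⟩
  by_cases hA : A ∈ c '' Icc 0 T
  · obtain ⟨r, hr, h⟩ := hc.exists_norm_defectDeriv_sub_le hε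
    filter_upwards [Metric.ball_mem_nhds A hr] with B hB Q
    rw [defectDeriv_of_mem hA]
    exact h B ((Metric.infDist_le_dist_of_mem hA).trans_lt hB) Q
  -- Off the closed set `Γ` the extension is `C¹` in the Euclidean sense, and the horizontal
  -- derivatives have continuous coefficients.
  · have h1 : ContinuousAt (fderiv ℝ (coordAverage T c)) (coordHomeo A) :=
      ((hc.contDiffAt_coordAverage hA).fderiv_right (m := 0) (by norm_num)).continuousAt
    have h2 : ContinuousAt (fun B : Heis => fderiv ℝ (coordAverage T c) (coordHomeo B)) A :=
      h1.comp (f := coordHomeo) coordHomeo.continuous.continuousAt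
    have hx := continuous_x
    have hy := continuous_y
    have h3 : ContinuousAt (fun B : Heis =>
        fderiv ℝ (coordAverage T c) (coordHomeo B) (1, 0, 2 * B.y)) A :=
      h2.clm_apply (by fun_prop)
    have h4 : ContinuousAt (fun B : Heis =>
        fderiv ℝ (coordAverage T c) (coordHomeo B) (0, 1, -(2 * B.x))) A :=
      h2.clm_apply (by fun_prop)
    have h5 := Metric.continuousAt_iff'.1 h3 (ε / 2) (by positivity)
    have h6 := Metric.continuousAt_iff'.1 h4 (ε / 2) (by positivity)
    have h7 : ∀ᶠ B in 𝓝 A, B ∉ c '' Icc 0 T :=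
      hc.isCompact_image.isClosed.isOpen_compl.mem_nhds hA
    filter_upwards [h5, h6, h7] with B h5 h6 h7 Q
    rw [defectDeriv_of_notMem hA, defectDeriv_of_notMem h7, sub_sub_sub_cancel_left]
    rw [dist_comm, dist_eq_norm] at h5 h6
    simp only [projExtDeriv, HorizHom.ofPair]
    rw [add_sub_add_comm, ← smul_sub, ← smul_sub]
    have h0 := rho_nonneg Q
    calc _ ≤ |Q.x| * (ε / 2) + |Q.y| * (ε / 2) := by
          refine (norm_add_le _ _).trans ?_
          rw [norm_smul, norm_smul, Real.norm_eq_abs, Real.norm_eq_abs]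
          gcongr
      _ ≤ rho Q * (ε / 2) + rho Q * (ε / 2) := by
          gcongr
          exacts [abs_x_le Q, abs_y_le Q]
      _ = ε * rho Q := by ring

/-! ### Tubes around the curve and vertical curves -/

/-- The horizontal element over a vector of the plane. -/
def ofPlane (v : Plane) : Heis := ⟨v 0, v 1, 0⟩

lemma proj_ofPlane (v : Plane) : proj (ofPlane v) = v := by
  ext i; fin_cases i <;> simp [proj, ofPlane]

lemma rho_ofPlane (v : Plane) : rho (ofPlane v) = ‖v‖ := by
  rw [rho_of_z_eq_zero rfl, proj_ofPlane]

lemma continuous_ofPlane : Continuous ofPlane := by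
  refine continuous_iff_coord.2 ⟨?_, ?_, ?_⟩ <;> simp only [ofPlane] <;> fun_prop

lemma eq_ofPlane {A : Heis} (h : A.z = 0) : A = ofPlane (proj A) := by
  ext <;> simp [ofPlane, proj, h]

/-- On horizontal elements `L` differs from the identity of the plane by a map of norm at most
`1/2`, hence is injective, hence onto by dimension. -/
lemma surjective_of_norm_sub_proj_le (L : HorizHom)
    (h : ∀ Q, ‖L.toFun Q - proj Q‖ ≤ 1 / 2 * rho Q) (a b : Plane)
    (hL : L = HorizHom.ofPair a b) : Function.Surjective L.toFun := by
  subst hL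
  let M : Plane →ₗ[ℝ] Plane :=
    { toFun := fun v => v 0 • a + v 1 • b
      map_add' := fun v w => by simp only [PiLp.add_apply]; module
      map_smul' := fun t v => by simp only [PiLp.smul_apply, smul_eq_mul, RingHom.id_apply]; module }
  have hM : ∀ v, M v = (HorizHom.ofPair a b).toFun (ofPlane v) := fun v => rfl
  have hinj : Function.Injective M := by
    refine (injective_iff_map_eq_zero M).2 fun v hv => ?_
    have h1 := h (ofPlane v)
    rw [← hM, hv, proj_ofPlane, rho_ofPlane, zero_sub, norm_neg] at h1
    exact norm_eq_zero.1 (le_antisymm (by linarith) (norm_nonneg v))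
  intro w
  obtain ⟨v, hv⟩ := LinearMap.injective_iff_surjective.1 hinj w
  exact ⟨ofPlane v, hv⟩

lemma exists_defectDeriv_eq_ofPair (P : Heis) : ∃ a b, defectDeriv T c P = HorizHom.ofPair a b := by
  unfold defectDeriv
  split_ifs
  exacts [⟨_, _, rfl⟩, ⟨_, _, rfl⟩]

lemma isSimpleArc (hc : IsVerticalParam T c) : IsSimpleArc (c '' Icc 0 T) := by
  have hT := hc.pos
  have himg : (fun t => T * t) '' Icc (0 : ℝ) 1 = Icc 0 T := by
    rw [image_mul_left_Icc hT.le zero_le_one, mul_zero, mul_one]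
  refine ⟨fun t => c (T * t), (hc.cont.comp (by fun_prop)).continuousOn, ?_, ?_⟩
  · intro s hs t ht hst
    have h1 := hc.half_le_dist_sq (himg ▸ mem_image_of_mem _ hs) (himg ▸ mem_image_of_mem _ ht)
    simp only at h1 hst
    rw [hst, dist_self] at h1
    have h2 : T * t - T * s = 0 := abs_eq_zero.1 (le_antisymm (by linarith) (abs_nonneg _))
    have h3 : T * (t - s) = 0 := by linarith
    rcases mul_eq_zero.1 h3 with h | h
    · exact absurd h hT.ne'
    · linarith
  · rw [← himg, image_image]

/-- Tubes of horizontal displacements are neighbourhoods of the centre of the curve. -/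
lemma tube_mem_nhds (hc : IsVerticalParam T c) {r : ℝ} (hr : 0 < r) :
    (fun q : ℝ × Plane => c q.1 * ofPlane q.2) '' (Icc 0 T ×ˢ Metric.closedBall 0 r) ∈ 𝓝 1 := by
  have hT := hc.pos
  obtain ⟨δ₀, hδ₀, hδ⟩ := Metric.continuousAt_iff.1 (hc.cont.continuousAt (x := T / 2)) (r / 2)
    (by positivity)
  rw [hc.mid] at hδ
  set δ := min (T / 2) (δ₀ / 2)
  have hδpos : 0 < δ := by positivity
  have hδT : δ ≤ T / 2 := min_le_left _ _
  have hδδ : δ ≤ δ₀ / 2 := min_le_right _ _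
  have hI : Icc (T / 2 - δ) (T / 2 + δ) ⊆ Icc 0 T := Icc_subset_Icc (by linarith) (by linarith)
  have hx := continuous_x
  have hy := continuous_y
  have hz := continuous_z
  have hcont : ∀ t, Continuous fun P : Heis => ((c t)⁻¹ * P).z := fun t => by fun_prop
  have hmem : T / 2 ∈ Icc 0 T := ⟨by linarith, by linarith⟩
  -- As the curve rises through `1` at time `T / 2`, the height of `(c t)⁻¹ * P` changes sign near
  -- `T / 2` for `P` close to `1`. At a zero, `P` is a horizontal displacement of `c t`.
  have h1 : 0 < ((c (T / 2 - δ))⁻¹ * 1).z := by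
    have := (hc.z_bound (T / 2 - δ) (hI ⟨le_rfl, by linarith⟩) (T / 2) hmem (by linarith)).1
    rw [hc.mid] at this
    linarith
  have h2 : ((c (T / 2 + δ))⁻¹ * 1).z < 0 := by
    have := (hc.z_bound (T / 2) hmem (T / 2 + δ) (hI ⟨by linarith, le_rfl⟩) (by linarith)).1
    rw [hc.mid] at this
    simp only [inv_one, one_mul] at this
    simp only [mul_one, inv_z]
    linarith
  have e1 := continuousAt_const.eventually_lt (hcont (T / 2 - δ)).continuousAt h1
  have e2 := (hcont (T / 2 + δ)).continuousAt.eventually_lt continuousAt_const h2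
  filter_upwards [e1, e2, Metric.ball_mem_nhds (1 : Heis) (half_pos hr)] with P p1 p2 p3
  have hct : ContinuousOn (fun t => ((c t)⁻¹ * P).z) (Icc (T / 2 - δ) (T / 2 + δ)) := by
    exact (hz.comp ((hc.cont.inv).mul continuous_const)).continuousOn
  obtain ⟨t, ht, hzt⟩ := intermediate_value_Icc' (by linarith) hct
    (show (0 : ℝ) ∈ Icc _ _ from ⟨p2.le, p1.le⟩)
  refine ⟨(t, proj ((c t)⁻¹ * P)), ⟨hI ht, ?_⟩, ?_⟩
  · rw [mem_closedBall_zero_iff]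
    refine (norm_proj_le _).trans ?_
    rw [← dist_eq_rho]
    have h3 : dist (c t) 1 < r / 2 := hδ (by
      rw [Real.dist_eq]
      exact lt_of_le_of_lt (abs_le.2 ⟨by linarith [ht.1], by linarith [ht.2]⟩)
        (by linarith : δ < δ₀))
    have h4 : dist P 1 < r / 2 := p3
    linarith [dist_triangle_right P (c t) 1]
  · simp only
    rw [← eq_ofPlane hzt, mul_inv_cancel_left]

/-- `U` is a thin tube of horizontal displacements, on which the differential is within `1/2` of
`π`. The centring `c (T / 2) = 1` is what makes `U` a neighbourhood of `1`. -/
theorem isVerticalCurve (hc : IsVerticalParam T c) : IsVerticalCurve (c '' Icc 0 T) := by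
  obtain ⟨r₁, hr₁, h₁⟩ := hc.exists_norm_defectDeriv_sub_le (by norm_num : (0 : ℝ) < 1 / 2)
  obtain ⟨r₂, hr₂, h₂⟩ := hc.exists_norm_projExt_mul_sub_le (by norm_num : (0 : ℝ) < 1 / 2)
  set r := min r₁ r₂ / 2 with hr
  have hr0 : 0 < r := by positivity
  have hrr₁ : r < r₁ := by have := min_le_left r₁ r₂; have : 0 < min r₁ r₂ := by positivity
                           linarith
  have hrr₂ : r < r₂ := by have := min_le_right r₁ r₂; have : 0 < min r₁ r₂ := by positivity
                           linarith
  have hT := hc.pos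
  have hone : (1 : Heis) ∈ c '' Icc 0 T := hc.mid ▸ hc.mem _
  have hzero : ∀ P ∈ c '' Icc 0 T, proj P - projExt T c P = 0 := fun P hP => by
    rw [projExt_of_mem hP, sub_self]
  refine ⟨fun P => proj P - projExt T c P, defectDeriv T c, _, hc.isC1HWith_defect,
    hzero 1 hone, hc.tube_mem_nhds hr0, ?_, ?_, ?_, hc.isSimpleArc⟩
  · refine (isCompact_Icc.prod (isCompact_closedBall _ _)).image ?_
    have h3 := hc.cont
    have h4 := continuous_ofPlane
    fun_prop
  · rintro _ ⟨⟨t, v⟩, ⟨ht, hv⟩, rfl⟩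
    obtain ⟨a, b, hab⟩ := exists_defectDeriv_eq_ofPair (T := T) (c := c) (c t * ofPlane v)
    refine surjective_of_norm_sub_proj_le _ (h₁ _ ?_) a b hab
    refine (hc.infDist_le _ t).trans_lt ?_
    rw [dist_mul_left_self, rho_ofPlane]
    exact (mem_closedBall_zero_iff.1 hv).trans_lt hrr₁
  · refine Subset.antisymm ?_ ?_
    · rintro _ ⟨t, ht, rfl⟩
      refine ⟨⟨(t, 0), ⟨ht, Metric.mem_closedBall_self hr0.le⟩, ?_⟩, hzero _ ⟨t, ht, rfl⟩⟩
      have : ofPlane 0 = 1 := by ext <;> simp [ofPlane]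
      simp [this]
    · rintro _ ⟨⟨⟨t, v⟩, ⟨ht, hv⟩, rfl⟩, hF⟩
      -- If `F` vanishes at `c t * v`, the extension must move by `v` between `c t` and `c t * v`;
      -- but it moves by at most `‖v‖ / 2`, so `v = 0`.
      have h3 := h₂ (c t) ⟨t, ht, rfl⟩ (ofPlane v) (by
        rw [rho_ofPlane]; exact (mem_closedBall_zero_iff.1 hv).trans_lt hrr₂)
      have h4 : projExt T c (c t * ofPlane v) = proj (c t) + v := by
        rw [← sub_eq_zero.1 hF, proj_mul, proj_ofPlane]
      rw [h4, projExt_of_mem ⟨t, ht, rfl⟩, add_sub_cancel_left, rho_ofPlane] at h3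
      have h5 : v = 0 := norm_eq_zero.1 (le_antisymm (by linarith) (norm_nonneg v))
      refine ⟨t, ht, ?_⟩
      have : ofPlane 0 = 1 := by ext <;> simp [ofPlane]
      simp [h5, this]

end IsVerticalParam

/-! ### A dyadic sewing lemma -/

section Sewing

/-- The additivity defect of a function of two variables. -/
def sewDefect (Ξ : ℝ → ℝ → ℝ) (s u t : ℝ) : ℝ := Ξ s u + Ξ u t - Ξ s t

/-- The dyadic sums of a function of two variables up to time `t`. -/
noncomputable def dyadicSum (Ξ : ℝ → ℝ → ℝ) (n : ℕ) (t : ℝ) : ℝ :=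
  ∑ l ∈ Finset.range ⌊2 ^ n * t⌋₊, Ξ (l / 2 ^ n) ((l + 1) / 2 ^ n) + Ξ (⌊2 ^ n * t⌋₊ / 2 ^ n) t

/-- The difference of two consecutive dyadic sums, in terms of defects. -/
noncomputable def dyadicDefect (Ξ : ℝ → ℝ → ℝ) (n : ℕ) (t : ℝ) : ℝ :=
  ∑ l ∈ Finset.range ⌊2 ^ n * t⌋₊,
      sewDefect Ξ (l / 2 ^ n) ((2 * l + 1) / 2 ^ (n + 1)) ((l + 1) / 2 ^ n)
    + sewDefect Ξ (⌊2 ^ n * t⌋₊ / 2 ^ n) (⌊2 ^ (n + 1) * t⌋₊ / 2 ^ (n + 1)) t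

variable {Ξ : ℝ → ℝ → ℝ} {a : ℕ → ℝ}

lemma floor_two_pow_succ {n : ℕ} {t : ℝ} (ht : 0 ≤ t) :
    ⌊2 ^ (n + 1) * t⌋₊ = 2 * ⌊2 ^ n * t⌋₊ ∨ ⌊2 ^ (n + 1) * t⌋₊ = 2 * ⌊2 ^ n * t⌋₊ + 1 := by
  have h0 : 0 ≤ 2 ^ n * t := by positivity
  have h1 := Nat.floor_le h0
  have h2 := Nat.lt_floor_add_one (2 ^ n * t)
  have e : (2 : ℝ) ^ (n + 1) * t = 2 * (2 ^ n * t) := by ring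
  rw [e]
  have h3 : 2 * ⌊2 ^ n * t⌋₊ ≤ ⌊2 * (2 ^ n * t)⌋₊ := Nat.le_floor (by push_cast; linarith)
  have h4 : ⌊2 * (2 ^ n * t)⌋₊ < 2 * ⌊2 ^ n * t⌋₊ + 2 :=
    (Nat.floor_lt (by positivity)).2 (by push_cast; linarith)
  omega

/-- Each full block is halved. The last, incomplete block either acquires a new dyadic point or
keeps its left endpoint; in the latter case its defect is zero because `Ξ` vanishes on the diagonal.
-/
lemma dyadicSum_succ (hΞ : ∀ t, Ξ t t = 0) (n : ℕ) {t : ℝ} (ht : 0 ≤ t) :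
    dyadicSum Ξ (n + 1) t = dyadicSum Ξ n t + dyadicDefect Ξ n t := by
  have pairs : ∀ (f : ℕ → ℝ) (m : ℕ), ∑ l ∈ Finset.range (2 * m), f l
      = ∑ l ∈ Finset.range m, (f (2 * l) + f (2 * l + 1)) := by
    intro f m
    induction m with
    | zero => simp
    | succ m ih =>
      rw [Finset.sum_range_succ, ← ih, show 2 * (m + 1) = 2 * m + 1 + 1 by ring,
        Finset.sum_range_succ, Finset.sum_range_succ]
      ring
  have half : ∀ x : ℝ, 2 * x / 2 ^ (n + 1) = x / 2 ^ n := fun x => by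
    rw [pow_succ]; field_simp
  have sums : ∑ l ∈ Finset.range (2 * ⌊2 ^ n * t⌋₊), Ξ (l / 2 ^ (n + 1)) ((l + 1) / 2 ^ (n + 1))
      = ∑ l ∈ Finset.range ⌊2 ^ n * t⌋₊, Ξ (l / 2 ^ n) ((l + 1) / 2 ^ n)
        + ∑ l ∈ Finset.range ⌊2 ^ n * t⌋₊,
      sewDefect Ξ (l / 2 ^ n) ((2 * l + 1) / 2 ^ (n + 1)) ((l + 1) / 2 ^ n) := by
    rw [pairs, ← Finset.sum_add_distrib]
    refine Finset.sum_congr rfl fun l _ => ?_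
    push_cast
    rw [half, show (2 * (l : ℝ) + 1 + 1) = 2 * (l + 1) by ring, half, sewDefect]
    ring
  unfold dyadicSum dyadicDefect
  rcases floor_two_pow_succ (n := n) ht with h | h
  · rw [h, sums]
    push_cast
    rw [half, sewDefect, hΞ]
    ring
  · rw [h, Finset.sum_range_succ, sums]
    push_cast
    rw [half, sewDefect]
    ring

lemma floor_div_two_pow_le (n : ℕ) {t : ℝ} (ht : 0 ≤ t) : (⌊2 ^ n * t⌋₊ : ℝ) / 2 ^ n ≤ t := by
  rw [div_le_iff₀ (by positivity)]
  have := Nat.floor_le (a := 2 ^ n * t) (by positivity)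
  linarith

lemma lt_floor_add_one_div_two_pow (n : ℕ) (t : ℝ) : t < ((⌊2 ^ n * t⌋₊ : ℝ) + 1) / 2 ^ n := by
  rw [lt_div_iff₀ (by positivity)]
  have := Nat.lt_floor_add_one (2 ^ n * t)
  linarith

/-- At most `2 ^ k * (t - s) + 1` full blocks enter between `s` and `t`, and the two incomplete
blocks add one defect each. -/
lemma abs_dyadicDefect_sub_le
    (ha : ∀ k s u t, 0 ≤ s → s ≤ u → u ≤ t → t ≤ 1 → t - s ≤ (1 / 2) ^ k →
      |sewDefect Ξ s u t| ≤ a k)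
    (k : ℕ) {s t : ℝ} (hs : 0 ≤ s) (hst : s ≤ t) (ht : t ≤ 1) :
    |dyadicDefect Ξ k t - dyadicDefect Ξ k s| ≤ (2 ^ k * (t - s) + 3) * a k := by
  have hj : ⌊2 ^ k * s⌋₊ ≤ ⌊2 ^ k * t⌋₊ := by gcongr
  have part : ∀ r, 0 ≤ r → r ≤ 1 →
      |sewDefect Ξ (⌊2 ^ k * r⌋₊ / 2 ^ k) (⌊2 ^ (k + 1) * r⌋₊ / 2 ^ (k + 1)) r| ≤ a k := by
    intro r hr hr1
    refine ha k _ _ _ (by positivity) ?_ (floor_div_two_pow_le _ hr) hr1 ?_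
    · rw [div_le_div_iff₀ (by positivity) (by positivity)]
      have : 2 * ⌊2 ^ k * r⌋₊ ≤ ⌊2 ^ (k + 1) * r⌋₊ := by
        rcases floor_two_pow_succ (n := k) hr with h | h <;> omega
      have : 2 * (⌊2 ^ k * r⌋₊ : ℝ) ≤ ⌊2 ^ (k + 1) * r⌋₊ := by exact_mod_cast this
      calc _ = 2 * (⌊2 ^ k * r⌋₊ : ℝ) * 2 ^ k := by ring
        _ ≤ _ := by gcongr
    · have := lt_floor_add_one_div_two_pow k r
      rw [add_div] at this
      rw [one_div_pow]
      linarith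
  have hsum : |∑ l ∈ Finset.Ico ⌊2 ^ k * s⌋₊ ⌊2 ^ k * t⌋₊,
      sewDefect Ξ (l / 2 ^ k) ((2 * l + 1) / 2 ^ (k + 1)) ((l + 1) / 2 ^ k)|
      ≤ (⌊2 ^ k * t⌋₊ - ⌊2 ^ k * s⌋₊ : ℝ) * a k := by
    refine (Finset.abs_sum_le_sum_abs _ _).trans ?_
    refine (Finset.sum_le_card_nsmul _ _ (a k) fun l hl => ?_).trans_eq ?_
    · rw [Finset.mem_Ico] at hl
      refine ha k _ _ _ (by positivity) ?_ ?_ ?_ ?_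
      · rw [div_le_div_iff₀ (by positivity) (by positivity), pow_succ]
        nlinarith [show (0 : ℝ) < 2 ^ k by positivity]
      · rw [div_le_div_iff₀ (by positivity) (by positivity), pow_succ]
        nlinarith [show (0 : ℝ) < 2 ^ k by positivity]
      · refine le_trans ?_ ((floor_div_two_pow_le k (hs.trans hst)).trans ht)
        have : (l : ℝ) + 1 ≤ ⌊2 ^ k * t⌋₊ := by exact_mod_cast hl.2
        gcongr
      · rw [one_div_pow, add_div]
        linarith
    · rw [Nat.card_Ico, nsmul_eq_mul, Nat.cast_sub hj]
  have e : dyadicDefect Ξ k t - dyadicDefect Ξ k s = ∑ l ∈ Finset.Ico ⌊2 ^ k * s⌋₊ ⌊2 ^ k * t⌋₊,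
      sewDefect Ξ (l / 2 ^ k) ((2 * l + 1) / 2 ^ (k + 1)) ((l + 1) / 2 ^ k)
      + sewDefect Ξ (⌊2 ^ k * t⌋₊ / 2 ^ k) (⌊2 ^ (k + 1) * t⌋₊ / 2 ^ (k + 1)) t
      - sewDefect Ξ (⌊2 ^ k * s⌋₊ / 2 ^ k) (⌊2 ^ (k + 1) * s⌋₊ / 2 ^ (k + 1)) s := by
    rw [Finset.sum_Ico_eq_sub _ hj, dyadicDefect, dyadicDefect]
    ring
  have p1 := part t (hs.trans hst) ht
  have p2 := part s hs (hst.trans ht)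
  have ha0 : 0 ≤ a k := (abs_nonneg _).trans p1
  have f1 := Nat.floor_le (a := 2 ^ k * t) (by have := hs.trans hst; positivity)
  have f2 := Nat.lt_floor_add_one (2 ^ k * s)
  rw [e]
  rw [abs_le] at hsum p1 p2 ⊢
  have h3 : (⌊2 ^ k * t⌋₊ - ⌊2 ^ k * s⌋₊ : ℝ) * a k ≤ (2 ^ k * (t - s) + 1) * a k := by
    gcongr; linarith
  constructor <;> linarith

/-- At most one point of the grid `2⁻ⁿ ℕ` lies in `(s, t]`, so the comparison involves one or two
defects. -/
lemma abs_dyadicSum_sub_le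
    (ha : ∀ k s u t, 0 ≤ s → s ≤ u → u ≤ t → t ≤ 1 → t - s ≤ (1 / 2) ^ k →
      |sewDefect Ξ s u t| ≤ a k)
    (n : ℕ) {s t : ℝ} (hs : 0 ≤ s) (hst : s ≤ t) (ht : t ≤ 1)
    (hn : t - s ≤ (1 / 2) ^ n) :
    |dyadicSum Ξ n t - dyadicSum Ξ n s - Ξ s t| ≤ 2 * a n := by
  have ht0 := hs.trans hst
  have hp : (0 : ℝ) < 2 ^ n := by positivity
  have hj : ⌊2 ^ n * s⌋₊ ≤ ⌊2 ^ n * t⌋₊ := by gcongr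
  have hj2 : ⌊2 ^ n * t⌋₊ < ⌊2 ^ n * s⌋₊ + 2 := by
    refine (Nat.floor_lt (by positivity)).2 ?_
    have h1 := Nat.lt_floor_add_one (2 ^ n * s)
    rw [one_div_pow, le_div_iff₀ hp] at hn
    push_cast
    linarith
  have us := floor_div_two_pow_le n hs
  have ut := floor_div_two_pow_le n ht0
  have lt1 := lt_floor_add_one_div_two_pow n t
  have ls1 := lt_floor_add_one_div_two_pow n s
  have hhalf : (1 : ℝ) / 2 ^ n = (1 / 2) ^ n := by rw [one_div_pow]
  rcases (by omega : ⌊2 ^ n * t⌋₊ = ⌊2 ^ n * s⌋₊ ∨ ⌊2 ^ n * t⌋₊ = ⌊2 ^ n * s⌋₊ + 1) with h | h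
  · rw [h, add_div] at lt1
    have := ha n _ s t (by positivity) us hst ht (by linarith)
    rw [sewDefect] at this
    rw [dyadicSum, dyadicSum, h]
    rw [abs_le] at this ⊢
    constructor <;> linarith
  · rw [h] at ut
    push_cast at ut
    have h1 := ha n (⌊2 ^ n * s⌋₊ / 2 ^ n) s ((⌊2 ^ n * s⌋₊ + 1) / 2 ^ n) (by positivity) us ls1.le
      (ut.trans ht) (by rw [add_div]; linarith)
    have h2 := ha n s ((⌊2 ^ n * s⌋₊ + 1) / 2 ^ n) t hs ls1.le ut ht hn
    rw [sewDefect] at h1 h2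
    rw [dyadicSum, dyadicSum, h, Finset.sum_range_succ]
    push_cast
    rw [abs_le] at h1 h2 ⊢
    constructor <;> linarith

/-- A dyadic sewing lemma. -/
theorem exists_sewing (hΞ : ∀ t, Ξ t t = 0)
    (ha : ∀ k s u t, 0 ≤ s → s ≤ u → u ≤ t → t ≤ 1 → t - s ≤ (1 / 2) ^ k →
      |sewDefect Ξ s u t| ≤ a k)
    (hsum : Summable fun k => 2 ^ k * a k) :
    ∃ Z : ℝ → ℝ, ∀ n s t, 0 ≤ s → s ≤ t → t ≤ 1 → t - s ≤ (1 / 2) ^ n →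
      |Z t - Z s - Ξ s t| ≤ 11 * (∑' k, 2 ^ (k + n) * a (k + n)) * (t - s) := by
  have ha0 : ∀ k, 0 ≤ a k := fun k =>
    (abs_nonneg _).trans (ha k 0 0 0 le_rfl le_rfl le_rfl zero_le_one (by simp))
  have hterm : ∀ k, 0 ≤ 2 ^ k * a k := fun k => mul_nonneg (by positivity) (ha0 k)
  have hzero : ∀ k, dyadicDefect Ξ k 0 = 0 := fun k => by simp [dyadicDefect, sewDefect, hΞ]
  have hW : ∀ t, 0 ≤ t → t ≤ 1 → Summable fun k => dyadicDefect Ξ k t := by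
    intro t ht ht1
    refine Summable.of_norm_bounded (hsum.mul_left 4) fun k => ?_
    have h1 := abs_dyadicDefect_sub_le ha k le_rfl ht ht1
    rw [hzero, sub_zero, sub_zero] at h1
    have h2 : (1 : ℝ) ≤ 2 ^ k := one_le_pow₀ one_le_two
    rw [Real.norm_eq_abs]
    calc _ ≤ (2 ^ k * t + 3) * a k := h1
      _ ≤ (2 ^ k * 1 + 3 * 2 ^ k) * a k := by
        have := ha0 k
        gcongr
        linarith
      _ = _ := by ring
  set Z : ℝ → ℝ := fun t => dyadicSum Ξ 0 t + ∑' k, dyadicDefect Ξ k t with hZ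
  have hZn : ∀ n t, 0 ≤ t → t ≤ 1 →
      Z t = dyadicSum Ξ n t + ∑' k, dyadicDefect Ξ (k + n) t := by
    intro n t ht ht1
    have h1 : dyadicSum Ξ n t = dyadicSum Ξ 0 t + ∑ k ∈ Finset.range n, dyadicDefect Ξ k t := by
      induction n with
      | zero => simp
      | succ n ih => rw [dyadicSum_succ hΞ n ht, ih, Finset.sum_range_succ]; ring
    rw [h1, add_assoc, (hW t ht ht1).sum_add_tsum_nat_add]
  have htail : ∀ n, Summable fun k => 2 ^ (k + n) * a (k + n) := fun n =>
    (summable_nat_add_iff (f := fun k => 2 ^ k * a k) n).2 hsum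
  -- The case where `2⁻ⁿ` is the scale of `t - s` up to a factor 2: each additive constant is then
  -- absorbed by `1 ≤ 2 · 2ⁿ (t - s)`. This gives `7 = 1 + 3 · 2` for the defects and `4` for the
  -- initial sum, so `11` in all.
  have hlocal : ∀ n s t, 0 ≤ s → s ≤ t → t ≤ 1 → t - s ≤ (1 / 2) ^ n → (1 / 2) ^ (n + 1) < t - s →
      |Z t - Z s - Ξ s t| ≤ 11 * (∑' k, 2 ^ (k + n) * a (k + n)) * (t - s) := by
    intro n s t hs hst ht hn hn'
    have hs1 := hst.trans ht
    have ht0 := hs.trans hst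
    have hone : 1 ≤ 2 * 2 ^ n * (t - s) := by
      rw [one_div_pow, pow_succ, div_lt_iff₀ (by positivity)] at hn'
      linarith
    have h1 := abs_dyadicSum_sub_le ha n hs hst ht hn
    have sWt := (summable_nat_add_iff n).2 (hW t ht0 ht)
    have sWs := (summable_nat_add_iff n).2 (hW s hs hs1)
    have h2 : |∑' k, dyadicDefect Ξ (k + n) t - ∑' k, dyadicDefect Ξ (k + n) s|
        ≤ 7 * (t - s) * ∑' k, 2 ^ (k + n) * a (k + n) := by
      rw [← sWt.tsum_sub sWs, ← tsum_mul_left, ← Real.norm_eq_abs]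
      refine tsum_of_norm_bounded ((htail n).mul_left (7 * (t - s))).hasSum fun k => ?_
      rw [Real.norm_eq_abs]
      refine le_trans (abs_dyadicDefect_sub_le ha (k + n) hs hst ht) ?_
      have h3 : 1 ≤ 2 * 2 ^ (k + n) * (t - s) := by
        have h4 : (2 : ℝ) ^ n ≤ 2 ^ (k + n) := pow_le_pow_right₀ one_le_two (by omega)
        have : 0 ≤ t - s := sub_nonneg.2 hst
        calc 1 ≤ 2 * 2 ^ n * (t - s) := hone
          _ ≤ _ := by gcongr
      calc _ ≤ (2 ^ (k + n) * (t - s) + 3 * (2 * 2 ^ (k + n) * (t - s))) * a (k + n) := by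
            have := ha0 (k + n)
            gcongr
            linarith
        _ = _ := by ring
    have h3 : a n * 2 ^ n ≤ ∑' k, 2 ^ (k + n) * a (k + n) := by
      have := (htail n).le_tsum 0 fun k _ => hterm (k + n)
      simpa [mul_comm] using this
    have h4 : 2 * a n ≤ 4 * (t - s) * ∑' k, 2 ^ (k + n) * a (k + n) := by
      have : 0 ≤ t - s := sub_nonneg.2 hst
      calc 2 * a n ≤ 2 * a n * (2 * 2 ^ n * (t - s)) :=
            le_mul_of_one_le_right (by linarith [ha0 n]) hone
        _ = 4 * (t - s) * (a n * 2 ^ n) := by ring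
        _ ≤ _ := by gcongr
    rw [hZn n t ht0 ht, hZn n s hs hs1]
    rw [abs_le] at h1 h2 ⊢
    constructor <;> linarith
  refine ⟨Z, fun n s t hs hst ht hn => ?_⟩
  rcases hst.eq_or_lt with rfl | hlt
  · simp [hΞ]
  -- The exact scale `m` of `t - s` is at least `n`, and the tails of the series decrease.
  obtain ⟨m, hm1, hm2⟩ := exists_nat_pow_near_of_lt_one (sub_pos.2 hlt) (by linarith)
    (by norm_num : (0 : ℝ) < 1 / 2) (by norm_num)
  have hnm : n ≤ m := by
    have := (pow_lt_pow_iff_right_of_lt_one₀ (by norm_num : (0 : ℝ) < 1 / 2) (by norm_num)).1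
      (hm1.trans_le hn)
    omega
  refine (hlocal m s t hs hst ht hm2 hm1).trans ?_
  obtain ⟨d, rfl⟩ := Nat.exists_eq_add_of_le hnm
  have : ∑' k, 2 ^ (k + (n + d)) * a (k + (n + d)) ≤ ∑' k, 2 ^ (k + n) * a (k + n) := by
    rw [← (htail n).sum_add_tsum_nat_add d]
    have h1 : 0 ≤ ∑ k ∈ Finset.range d, 2 ^ (k + n) * a (k + n) :=
      Finset.sum_nonneg fun k _ => hterm _
    have h2 : ∀ k, k + (n + d) = k + d + n := fun k => by ring
    simp only [h2]
    linarith
  have : 0 ≤ t - s := sub_nonneg.2 hst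
  gcongr

end Sewing

/-! ### The Lévy area as a sewn integral -/

/-- The defect is a determinant of two increments, so it is bounded by the square of the oscillation
of `γ` at the scale of `t - s`. -/
lemma sewDefect_planeDet (γ : ℝ → Plane) (s u t : ℝ) :
    sewDefect (fun s t => planeDet (γ s) (γ t)) s u t = planeDet (γ u - γ s) (γ t - γ u) := by
  simp only [sewDefect, planeDet, PiLp.sub_apply]; ring

lemma abs_planeDet_le (u v : Plane) : |planeDet u v| ≤ ‖u‖ * ‖v‖ := by
  refine abs_le_of_sq_le_sq ?_ (by positivity)
  rw [mul_pow, EuclideanSpace.norm_sq_eq, EuclideanSpace.norm_sq_eq]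
  simp only [Fin.sum_univ_two, Real.norm_eq_abs, sq_abs, planeDet]
  nlinarith [sq_nonneg (u 0 * v 0 + u 1 * v 1)]

/-- A function whose increments are well approximated by `2 det (γ s, γ t)` is the Lévy area. -/
lemma hasLevyArea_of_increments {T : ℝ} {γ : ℝ → Plane} {Z : ℝ → ℝ} (hZ0 : Z 0 = 0)
    (hZ : ∀ ε > 0, ∃ δ > 0, ∀ s t, 0 ≤ s → s ≤ t → t ≤ T → t - s ≤ δ →
      |Z t - Z s - 2 * planeDet (γ s) (γ t)| ≤ ε * (t - s)) {t : ℝ} (ht : t ∈ Icc 0 T) :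
    HasLevyArea γ t (Z t) := by
  intro ε hε
  have hT : 0 ≤ T := ht.1.trans ht.2
  obtain ⟨δ, hδ, h⟩ := hZ (ε / (T + 1)) (by positivity)
  refine ⟨δ, hδ, fun N τ h0 hN hτ => ?_⟩
  have hmono : ∀ i ≤ N, ∀ j ≤ i, τ j ≤ τ i := by
    intro i
    induction i with
    | zero => intro _ j hj; rw [Nat.le_zero.1 hj]
    | succ i ih =>
      intro hi j hj
      rcases hj.eq_or_lt with rfl | hj
      · rfl
      · exact (ih (by omega) j (by omega)).trans (hτ i (by omega)).1.le
  -- The increments of `Z` telescope, so the error of a subdivision is the sum of the local errors,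
  -- at most `ε (t - s) / (T + 1)` each.
  have e : 2 * ∑ i ∈ Finset.range N, (γ (τ i) 0 * γ (τ (i + 1)) 1 - γ (τ i) 1 * γ (τ (i + 1)) 0)
      - Z t = -∑ i ∈ Finset.range N,
        (Z (τ (i + 1)) - Z (τ i) - 2 * planeDet (γ (τ i)) (γ (τ (i + 1)))) := by
    simp only [planeDet]
    rw [Finset.sum_sub_distrib (fun i => Z (τ (i + 1)) - Z (τ i)),
      Finset.sum_range_sub (fun i => Z (τ i)), h0, hN, hZ0, ← Finset.mul_sum]
    ring
  rw [e, abs_neg]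
  calc _ ≤ ∑ i ∈ Finset.range N, ε / (T + 1) * (τ (i + 1) - τ i) := by
        refine (Finset.abs_sum_le_sum_abs _ _).trans (Finset.sum_le_sum fun i hi => ?_)
        rw [Finset.mem_range] at hi
        refine h _ _ (h0 ▸ hmono i hi.le 0 (Nat.zero_le _)) (hτ i hi).1.le ?_ (hτ i hi).2.le
        exact (hmono N le_rfl (i + 1) hi).trans (hN ▸ ht.2)
    _ = ε / (T + 1) * t := by
        rw [← Finset.mul_sum, Finset.sum_range_sub, h0, hN, sub_zero]
    _ < ε := by
        rw [div_mul_eq_mul_div, div_lt_iff₀ (by positivity)]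
        have := ht.2
        nlinarith

/-! ### Von Koch curves with alternating sides: vertices, cells and upper bounds -/

namespace Koch

/-- The position of the new vertex over the unit segment at step `n`. -/
noncomputable def turn (τ : ℕ → ℝ) (n : ℕ) : ℂ := ⟨1 / 2, (-1) ^ n * τ n / 2⟩

/-- The vertices of the broken lines; the first one has vertices `a, a + 1, …`. -/
noncomputable def vertex (τ : ℕ → ℝ) (a : ℂ) : ℕ → ℕ → ℂ
  | 0, i => a + i
  | n + 1, i => vertex τ a n (i / 2) +
      if Even i then 0 else (vertex τ a n (i / 2 + 1) - vertex τ a n (i / 2)) * turn τ n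

/-- The edges of the broken lines. -/
noncomputable def edge (τ : ℕ → ℝ) (a : ℂ) (n i : ℕ) : ℂ := vertex τ a n (i + 1) - vertex τ a n i

/-- The length of the edges. -/
noncomputable def side (τ : ℕ → ℝ) (n : ℕ) : ℝ := ∏ k ∈ Finset.range n, ‖turn τ k‖

/-- The slope of the lower boundary of the region containing the normalized curve. -/
noncomputable def slope (τ : ℕ → ℝ) (n : ℕ) : ℝ := (1 - τ n) / (1 + τ n)

/-- A quadrilateral containing the curve over the unit segment, from step `n` on. -/
def region (τ : ℕ → ℝ) (n : ℕ) : Set ℂ :=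
  {z | (-1) ^ n * z.im ≤ z.re ∧ (-1) ^ n * z.im ≤ 1 - z.re ∧
    -(slope τ n * z.re) ≤ (-1) ^ n * z.im ∧ -(slope τ n * (1 - z.re)) ≤ (-1) ^ n * z.im}

/-- The region over the edge `i` at step `n`. -/
def cell (τ : ℕ → ℝ) (a : ℂ) (n i : ℕ) : Set ℂ :=
  (fun z => vertex τ a n i + edge τ a n i * z) '' region τ n

variable {τ : ℕ → ℝ} {a : ℂ}

lemma vertex_even (n i : ℕ) : vertex τ a (n + 1) (2 * i) = vertex τ a n i := by
  simp [vertex]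

lemma vertex_odd (n i : ℕ) :
    vertex τ a (n + 1) (2 * i + 1) = vertex τ a n i + edge τ a n i * turn τ n := by
  have h1 : (2 * i + 1) / 2 = i := by omega
  have h2 : ¬ Even (2 * i + 1) := by simp
  rw [vertex, h1, if_neg h2, edge]

lemma vertex_succ (n i : ℕ) : vertex τ a n (i + 1) = vertex τ a n i + edge τ a n i := by
  rw [edge]; ring

lemma edge_even (n i : ℕ) : edge τ a (n + 1) (2 * i) = edge τ a n i * turn τ n := by
  rw [edge, vertex_odd, vertex_even]; ring

lemma edge_odd (n i : ℕ) : edge τ a (n + 1) (2 * i + 1) = edge τ a n i * (1 - turn τ n) := by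
  rw [edge, vertex_odd, show 2 * i + 1 + 1 = 2 * (i + 1) by ring, vertex_even, vertex_succ]; ring

lemma norm_turn (n : ℕ) : ‖turn τ n‖ = √(1 + τ n ^ 2) / 2 := by
  have h : ((-1 : ℝ) ^ n) ^ 2 = 1 := by rw [← pow_mul, mul_comm, pow_mul]; simp
  rw [Complex.norm_eq_sqrt_sq_add_sq, turn]
  simp only
  rw [show (1 / 2 : ℝ) ^ 2 + ((-1) ^ n * τ n / 2) ^ 2 = (1 + ((-1) ^ n) ^ 2 * τ n ^ 2) / 2 ^ 2 by
    ring, h, one_mul, Real.sqrt_div (by positivity), Real.sqrt_sq (by norm_num)]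

lemma norm_one_sub_turn (n : ℕ) : ‖1 - turn τ n‖ = ‖turn τ n‖ := by
  rw [Complex.norm_eq_sqrt_sq_add_sq, Complex.norm_eq_sqrt_sq_add_sq, turn]
  simp only [Complex.sub_re, Complex.sub_im, Complex.one_re, Complex.one_im]
  congr 1
  ring

lemma side_succ (n : ℕ) : side τ (n + 1) = side τ n * (√(1 + τ n ^ 2) / 2) := by
  rw [side, Finset.prod_range_succ, ← side, norm_turn]

lemma side_pos (n : ℕ) : 0 < side τ n := by
  refine Finset.prod_pos fun k _ => ?_
  rw [norm_turn]
  positivity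

lemma norm_edge (n i : ℕ) : ‖edge τ a n i‖ = side τ n := by
  induction n generalizing i with
  | zero => simp [edge, vertex, side]
  | succ n ih =>
    rcases Nat.even_or_odd' i with ⟨j, rfl | rfl⟩
    · rw [edge_even, norm_mul, ih, side, side, Finset.prod_range_succ]
    · rw [edge_odd, norm_mul, ih, norm_one_sub_turn, side, side, Finset.prod_range_succ]

lemma side_succ_le (h0 : ∀ n, 0 ≤ τ n) (h1 : ∀ n, τ n < 1) (n : ℕ) :
    side τ (n + 1) ≤ 3 / 4 * side τ n := by
  have h : √(1 + τ n ^ 2) ≤ 3 / 2 :=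
    Real.sqrt_le_iff.2 ⟨by norm_num, by nlinarith [h0 n, h1 n]⟩
  rw [side_succ]
  nlinarith [side_pos (τ := τ) n]

lemma slope_nonneg (h0 : ∀ n, 0 ≤ τ n) (h1 : ∀ n, τ n < 1) (n : ℕ) : 0 ≤ slope τ n :=
  div_nonneg (by linarith [h1 n]) (by linarith [h0 n])

lemma slope_le_one (h0 : ∀ n, 0 ≤ τ n) (n : ℕ) : slope τ n ≤ 1 :=
  (div_le_one (by linarith [h0 n])).2 (by linarith [h0 n])

lemma slope_succ_le (h0 : ∀ n, 0 ≤ τ n) (h1 : ∀ n, τ n < 1) (hm : Monotone τ) (n : ℕ) :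
    slope τ (n + 1) ≤ slope τ n := by
  have := hm n.le_succ
  have := h0 n
  have h3 := h1 n
  have : 0 ≤ 1 - τ n := by linarith
  unfold slope
  gcongr

lemma isClosed_region (n : ℕ) : IsClosed (region τ n) := by
  have hr := Complex.continuous_re
  have hi := Complex.continuous_im
  exact (isClosed_le (by fun_prop) (by fun_prop)).and
    ((isClosed_le (by fun_prop) (by fun_prop)).and
      ((isClosed_le (by fun_prop) (by fun_prop)).and
        (isClosed_le (by fun_prop) (by fun_prop))))

lemma re_mem_of_mem_region (h0 : ∀ n, 0 ≤ τ n) (h1 : ∀ n, τ n < 1) {n : ℕ} {z : ℂ}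
    (hz : z ∈ region τ n) : 0 ≤ z.re ∧ z.re ≤ 1 := by
  obtain ⟨e1, e2, e3, e4⟩ := hz
  have hk := slope_nonneg h0 h1 n
  constructor <;> by_contra! h <;> nlinarith

lemma norm_le_of_mem_region (h0 : ∀ n, 0 ≤ τ n) (h1 : ∀ n, τ n < 1) {n : ℕ} {z : ℂ}
    (hz : z ∈ region τ n) : ‖z‖ ≤ 2 * z.re ∧ ‖1 - z‖ ≤ 2 * (1 - z.re) := by
  have hre := re_mem_of_mem_region h0 h1 hz
  obtain ⟨e1, e2, e3, e4⟩ := hz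
  have hk := slope_le_one h0 n
  have habs : |z.im| = |(-1) ^ n * z.im| := by rw [abs_mul, abs_neg_one_pow, one_mul]
  have i1 : |z.im| ≤ z.re := by
    rw [habs]; exact abs_le.2 ⟨by nlinarith, e1⟩
  have i2 : |z.im| ≤ 1 - z.re := by
    rw [habs]; exact abs_le.2 ⟨by nlinarith, e2⟩
  constructor
  · refine (Complex.norm_le_abs_re_add_abs_im z).trans ?_
    rw [abs_of_nonneg hre.1]; linarith
  · refine (Complex.norm_le_abs_re_add_abs_im _).trans ?_
    simp only [Complex.sub_re, Complex.sub_im, Complex.one_re, Complex.one_im, zero_sub, abs_neg]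
    rw [abs_of_nonneg (by linarith)]; linarith

lemma isCompact_region (h0 : ∀ n, 0 ≤ τ n) (h1 : ∀ n, τ n < 1) (n : ℕ) :
    IsCompact (region τ n) := by
  refine Metric.isCompact_of_isClosed_isBounded (isClosed_region n) ?_
  refine (Metric.isBounded_closedBall (x := (0 : ℂ)) (r := 2)).subset fun z hz => ?_
  rw [mem_closedBall_zero_iff]
  have := (norm_le_of_mem_region h0 h1 hz).1
  linarith [(re_mem_of_mem_region h0 h1 hz).2]

lemma ofReal_mem_region (h0 : ∀ n, 0 ≤ τ n) (h1 : ∀ n, τ n < 1) (n : ℕ) {θ : ℝ}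
    (hθ : θ ∈ Icc (0 : ℝ) 1) : (θ : ℂ) ∈ region τ n := by
  have hk := slope_nonneg h0 h1 n
  have e1 := mul_nonneg hk hθ.1
  have e2 := mul_nonneg hk (sub_nonneg.2 hθ.2)
  refine ⟨?_, ?_, ?_, ?_⟩ <;> simp <;> linarith [hθ.1, hθ.2]

/-- At the vertex `0`, region `n` has half-angle `π/4` on the side of the new vertex and `π/4 -
arctan τₙ` on the other, since `slope` is the tangent of the latter. Region `n + 1` is flipped.
Rotated by `arctan τₙ`, it has outer edge at angle `π/4 - arctan τₙ`, as required, and inner edge at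
`π/4 + arctan τₙ - arctan τₙ₊₁ ≤ π/4`: this is where monotonicity of `τ` enters. -/
lemma left_child (h0 : ∀ n, 0 ≤ τ n) (h1 : ∀ n, τ n < 1) (hm : Monotone τ) {n : ℕ} {z : ℂ}
    (hz : z ∈ region τ (n + 1)) : turn τ n * z ∈ region τ n := by
  have hre := re_mem_of_mem_region h0 h1 hz
  have hκ' := slope_succ_le h0 h1 hm n
  have hκ'0 := slope_nonneg h0 h1 (n + 1)
  have hdef : slope τ n * (1 + τ n) = 1 - τ n := div_mul_cancel₀ _ (by linarith [h0 n])
  have hκ1 := slope_le_one h0 n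
  have ht0 := h0 n
  have ht1 := h1 n
  obtain ⟨e1, e2, e3, e4⟩ := hz
  have hs : ((-1 : ℝ) ^ n) * (-1) ^ n = 1 := by rw [← mul_pow]; simp
  set b := (-1 : ℝ) ^ (n + 1) * z.im with hb
  set κ := slope τ n
  set κ' := slope τ (n + 1)
  set t := τ n
  set x := z.re
  have him : z.im = -((-1 : ℝ) ^ n * b) := by
    rw [hb, pow_succ]; linear_combination (-z.im) * hs
  have r1 : (turn τ n * z).re = (x + t * b) / 2 := by
    simp only [turn, Complex.mul_re]
    rw [him]; linear_combination (t * b / 2) * hs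
  have r2 : (-1) ^ n * (turn τ n * z).im = (t * x - b) / 2 := by
    simp only [turn, Complex.mul_im]
    rw [him]; linear_combination (t * x / 2 - b / 2) * hs
  have f3 : -(κ * x) ≤ b := by nlinarith
  have f4 : -(κ * (1 - x)) ≤ b := by nlinarith
  have k0 : 0 ≤ κ := hκ'0.trans hκ'
  refine ⟨?_, ?_, ?_, ?_⟩ <;> rw [r1, r2]
  · nlinarith
  · nlinarith [mul_nonneg (sub_nonneg.2 ht1.le) k0, mul_nonneg (sub_nonneg.2 hre.2) k0]
  · have : t + κ = 1 - κ * t := by linarith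
    nlinarith [mul_nonneg (sub_nonneg.2 hκ1) (sub_nonneg.2 ht1.le), mul_nonneg k0 ht0,
      mul_nonneg (add_nonneg ht0 k0) (sub_nonneg.2 e1)]
  · have hkt : κ * t = 1 - t - κ := by linarith
    have : 0 ≤ κ * t := mul_nonneg k0 ht0
    have k1 : 1 - t ≤ 2 * κ := by nlinarith
    nlinarith [mul_nonneg (sub_nonneg.2 e1) k0, mul_nonneg (sub_nonneg.2 e2) k0,
      mul_nonneg (sub_nonneg.2 e1) ht0, mul_nonneg (sub_nonneg.2 e2) ht0,
      mul_nonneg (sub_nonneg.2 e1) this, mul_nonneg (sub_nonneg.2 e2) this,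
      mul_nonneg (sub_nonneg.2 ht1.le) (sub_nonneg.2 e1),
      mul_nonneg (sub_nonneg.2 ht1.le) (sub_nonneg.2 e2)]

lemma reflect_mem_region {n : ℕ} {z : ℂ} (hz : z ∈ region τ n) :
    1 - (starRingEnd ℂ) z ∈ region τ n := by
  obtain ⟨e1, e2, e3, e4⟩ := hz
  refine ⟨?_, ?_, ?_, ?_⟩ <;>
    simp only [Complex.sub_re, Complex.sub_im, Complex.one_re, Complex.one_im, Complex.conj_re,
      Complex.conj_im, zero_sub, neg_neg, sub_sub_cancel] <;> assumption

lemma conj_turn (n : ℕ) : (starRingEnd ℂ) (turn τ n) = 1 - turn τ n := by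
  apply Complex.ext <;> simp [turn]
  norm_num

/-- The reflection `z ↦ 1 - conj z` preserves the regions and exchanges the two children. -/
lemma right_child (h0 : ∀ n, 0 ≤ τ n) (h1 : ∀ n, τ n < 1) (hm : Monotone τ) {n : ℕ} {z : ℂ}
    (hz : z ∈ region τ (n + 1)) : turn τ n + (1 - turn τ n) * z ∈ region τ n := by
  have h := reflect_mem_region (left_child h0 h1 hm (reflect_mem_region hz))
  rw [map_mul, map_sub, map_one, Complex.conj_conj, conj_turn] at h
  convert h using 1
  ring

lemma cell_even_subset (h0 : ∀ n, 0 ≤ τ n) (h1 : ∀ n, τ n < 1) (hm : Monotone τ) (n i : ℕ) :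
    cell τ a (n + 1) (2 * i) ⊆ cell τ a n i := by
  rintro _ ⟨z, hz, rfl⟩
  refine ⟨_, left_child h0 h1 hm hz, ?_⟩
  simp only
  rw [vertex_even, edge_even]; ring

lemma cell_odd_subset (h0 : ∀ n, 0 ≤ τ n) (h1 : ∀ n, τ n < 1) (hm : Monotone τ) (n i : ℕ) :
    cell τ a (n + 1) (2 * i + 1) ⊆ cell τ a n i := by
  rintro _ ⟨z, hz, rfl⟩
  refine ⟨_, right_child h0 h1 hm hz, ?_⟩
  simp only
  rw [vertex_odd, edge_odd]; ring

lemma cell_floor_subset (h0 : ∀ n, 0 ≤ τ n) (h1 : ∀ n, τ n < 1) (hm : Monotone τ) {t : ℝ}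
    (ht : 0 ≤ t) {n m : ℕ} (hnm : n ≤ m) :
    cell τ a m ⌊2 ^ m * t⌋₊ ⊆ cell τ a n ⌊2 ^ n * t⌋₊ := by
  induction m, hnm using Nat.le_induction with
  | base => exact Subset.rfl
  | succ m _ ih =>
    refine Subset.trans ?_ ih
    rcases floor_two_pow_succ (n := m) ht with h | h <;> rw [h]
    exacts [cell_even_subset h0 h1 hm m _, cell_odd_subset h0 h1 hm m _]

lemma isClosed_cell (h0 : ∀ n, 0 ≤ τ n) (h1 : ∀ n, τ n < 1) (n i : ℕ) :
    IsClosed (cell τ a n i) :=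
  ((isCompact_region h0 h1 n).image (by fun_prop)).isClosed

lemma vertex_mem_cell (h0 : ∀ n, 0 ≤ τ n) (h1 : ∀ n, τ n < 1) (n i : ℕ) :
    vertex τ a n i ∈ cell τ a n i :=
  ⟨0, by simpa using ofReal_mem_region h0 h1 n (left_mem_Icc.2 zero_le_one), by simp⟩

lemma vertex_succ_mem_cell (h0 : ∀ n, 0 ≤ τ n) (h1 : ∀ n, τ n < 1) (n i : ℕ) :
    vertex τ a n (i + 1) ∈ cell τ a n i :=
  ⟨1, by simpa using ofReal_mem_region h0 h1 n (right_mem_Icc.2 zero_le_one),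
    by simp [vertex_succ]⟩

lemma norm_sub_le_of_mem_cell (h0 : ∀ n, 0 ≤ τ n) (h1 : ∀ n, τ n < 1) {n i : ℕ} {p : ℂ}
    (hp : p ∈ cell τ a n i) :
    ‖p - vertex τ a n i‖ ≤ 2 * side τ n ∧ ‖vertex τ a n (i + 1) - p‖ ≤ 2 * side τ n := by
  obtain ⟨z, hz, rfl⟩ := hp
  have h2 := norm_le_of_mem_region h0 h1 hz
  have h3 := re_mem_of_mem_region h0 h1 hz
  have h4 := side_pos (τ := τ) n
  constructor
  · rw [show vertex τ a n i + edge τ a n i * z - vertex τ a n i = edge τ a n i * z by ring,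
      norm_mul, norm_edge]
    nlinarith
  · rw [vertex_succ, show vertex τ a n i + edge τ a n i - (vertex τ a n i + edge τ a n i * z)
      = edge τ a n i * (1 - z) by ring, norm_mul, norm_edge]
    nlinarith

lemma side_le (h0 : ∀ n, 0 ≤ τ n) (h1 : ∀ n, τ n < 1) (n : ℕ) : side τ n ≤ (3 / 4) ^ n := by
  induction n with
  | zero => simp [side]
  | succ n ih => rw [pow_succ]; linarith [side_succ_le h0 h1 n]

lemma tendsto_side (h0 : ∀ n, 0 ≤ τ n) (h1 : ∀ n, τ n < 1) : Tendsto (side τ) atTop (𝓝 0) :=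
  squeeze_zero (fun n => (side_pos n).le) (side_le h0 h1)
    (tendsto_pow_atTop_nhds_zero_of_lt_one (by norm_num) (by norm_num))

/-- The limit curve. -/
noncomputable def curve (τ : ℕ → ℝ) (a : ℂ) (t : ℝ) : ℂ :=
  limUnder atTop fun n => vertex τ a n ⌊2 ^ n * t⌋₊

lemma tendsto_curve (h0 : ∀ n, 0 ≤ τ n) (h1 : ∀ n, τ n < 1) (hm : Monotone τ) {t : ℝ}
    (ht : 0 ≤ t) : Tendsto (fun n => vertex τ a n ⌊2 ^ n * t⌋₊) atTop (𝓝 (curve τ a t)) := by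
  refine CauchySeq.tendsto_limUnder ?_
  refine cauchySeq_of_le_geometric (3 / 4) 2 (by norm_num) fun n => ?_
  have h := cell_floor_subset (a := a) h0 h1 hm ht n.le_succ
    (vertex_mem_cell h0 h1 (n + 1) ⌊2 ^ (n + 1) * t⌋₊)
  rw [dist_comm, dist_eq_norm]
  have := side_le h0 h1 n
  linarith [(norm_sub_le_of_mem_cell h0 h1 h).1]

lemma curve_mem_cell_floor (h0 : ∀ n, 0 ≤ τ n) (h1 : ∀ n, τ n < 1) (hm : Monotone τ) {t : ℝ}
    (ht : 0 ≤ t) (n : ℕ) : curve τ a t ∈ cell τ a n ⌊2 ^ n * t⌋₊ := by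
  refine (isClosed_cell h0 h1 n _).mem_of_tendsto (tendsto_curve h0 h1 hm ht) ?_
  filter_upwards [eventually_ge_atTop n] with m hnm
  exact cell_floor_subset h0 h1 hm ht hnm (vertex_mem_cell h0 h1 m _)

lemma vertex_two_pow_mul (n i d : ℕ) : vertex τ a (n + d) (2 ^ d * i) = vertex τ a n i := by
  induction d with
  | zero => simp
  | succ d ih => rw [← add_assoc, pow_succ, show 2 ^ d * 2 * i = 2 * (2 ^ d * i) by ring,
      vertex_even, ih]

lemma curve_dyadic (h0 : ∀ n, 0 ≤ τ n) (h1 : ∀ n, τ n < 1) (hm : Monotone τ) (n i : ℕ) :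
    curve τ a (i / 2 ^ n) = vertex τ a n i := by
  refine tendsto_nhds_unique (tendsto_curve h0 h1 hm (by positivity)) ?_
  refine tendsto_const_nhds.congr' ?_
  filter_upwards [eventually_ge_atTop n] with m hnm
  obtain ⟨d, rfl⟩ := Nat.exists_eq_add_of_le hnm
  have : (2 : ℝ) ^ (n + d) * (i / 2 ^ n) = ((2 ^ d * i : ℕ) : ℝ) := by
    push_cast; rw [pow_add]; field_simp
  rw [this, Nat.floor_natCast, vertex_two_pow_mul]

lemma curve_mem_cell (h0 : ∀ n, 0 ≤ τ n) (h1 : ∀ n, τ n < 1) (hm : Monotone τ) {t : ℝ} {n i : ℕ}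
    (hl : (i : ℝ) / 2 ^ n ≤ t) (hr : t ≤ ((i : ℝ) + 1) / 2 ^ n) : curve τ a t ∈ cell τ a n i := by
  have ht : 0 ≤ t := le_trans (by positivity) hl
  -- At the right endpoint the floor already designates the next cell; the point is then a common
  -- vertex.
  rcases hr.eq_or_lt with rfl | hr
  · have := curve_dyadic (a := a) h0 h1 hm n (i + 1)
    push_cast at this
    rw [this]
    exact vertex_succ_mem_cell h0 h1 n i
  · have h := curve_mem_cell_floor (a := a) h0 h1 hm ht n
    rw [div_le_iff₀ (by positivity)] at hl
    rw [lt_div_iff₀ (by positivity)] at hr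
    have : ⌊2 ^ n * t⌋₊ = i := by
      rw [Nat.floor_eq_iff (by positivity)]
      constructor <;> linarith
    rwa [this] at h

/-- The two points lie in the same cell or in adjacent cells of step `n`, which share a vertex. -/
lemma norm_curve_sub_le (h0 : ∀ n, 0 ≤ τ n) (h1 : ∀ n, τ n < 1) (hm : Monotone τ) {s t : ℝ}
    (hs : 0 ≤ s) (hst : s ≤ t) {n : ℕ} (hn : t - s ≤ (1 / 2) ^ n) :
    ‖curve τ a t - curve τ a s‖ ≤ 5 * side τ n := by
  have hl := side_pos (τ := τ) n
  set i := ⌊2 ^ n * s⌋₊ with hi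
  have us := floor_div_two_pow_le n hs
  have ls := lt_floor_add_one_div_two_pow n s
  have hs' := norm_sub_le_of_mem_cell h0 h1 (curve_mem_cell (a := a) h0 h1 hm us ls.le)
  rw [one_div_pow] at hn
  rw [← hi] at us ls hs'
  rcases le_total t ((i + 1) / 2 ^ n) with h | h
  · have ht' := norm_sub_le_of_mem_cell h0 h1
      (curve_mem_cell (a := a) h0 h1 hm (us.trans hst) h)
    have := norm_sub_le_norm_sub_add_norm_sub (curve τ a t) (vertex τ a n i) (curve τ a s)
    rw [norm_sub_rev (vertex τ a n i)] at this
    linarith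
  · have h2 : t ≤ (((i + 1 : ℕ) : ℝ) + 1) / 2 ^ n := by
      push_cast
      rw [add_div]
      linarith
    have ht' := norm_sub_le_of_mem_cell h0 h1
      (curve_mem_cell (a := a) (i := i + 1) h0 h1 hm (by push_cast; exact h) h2)
    have := norm_sub_le_norm_sub_add_norm_sub (curve τ a t) (vertex τ a n (i + 1)) (curve τ a s)
    linarith

/-! ### Separation of cells and lower bounds -/

section LowerBound

/-- Seen from the new vertex, the right child is tilted by `arctan τₙ` and opens by `π/4` on the
outer side. It therefore stays at angle at least `π/4 - arctan τₙ` from the perpendicular to the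
edge, which is bounded below by `1 - τₙ` up to a constant. -/
lemma re_one_sub_turn_mul (h0 : ∀ n, 0 ≤ τ n) (h1 : ∀ n, τ n < 1) {n : ℕ} {w : ℂ}
    (hw : w ∈ region τ (n + 1)) : (1 - τ n) / 4 * ‖w‖ ≤ ((1 - turn τ n) * w).re := by
  have hnorm := (norm_le_of_mem_region h0 h1 hw).1
  obtain ⟨e1, -⟩ := hw
  have ht0 := h0 n
  have ht1 := h1 n
  have : ((1 - turn τ n) * w).re = (w.re - τ n * ((-1) ^ (n + 1) * w.im)) / 2 := by
    simp only [turn, Complex.mul_re, Complex.sub_re, Complex.sub_im, Complex.one_re,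
      Complex.one_im, pow_succ]
    ring
  rw [this]
  have e2 := mul_le_mul_of_nonneg_left e1 ht0
  have e3 := mul_le_mul_of_nonneg_left hnorm (sub_nonneg.2 ht1.le)
  linarith

lemma re_turn_mul_one_sub (h0 : ∀ n, 0 ≤ τ n) (h1 : ∀ n, τ n < 1) {n : ℕ} {w : ℂ}
    (hw : w ∈ region τ (n + 1)) : (1 - τ n) / 4 * ‖1 - w‖ ≤ (turn τ n * (1 - w)).re := by
  have h := re_one_sub_turn_mul h0 h1 (reflect_mem_region hw)
  have e : (1 - turn τ n) * (1 - (starRingEnd ℂ) w) = (starRingEnd ℂ) (turn τ n * (1 - w)) := by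
    rw [map_mul, conj_turn, map_sub, map_one]
  have e2 : 1 - (starRingEnd ℂ) w = (starRingEnd ℂ) (1 - w) := by rw [map_sub, map_one]
  rwa [e, Complex.conj_re, e2, RCLike.norm_conj] at h

lemma norm_turn_le (h0 : ∀ n, 0 ≤ τ n) (h1 : ∀ n, τ n < 1) (n : ℕ) : ‖turn τ n‖ ≤ 1 := by
  have h : √(1 + τ n ^ 2) ≤ 2 := Real.sqrt_le_iff.2 ⟨by norm_num, by nlinarith [h0 n, h1 n]⟩
  rw [norm_turn]; linarith

lemma turn_re (n : ℕ) : (turn τ n).re = 1 / 2 := rfl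

lemma norm_edge_mul_ge (n i : ℕ) (z : ℂ) : side τ n * z.re ≤ ‖edge τ a n i * z‖ := by
  rw [norm_mul, norm_edge]
  exact mul_le_mul_of_nonneg_left (Complex.re_le_norm z) (side_pos n).le

variable {n i : ℕ} {p q : ℂ}

/-- Two children of a cell are separated by a cone at their common vertex. -/
lemma separation (h0 : ∀ n, 0 ≤ τ n) (h1 : ∀ n, τ n < 1) (hp : p ∈ cell τ a (n + 1) (2 * i))
    (hq : q ∈ cell τ a (n + 1) (2 * i + 1)) :
    (1 - τ n) / 4 * ‖vertex τ a (n + 1) (2 * i + 1) - p‖ ≤ ‖q - p‖ ∧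
      (1 - τ n) / 4 * ‖q - vertex τ a (n + 1) (2 * i + 1)‖ ≤ ‖q - p‖ := by
  obtain ⟨w, hw, rfl⟩ := hp
  obtain ⟨z, hz, rfl⟩ := hq
  have e1 := re_turn_mul_one_sub h0 h1 hw
  have e2 := re_one_sub_turn_mul h0 h1 hz
  have hτ : 0 ≤ (1 - τ n) / 4 := by linarith [h1 n]
  have hs := side_pos (τ := τ) n
  have hsucc : ∀ v : ℂ, side τ n * ‖turn τ n‖ * ‖v‖ ≤ side τ n * ‖v‖ := fun v =>
    mul_le_mul_of_nonneg_right (mul_le_of_le_one_right hs.le (norm_turn_le h0 h1 n))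
      (norm_nonneg v)
  simp only [vertex_even, vertex_odd, edge_even, edge_odd]
  have d : vertex τ a n i + edge τ a n i * turn τ n + edge τ a n i * (1 - turn τ n) * z
      - (vertex τ a n i + edge τ a n i * turn τ n * w)
      = edge τ a n i * (turn τ n * (1 - w) + (1 - turn τ n) * z) := by ring
  have d1 : vertex τ a n i + edge τ a n i * turn τ n - (vertex τ a n i + edge τ a n i * turn τ n * w)
      = edge τ a n i * turn τ n * (1 - w) := by ring
  have d2 : vertex τ a n i + edge τ a n i * turn τ n + edge τ a n i * (1 - turn τ n) * z
      - (vertex τ a n i + edge τ a n i * turn τ n) = edge τ a n i * (1 - turn τ n) * z := by ring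
  -- Along the direction of the parent edge both children move away from the common vertex, so the
  -- components add up without cancellation.
  have hge := norm_edge_mul_ge (τ := τ) (a := a) n i (turn τ n * (1 - w) + (1 - turn τ n) * z)
  rw [Complex.add_re] at hge
  have p1 : 0 ≤ (1 - τ n) / 4 * ‖1 - w‖ := by positivity
  have p2 : 0 ≤ (1 - τ n) / 4 * ‖z‖ := by positivity
  rw [d, d1, d2, norm_mul (edge τ a n i * turn τ n), norm_mul (edge τ a n i),
    norm_mul (edge τ a n i * (1 - turn τ n)), norm_mul (edge τ a n i) (1 - turn τ n), norm_edge,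
    norm_one_sub_turn]
  rw [norm_mul, norm_edge] at hge ⊢
  constructor
  · calc _ ≤ (1 - τ n) / 4 * (side τ n * ‖1 - w‖) := mul_le_mul_of_nonneg_left (hsucc _) hτ
      _ = side τ n * ((1 - τ n) / 4 * ‖1 - w‖) := by ring
      _ ≤ side τ n * ((turn τ n * (1 - w)).re + ((1 - turn τ n) * z).re) := by gcongr; linarith
      _ ≤ _ := hge
  · calc _ ≤ (1 - τ n) / 4 * (side τ n * ‖z‖) := mul_le_mul_of_nonneg_left (hsucc _) hτ
      _ = side τ n * ((1 - τ n) / 4 * ‖z‖) := by ring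
      _ ≤ side τ n * ((turn τ n * (1 - w)).re + ((1 - turn τ n) * z).re) := by gcongr; linarith
      _ ≤ _ := hge

/-- Projected on the parent edge, the second child lies beyond the midpoint. -/
lemma far_from_left (h0 : ∀ n, 0 ≤ τ n) (h1 : ∀ n, τ n < 1)
    (hq : q ∈ cell τ a (n + 1) (2 * i + 1)) : side τ n / 2 ≤ ‖q - vertex τ a n i‖ := by
  obtain ⟨z, hz, rfl⟩ := hq
  have e2 := re_one_sub_turn_mul h0 h1 hz
  have p2 : 0 ≤ (1 - τ n) / 4 * ‖z‖ := mul_nonneg (by linarith [h1 n]) (norm_nonneg z)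
  simp only [vertex_odd, edge_odd]
  have d : vertex τ a n i + edge τ a n i * turn τ n + edge τ a n i * (1 - turn τ n) * z
      - vertex τ a n i = edge τ a n i * (turn τ n + (1 - turn τ n) * z) := by ring
  rw [d]
  refine le_trans ?_ (norm_edge_mul_ge n i _)
  rw [Complex.add_re, turn_re, div_eq_mul_inv]
  have := side_pos (τ := τ) n
  gcongr
  linarith

lemma far_from_right (h0 : ∀ n, 0 ≤ τ n) (h1 : ∀ n, τ n < 1)
    (hp : p ∈ cell τ a (n + 1) (2 * i)) : side τ n / 2 ≤ ‖vertex τ a n (i + 1) - p‖ := by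
  obtain ⟨w, hw, rfl⟩ := hp
  have e1 := re_turn_mul_one_sub h0 h1 hw
  have p1 : 0 ≤ (1 - τ n) / 4 * ‖1 - w‖ := mul_nonneg (by linarith [h1 n]) (norm_nonneg _)
  simp only [vertex_even, edge_even]
  have d : vertex τ a n (i + 1) - (vertex τ a n i + edge τ a n i * turn τ n * w)
      = edge τ a n i * (turn τ n * (1 - w) + (1 - turn τ n)) := by rw [vertex_succ]; ring
  rw [d]
  refine le_trans ?_ (norm_edge_mul_ge n i _)
  rw [Complex.add_re, Complex.sub_re, turn_re, Complex.one_re, div_eq_mul_inv]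
  have := side_pos (τ := τ) n
  gcongr
  linarith

lemma exists_scale {r : ℝ} {n : ℕ} (hr : 0 < r) (hn : r ≤ (1 / 2) ^ n) :
    ∃ d, (1 / 2 : ℝ) ^ (n + d + 1) < r ∧ r ≤ (1 / 2) ^ (n + d) := by
  obtain ⟨m, hm1, hm2⟩ := exists_nat_pow_near_of_lt_one hr
    (hn.trans (pow_le_one₀ (by norm_num) (by norm_num)))
    (by norm_num : (0 : ℝ) < 1 / 2) (by norm_num)
  have hnm : n ≤ m := by
    have := (pow_lt_pow_iff_right_of_lt_one₀ (by norm_num : (0 : ℝ) < 1 / 2) (by norm_num)).1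
      (hm1.trans_le hn)
    omega
  obtain ⟨d, rfl⟩ := Nat.exists_eq_add_of_le hnm
  exact ⟨d, hm1, hm2⟩

/-- The vertex is also a vertex of every later step. At the step `n + d` given by the scale of `t -
i / 2 ^ n`, the time `t` belongs to the second half of the dyadic interval starting there. -/
lemma radial_right (h0 : ∀ n, 0 ≤ τ n) (h1 : ∀ n, τ n < 1) (hm : Monotone τ) {t : ℝ} {n i : ℕ}
    (hl : (i : ℝ) / 2 ^ n < t) (hr : t ≤ ((i : ℝ) + 1) / 2 ^ n) :
    ∃ k ≥ n, t - i / 2 ^ n ≤ (1 / 2) ^ k ∧ side τ k / 2 ≤ ‖curve τ a t - vertex τ a n i‖ := by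
  obtain ⟨d, hd1, hd2⟩ := exists_scale (sub_pos.2 hl) (n := n)
    (by rw [one_div_pow]; rw [add_div] at hr; linarith)
  refine ⟨n + d, Nat.le_add_right _ _, hd2, ?_⟩
  rw [← vertex_two_pow_mul n i d]
  refine far_from_left h0 h1 (curve_mem_cell h0 h1 hm ?_ ?_)
  all_goals
    push_cast
    rw [one_div_pow] at hd1 hd2
  · have : (2 * (2 ^ d * (i : ℝ)) + 1) / 2 ^ (n + d + 1) = i / 2 ^ n + 1 / 2 ^ (n + d + 1) := by
      rw [pow_succ, pow_add]; field_simp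
    rw [this]; linarith
  · have : (2 * (2 ^ d * (i : ℝ)) + 1 + 1) / 2 ^ (n + d + 1) = i / 2 ^ n + 1 / 2 ^ (n + d) := by
      rw [pow_succ, pow_add]; field_simp; ring
    rw [this]; linarith

lemma radial_left (h0 : ∀ n, 0 ≤ τ n) (h1 : ∀ n, τ n < 1) (hm : Monotone τ) {s : ℝ} {n i : ℕ}
    (hl : (i : ℝ) / 2 ^ n ≤ s) (hr : s < ((i : ℝ) + 1) / 2 ^ n) :
    ∃ k ≥ n, (i + 1) / 2 ^ n - s ≤ (1 / 2) ^ k ∧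
      side τ k / 2 ≤ ‖vertex τ a n (i + 1) - curve τ a s‖ := by
  obtain ⟨d, hd1, hd2⟩ := exists_scale (sub_pos.2 hr) (n := n)
    (by rw [one_div_pow]; rw [add_div]; linarith)
  refine ⟨n + d, Nat.le_add_right _ _, hd2, ?_⟩
  rw [← vertex_two_pow_mul n (i + 1) d]
  -- The dyadic interval ending at the vertex has index `j = 2 ^ d * (i + 1) - 1`.
  have hpos : 1 ≤ 2 ^ d * (i + 1) := Nat.one_le_iff_ne_zero.2 (by positivity)
  obtain ⟨j, hj⟩ := Nat.exists_eq_add_of_le' hpos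
  have hjr : (j : ℝ) = 2 ^ d * (i + 1) - 1 := by
    have : ((j + 1 : ℕ) : ℝ) = ((2 ^ d * (i + 1) : ℕ) : ℝ) := by rw [hj]
    push_cast at this
    linarith
  rw [hj]
  refine far_from_right h0 h1 (curve_mem_cell h0 h1 hm ?_ ?_)
  all_goals
    push_cast
    rw [one_div_pow] at hd1 hd2
    rw [hjr]
  · have : 2 * (2 ^ d * ((i : ℝ) + 1) - 1) / 2 ^ (n + d + 1)
        = (i + 1) / 2 ^ n - 1 / 2 ^ (n + d) := by
      rw [pow_succ, pow_add]; field_simp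
    rw [this]; linarith
  · have : (2 * (2 ^ d * ((i : ℝ) + 1) - 1) + 1) / 2 ^ (n + d + 1)
        = (i + 1) / 2 ^ n - 1 / 2 ^ (n + d + 1) := by
      rw [pow_succ, pow_add]; field_simp; ring
    rw [this]; linarith

/-- At the last step where one dyadic interval contains `s` and `t`, its midpoint `q` separates
them. The cone at the image of `q` reduces the estimate to the distance from that vertex to the end
farther from `q` in time; that end accounts for at least half of `t - s`, whence the factor 2.
Monotonicity of `τ` replaces `1 - τ m` by the smaller `1 - τ k`. -/
theorem exists_le_norm_curve_sub (h0 : ∀ n, 0 ≤ τ n) (h1 : ∀ n, τ n < 1) (hm : Monotone τ)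
    {s t : ℝ} (hs : 0 ≤ s) (hst : s < t) (ht : t ≤ 1) :
    ∃ k, t - s ≤ 2 * (1 / 2) ^ k ∧ (1 - τ k) / 8 * side τ k ≤ ‖curve τ a t - curve τ a s‖ := by
  classical
  have hex : ∃ m : ℕ, ¬ ∃ i : ℕ, (i : ℝ) / 2 ^ m ≤ s ∧ t ≤ (i + 1) / 2 ^ m := by
    obtain ⟨m, hm⟩ := exists_pow_lt_of_lt_one (sub_pos.2 hst) (by norm_num : (1 / 2 : ℝ) < 1)
    refine ⟨m, ?_⟩
    rintro ⟨i, hi1, hi2⟩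
    rw [one_div_pow] at hm
    rw [add_div] at hi2
    linarith
  have hspec := Nat.find_spec hex
  have hmin := fun m => Nat.find_min hex (m := m)
  obtain ⟨m, hN⟩ : ∃ m, Nat.find hex = m + 1 := by
    refine Nat.exists_eq_succ_of_ne_zero fun h => ?_
    rw [h] at hspec
    exact hspec ⟨0, by simpa using hs, by simpa using ht⟩
  rw [hN] at hspec
  obtain ⟨i, hi1, hi2⟩ := not_not.1 (hmin m (by omega))
  have el : (i : ℝ) / 2 ^ m = (2 * i : ℕ) / 2 ^ (m + 1) := by
    push_cast; rw [pow_succ]; field_simp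
  have er : ((i : ℝ) + 1) / 2 ^ m = ((2 * i + 1 : ℕ) + 1) / 2 ^ (m + 1) := by
    push_cast; rw [pow_succ]; field_simp; ring
  rw [el] at hi1
  rw [er] at hi2
  set q : ℝ := ((2 * i + 1 : ℕ) : ℝ) / 2 ^ (m + 1) with hq
  have hq' : (((2 * i : ℕ) : ℝ) + 1) / 2 ^ (m + 1) = q := by rw [hq]; push_cast; rfl
  have hsq : s < q := by
    by_contra! h
    exact hspec ⟨2 * i + 1, h, hi2⟩
  have hqt : q < t := by
    by_contra! h
    exact hspec ⟨2 * i, hi1, by rw [hq']; exact h⟩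
  have hsep := separation (a := a) h0 h1
    (curve_mem_cell h0 h1 hm hi1 (hq' ▸ hsq.le)) (curve_mem_cell h0 h1 hm hqt.le hi2)
  have conclude : ∀ k ≥ m + 1, ∀ r, side τ k / 2 ≤ r →
      (1 - τ m) / 4 * r ≤ ‖curve τ a t - curve τ a s‖ →
      (1 - τ k) / 8 * side τ k ≤ ‖curve τ a t - curve τ a s‖ := by
    intro k hk r hr hle
    have e1 : τ m ≤ τ k := hm (by omega)
    have e2 := side_pos (τ := τ) k
    have e3 := h1 m
    calc (1 - τ k) / 8 * side τ k ≤ (1 - τ m) / 8 * side τ k := by gcongr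
      _ = (1 - τ m) / 4 * (side τ k / 2) := by ring
      _ ≤ (1 - τ m) / 4 * r := by gcongr
      _ ≤ _ := hle
  rcases le_total (q - s) (t - q) with h | h
  · obtain ⟨k, hk, hk1, hk2⟩ := radial_right (a := a) h0 h1 hm hqt hi2
    exact ⟨k, by linarith, conclude k hk _ hk2 hsep.2⟩
  · obtain ⟨k, hk, hk1, hk2⟩ := radial_left (a := a) h0 h1 hm hi1 (hq' ▸ hsq)
    rw [hq'] at hk1
    exact ⟨k, by linarith, conclude k hk _ hk2 hsep.1⟩

end LowerBound

end Koch

/-! ### Hausdorff dimension of bi-Hölder images of intervals -/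

section HolderDimension

variable {X Y : Type*} [MetricSpace X] [MetricSpace Y]

lemma holderOnWith_of_dist_le {f : X → Y} {S : Set X} {C r : ℝ} (hC : 0 ≤ C) (hr : 0 ≤ r)
    (h : ∀ x ∈ S, ∀ y ∈ S, dist (f x) (f y) ≤ C * dist x y ^ r) :
    HolderOnWith C.toNNReal r.toNNReal f S := by
  intro x hx y hy
  rw [edist_dist, edist_dist, Real.coe_toNNReal r hr, ENNReal.ofReal_rpow_of_nonneg dist_nonneg hr]
  exact (ENNReal.ofReal_le_ofReal (h x hx y hy)).trans_eq (ENNReal.ofReal_mul hC)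

lemma holderOnWith_invFunOn {f : X → Y} {S : Set X} [Nonempty X] {C q : ℝ} (hC : 0 ≤ C)
    (hq : 0 < q) (h : ∀ x ∈ S, ∀ y ∈ S, dist x y ≤ C * dist (f x) (f y) ^ q) :
    HolderOnWith C.toNNReal q.toNNReal (Function.invFunOn f S) (f '' S) ∧
      Function.invFunOn f S '' (f '' S) = S := by
  have hinj : InjOn f S := fun x hx y hy hxy => by
    have := h x hx y hy
    rw [hxy, dist_self, Real.zero_rpow hq.ne', mul_zero] at this
    exact dist_le_zero.1 this
  have hinv : ∀ x ∈ S, Function.invFunOn f S (f x) = x := fun x hx => hinj.leftInvOn_invFunOn hx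
  refine ⟨holderOnWith_of_dist_le hC hq.le ?_, ?_⟩
  · rintro _ ⟨x, hx, rfl⟩ _ ⟨y, hy, rfl⟩
    rw [hinv x hx, hinv y hy]
    exact h x hx y hy
  · rw [image_image]
    exact (image_congr hinv).trans (image_id' S)

lemma dimH_Icc {T : ℝ} (hT : 0 < T) : dimH (Icc 0 T) = 1 := by
  rw [Real.dimH_of_nonempty_interior (by rw [interior_Icc]; exact nonempty_Ioo.2 hT)]
  simp

lemma dimH_image_Icc_le {f : ℝ → Y} {T C r : ℝ} (hT : 0 < T) (hC : 0 ≤ C) (hr : 0 < r)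
    (h : ∀ s ∈ Icc 0 T, ∀ t ∈ Icc 0 T, dist (f s) (f t) ≤ C * |s - t| ^ r) :
    dimH (f '' Icc 0 T) ≤ ENNReal.ofReal (1 / r) := by
  have := (holderOnWith_of_dist_le hC hr.le h).dimH_image_le (Real.toNNReal_pos.2 hr)
  rw [dimH_Icc hT] at this
  rwa [ENNReal.ofReal_div_of_pos hr, ENNReal.ofReal_one]

lemma le_dimH_image_Icc {f : ℝ → Y} {T C q : ℝ} (hT : 0 < T) (hC : 0 ≤ C) (hq : 0 < q)
    (h : ∀ s ∈ Icc 0 T, ∀ t ∈ Icc 0 T, |s - t| ≤ C * dist (f s) (f t) ^ q) :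
    ENNReal.ofReal q ≤ dimH (f '' Icc 0 T) := by
  obtain ⟨h1, h2⟩ := holderOnWith_invFunOn hC hq h
  have h3 := h1.dimH_image_le (Real.toNNReal_pos.2 hq)
  rw [h2, dimH_Icc hT] at h3
  have hq0 : (q.toNNReal : ℝ≥0∞) ≠ 0 := by simpa using hq
  rwa [ENNReal.le_div_iff_mul_le (Or.inl hq0) (Or.inl ENNReal.coe_ne_top), one_mul] at h3

end HolderDimension

/-! ### Ahlfors regularity and Hölder bounds for vertical parametrizations -/

namespace IsVerticalParam

variable {T : ℝ} {c : ℝ → Heis}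

lemma dist_le_rpow (hc : IsVerticalParam T c) : ∃ K > 0, ∀ s ∈ Icc 0 T, ∀ t ∈ Icc 0 T,
    dist (c s) (c t) ≤ K * |s - t| ^ (1 / 2 : ℝ) := by
  obtain ⟨K, hK1, hK⟩ := hc.exists_dist_sq_le
  have hK0 : 0 < K := by linarith
  refine ⟨√K, by positivity, fun s hs t ht => ?_⟩
  rw [← Real.sqrt_eq_rpow, ← Real.sqrt_mul hK0.le, abs_sub_comm]
  exact Real.le_sqrt_of_sq_le (hK s hs t ht)

lemma abs_sub_le_rpow (hc : IsVerticalParam T c) : ∀ s ∈ Icc 0 T, ∀ t ∈ Icc 0 T,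
    |s - t| ≤ 2 * dist (c s) (c t) ^ (2 : ℝ) := fun s hs t ht => by
  rw [abs_sub_comm, Real.rpow_two]
  exact hc.half_le_dist_sq hs ht

theorem dimH_image (hc : IsVerticalParam T c) : dimH (c '' Icc 0 T) = 2 := by
  obtain ⟨K, hK0, hK⟩ := hc.dist_le_rpow
  refine le_antisymm ?_ ?_
  · simpa using dimH_image_Icc_le hc.pos hK0.le (by norm_num) hK
  · simpa using le_dimH_image_Icc hc.pos zero_le_two zero_lt_two hc.abs_sub_le_rpow

/-- The parametrization and its inverse are Hölder of exponents `1/2` and `2`, so the measure of a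
subarc is comparable with the length `t - s` of its time interval, which is comparable with the
squared distance. -/
theorem isAhlforsRegularCurve (hc : IsVerticalParam T c) : IsAhlforsRegularCurve 2 T c := by
  obtain ⟨K, hK0, hK⟩ := hc.dist_le_rpow
  obtain ⟨K', hK'1, hK'⟩ := hc.exists_dist_sq_le
  refine ⟨2 * K ^ 2 + 2 * K', by positivity, fun s hs t ht hst => ?_⟩
  have hsub : Icc s t ⊆ Icc 0 T := Icc_subset_Icc hs.1 ht.2
  have hvol : (μH[1] : Measure ℝ) (Icc s t) = ENNReal.ofReal (t - s) := by
    rw [hausdorffMeasure_real, Real.volume_Icc]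
  have hd1 := hc.half_le_dist_sq hs ht
  have hd2 := hK' s hs t ht
  rw [abs_of_nonneg (sub_nonneg.2 hst)] at hd1 hd2
  have hts : 0 ≤ t - s := sub_nonneg.2 hst
  rw [Real.rpow_two]
  constructor
  · obtain ⟨h1, h2⟩ := holderOnWith_invFunOn (S := Icc s t) zero_le_two zero_lt_two
      (fun x hx y hy => hc.abs_sub_le_rpow x (hsub hx) y (hsub hy))
    have h3 := h1.hausdorffMeasure_image_le (by simp) zero_le_one
    rw [h2, hvol] at h3
    have h4 : ENNReal.ofReal (t - s) ≤ ENNReal.ofReal 2 * μH[2] (c '' Icc s t) := by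
      simpa using h3
    have h5 : ENNReal.ofReal ((t - s) / 2) ≤ μH[2] (c '' Icc s t) := by
      rw [ENNReal.ofReal_div_of_pos two_pos]
      exact ENNReal.div_le_of_le_mul' h4
    refine le_trans (ENNReal.ofReal_le_ofReal ?_) h5
    rw [inv_mul_le_iff₀ (by positivity)]
    nlinarith [mul_nonneg (sq_nonneg K) hts]
  · have h1 := ((holderOnWith_of_dist_le hK0.le (by norm_num : (0 : ℝ) ≤ 1 / 2)
      (fun x hx y hy => hK x (hsub hx) y (hsub hy))).hausdorffMeasure_image_le
        (by simp) zero_le_two)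
    have h2 : (((1 / 2 : ℝ).toNNReal : ℝ) * 2) = 1 := by
      rw [Real.coe_toNNReal _ (by norm_num)]; norm_num
    rw [h2, hvol] at h1
    refine h1.trans ?_
    have h3 : ((K.toNNReal : ℝ≥0∞)) ^ (2 : ℝ) = ENNReal.ofReal (K ^ 2) := by
      rw [ENNReal.rpow_two, ENNReal.ofReal_pow hK0.le]; rfl
    rw [h3, ← ENNReal.ofReal_mul (by positivity)]
    refine ENNReal.ofReal_le_ofReal ?_
    calc K ^ 2 * (t - s) ≤ K ^ 2 * (2 * dist (c s) (c t) ^ 2) := by gcongr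
      _ ≤ _ := by nlinarith [sq_nonneg (dist (c s) (c t))]

/-- A vertical lift is as Hölder as its projection, for the Euclidean distance. -/
lemma dist_toEuclid_le (hc : IsVerticalParam T c) {C α : ℝ} (hα : α ≤ 1) (hα0 : 0 < α)
    (hC : 0 ≤ C)
    (h : ∀ s ∈ Icc 0 T, ∀ t ∈ Icc 0 T, ‖proj (c t) - proj (c s)‖ ≤ C * |s - t| ^ α) :
    ∃ K ≥ 0, ∀ s ∈ Icc 0 T, ∀ t ∈ Icc 0 T,
      dist (toEuclid (c s)) (toEuclid (c t)) ≤ K * |s - t| ^ α := by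
  have hT := hc.pos
  have hB : ∀ s ∈ Icc 0 T, ‖proj (c s)‖ ≤ C * T ^ α := by
    intro s hs
    have h1 := h (T / 2) ⟨by linarith, by linarith⟩ s hs
    have h0 : proj 1 = 0 := by ext i; fin_cases i <;> simp [proj]
    rw [hc.mid, h0, sub_zero] at h1
    refine h1.trans ?_
    gcongr
    exact abs_le.2 ⟨by linarith [hs.2], by linarith [hs.1]⟩
  refine ⟨C + 2 * T ^ (1 - α) + 2 * (C * T ^ α) * C, by positivity, fun s hs t ht => ?_⟩
  wlog hst : s ≤ t generalizing s t
  · rw [dist_comm, abs_sub_comm]; exact this t ht s hs (le_of_not_ge hst)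
  have hu : 0 ≤ |s - t| := abs_nonneg _
  have hxy := h s hs t ht
  -- The difference of heights is the intrinsic vertical displacement, of order `|s - t|`, plus a
  -- determinant that is linear in the horizontal increment; the curve being bounded, the latter is
  -- `O(|s - t|^α)`.
  have hz : |(c t).z - (c s).z| ≤ 2 * |s - t| + 2 * (C * T ^ α) * (C * |s - t| ^ α) := by
    have h1 := hc.z_bound s hs t ht hst
    have h2 := abs_planeDet_le (proj (c s)) (proj (c t) - proj (c s))
    have h3 : ‖proj (c s)‖ * ‖proj (c t) - proj (c s)‖ ≤ C * T ^ α * (C * |s - t| ^ α) :=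
      mul_le_mul (hB s hs) hxy (norm_nonneg _) (by positivity)
    have h4 : ((c s)⁻¹ * c t).z
        = (c t).z - (c s).z + 2 * planeDet (proj (c s)) (proj (c t) - proj (c s)) := by
      simp [planeDet, proj]; ring
    have habs : |s - t| = t - s := by rw [abs_sub_comm, abs_of_nonneg (sub_nonneg.2 hst)]
    rw [habs] at h3 ⊢
    have h5 := abs_le.1 (h2.trans h3)
    exact abs_le.2 ⟨by linarith, by linarith⟩
  have hlin : |s - t| ≤ T ^ (1 - α) * |s - t| ^ α := by
    have h1 : |s - t| ≤ T := abs_le.2 ⟨by linarith [hs.1, ht.2], by linarith [hs.2, ht.1]⟩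
    rcases hu.eq_or_lt with h0 | h0
    · rw [← h0, Real.zero_rpow hα0.ne', mul_zero]
    · calc |s - t| = |s - t| ^ (1 - α) * |s - t| ^ α := by
            rw [← Real.rpow_add h0, sub_add_cancel, Real.rpow_one]
        _ ≤ _ := by gcongr
  have hnorm : dist (toEuclid (c s)) (toEuclid (c t))
      ≤ ‖proj (c t) - proj (c s)‖ + |(c t).z - (c s).z| := by
    rw [dist_comm, dist_eq_norm]
    refine le_of_sq_le_sq ?_ (by positivity)
    have e1 : ‖toEuclid (c t) - toEuclid (c s)‖ ^ 2
        = ‖proj (c t) - proj (c s)‖ ^ 2 + |(c t).z - (c s).z| ^ 2 := by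
      rw [EuclideanSpace.norm_sq_eq, EuclideanSpace.norm_sq_eq]
      simp [Fin.sum_univ_three, Fin.sum_univ_two, toEuclid, proj]
    rw [e1]
    nlinarith [mul_nonneg (norm_nonneg (proj (c t) - proj (c s))) (abs_nonneg ((c t).z - (c s).z))]
  calc _ ≤ C * |s - t| ^ α + (2 * (T ^ (1 - α) * |s - t| ^ α)
        + 2 * (C * T ^ α) * (C * |s - t| ^ α)) := by linarith
    _ = _ := by ring

lemma dist_proj_le_dist_toEuclid (A B : Heis) :
    dist (proj A) (proj B) ≤ dist (toEuclid A) (toEuclid B) := by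
  rw [EuclideanSpace.dist_eq, EuclideanSpace.dist_eq]
  refine Real.sqrt_le_sqrt ?_
  simp [Fin.sum_univ_three, Fin.sum_univ_two, toEuclid, proj]

end IsVerticalParam

/-! ### Construction of vertical lifts -/

section Lift

variable {γ : ℝ → Plane} {L : ℕ → ℝ}

/-- Used at the exact dyadic scale of `|t - s|`. With `N = 0` it gives the Hölder bound of exponent
`1/2`, and with `N` large and `B` small the little-o version. -/
lemma norm_sub_sq_le_of_scale
    (hγ : ∀ n s t, 0 ≤ s → s ≤ t → t ≤ 1 → t - s ≤ (1 / 2) ^ n → ‖γ t - γ s‖ ≤ L n) {N : ℕ} {B : ℝ}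
    (hB : ∀ n ≥ N, 2 ^ n * L n ^ 2 ≤ B) {s t : ℝ} (hs : s ∈ Icc (0 : ℝ) 1)
    (ht : t ∈ Icc (0 : ℝ) 1) (hst : |t - s| ≤ (1 / 2) ^ N) :
    ‖γ t - γ s‖ ^ 2 ≤ 2 * B * |t - s| := by
  wlog hle : s ≤ t generalizing s t
  · rw [abs_sub_comm] at hst ⊢
    rw [norm_sub_rev]
    exact this ht hs hst (le_of_not_ge hle)
  rcases hle.eq_or_lt with rfl | hlt
  · simp
  rw [abs_of_nonneg (sub_nonneg.2 hle)] at hst ⊢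
  obtain ⟨d, hd1, hd2⟩ := Koch.exists_scale (sub_pos.2 hlt) hst
  have h1 := hγ _ s t hs.1 hle ht.2 hd2
  have h2 := hB (N + d) (Nat.le_add_right _ _)
  have h3 : 1 ≤ 2 * 2 ^ (N + d) * (t - s) := by
    rw [one_div_pow, pow_succ, div_lt_iff₀ (by positivity)] at hd1
    linarith
  calc ‖γ t - γ s‖ ^ 2 ≤ L (N + d) ^ 2 := by gcongr
    _ ≤ L (N + d) ^ 2 * (2 * 2 ^ (N + d) * (t - s)) := le_mul_of_one_le_right (sq_nonneg _) h3
    _ = 2 * (2 ^ (N + d) * L (N + d) ^ 2) * (t - s) := by ring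
    _ ≤ _ := by gcongr

/-- The sewing defect of `2 det(γ s, γ t)` at scale `2⁻ⁿ` is at most `2 Lₙ²`, so summability of `2ⁿ
Lₙ²` is what sewing requires. The smallness condition keeps the area error below `(t - s) / 2`; the
constant is `22 = 11 · 2`. -/
theorem exists_isVerticalParam
    (hγ : ∀ n s t, 0 ≤ s → s ≤ t → t ≤ 1 → t - s ≤ (1 / 2) ^ n → ‖γ t - γ s‖ ≤ L n)
    (hsum : Summable fun n => 2 ^ n * L n ^ 2) (hmid : γ (1 / 2) = 0) {lam T : ℝ} (hT : 0 < T)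
    (hsmall : 22 * (∑' n, 2 ^ n * L n ^ 2) * lam ^ 2 ≤ T / 2) :
    ∃ c, IsVerticalLift T (fun t => lam • γ (t / T)) c ∧ IsVerticalParam T c ∧
      ∀ t ∈ Icc 0 T, proj (c t) = lam • γ (t / T) := by
  set γ' : ℝ → Plane := fun t => lam • γ (t / T) with hγ'
  set Ξ : ℝ → ℝ → ℝ := fun s t => 2 * planeDet (γ s) (γ t) with hΞdef
  have hΞ : ∀ t, Ξ t t = 0 := fun t => by simp only [hΞdef, planeDet]; ring
  have hterm : ∀ n, 0 ≤ 2 ^ n * L n ^ 2 := fun n => by positivity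
  have hdiv : ∀ t ∈ Icc 0 T, t / T ∈ Icc (0 : ℝ) 1 := fun t ht =>
    ⟨div_nonneg ht.1 hT.le, (div_le_one hT).2 ht.2⟩
  have hfun : (fun k => 2 ^ k * (2 * L k ^ 2)) = fun k => 2 * (2 ^ k * L k ^ 2) := by
    funext k; ring
  obtain ⟨Z₁, hZ₁⟩ := exists_sewing (Ξ := Ξ) (a := fun n => 2 * L n ^ 2) hΞ (by
    intro k s u t hs hsu hut ht hts
    have e : sewDefect Ξ s u t = 2 * planeDet (γ u - γ s) (γ t - γ u) := by
      rw [← sewDefect_planeDet]; simp only [sewDefect, hΞdef]; ring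
    have h1 := hγ k s u hs hsu (hut.trans ht) (by linarith)
    have h2 := hγ k u t (hs.trans hsu) hut ht (by linarith)
    have h0 : 0 ≤ L k := (norm_nonneg _).trans h1
    rw [e, abs_mul, abs_two, sq]
    gcongr
    exact (abs_planeDet_le _ _).trans (by gcongr)) (by
    rw [hfun]; exact hsum.mul_left 2)
  -- Area scales by `lam ^ 2`, and is invariant under reparametrization.
  set Z : ℝ → ℝ := fun t => lam ^ 2 * (Z₁ (t / T) - Z₁ 0) with hZdef
  have hincr : ∀ n s t, 0 ≤ s → s ≤ t → t ≤ T → (t - s) / T ≤ (1 / 2) ^ n →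
      |Z t - Z s - 2 * planeDet (γ' s) (γ' t)|
        ≤ lam ^ 2 / T * (22 * ∑' k, 2 ^ (k + n) * L (k + n) ^ 2) * (t - s) := by
    intro n s t hs hst ht hn
    have h := hZ₁ n (s / T) (t / T) (by positivity) (by gcongr) ((div_le_one hT).2 ht)
      (by rwa [← sub_div])
    have e : Z t - Z s - 2 * planeDet (γ' s) (γ' t)
        = lam ^ 2 * (Z₁ (t / T) - Z₁ (s / T) - Ξ (s / T) (t / T)) := by
      simp only [hZdef, hΞdef, hγ', planeDet, PiLp.smul_apply, smul_eq_mul]; ring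
    have e2 : ∑' k, 2 ^ (k + n) * (2 * L (k + n) ^ 2) = 2 * ∑' k, 2 ^ (k + n) * L (k + n) ^ 2 := by
      rw [← tsum_mul_left]
      exact tsum_congr fun k => by ring
    rw [e2] at h
    rw [e, abs_mul, abs_of_nonneg (sq_nonneg lam)]
    calc _ ≤ lam ^ 2 * (11 * (2 * ∑' k, 2 ^ (k + n) * L (k + n) ^ 2) * (t / T - s / T)) := by
          gcongr
      _ = _ := by field_simp; ring
  have hhalf : ∀ s t, 0 ≤ s → s ≤ t → t ≤ T →
      |Z t - Z s - 2 * planeDet (γ' s) (γ' t)| ≤ 1 / 2 * (t - s) := by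
    intro s t hs hst ht
    refine (hincr 0 s t hs hst ht ?_).trans ?_
    · rw [pow_zero, div_le_one hT]; linarith
    · have : lam ^ 2 / T * (22 * ∑' k, 2 ^ (k + 0) * L (k + 0) ^ 2) ≤ 1 / 2 := by
        simp only [add_zero]
        rw [div_mul_eq_mul_div, div_le_iff₀ hT]
        linarith
      have : 0 ≤ t - s := sub_nonneg.2 hst
      gcongr
  have hγ'sq : ∀ s t, ‖γ' t - γ' s‖ ^ 2 = lam ^ 2 * ‖γ (t / T) - γ (s / T)‖ ^ 2 := by
    intro s t
    simp only [hγ']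
    rw [← smul_sub, norm_smul, mul_pow, Real.norm_eq_abs, sq_abs]
  have habs : ∀ s t, |t / T - s / T| = |t - s| / T := fun s t => by
    rw [← sub_div, abs_div, abs_of_pos hT]
  have hholder : ∀ s ∈ Icc 0 T, ∀ t ∈ Icc 0 T,
      ‖γ' t - γ' s‖ ^ 2 ≤ lam ^ 2 * (2 * ∑' n, 2 ^ n * L n ^ 2) / T * |t - s| := by
    intro s hs t ht
    have h := norm_sub_sq_le_of_scale hγ (N := 0)
      (fun n _ => hsum.le_tsum n fun k _ => hterm k) (hdiv s hs) (hdiv t ht) (by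
        rw [pow_zero]
        exact abs_le.2 ⟨by linarith [(hdiv s hs).2, (hdiv t ht).1],
          by linarith [(hdiv s hs).1, (hdiv t ht).2]⟩)
    rw [habs] at h
    rw [hγ'sq]
    calc _ ≤ lam ^ 2 * (2 * (∑' n, 2 ^ n * L n ^ 2) * (|t - s| / T)) := by gcongr
      _ = _ := by ring
  have hsmall' : ∀ ε > 0, ∃ δ > 0, ∀ s ∈ Icc 0 T, ∀ t ∈ Icc 0 T, |t - s| ≤ δ →
      ‖γ' t - γ' s‖ ^ 2 ≤ ε * |t - s| := by
    intro ε hε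
    set η := ε * T / (2 * (lam ^ 2 + 1)) with hη
    have hη0 : 0 < η := by positivity
    obtain ⟨N, hN⟩ := eventually_atTop.1 (hsum.tendsto_atTop_zero.eventually_le_const hη0)
    refine ⟨T * (1 / 2) ^ N, by positivity, fun s hs t ht hst => ?_⟩
    have h := norm_sub_sq_le_of_scale hγ hN (hdiv s hs) (hdiv t ht) (by
      rw [habs, div_le_iff₀ hT]; linarith)
    rw [habs] at h
    rw [hγ'sq]
    calc _ ≤ lam ^ 2 * (2 * η * (|t - s| / T)) := by gcongr
      _ ≤ (lam ^ 2 + 1) * (2 * η * (|t - s| / T)) := by gcongr; linarith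
      _ = ε * |t - s| := by rw [hη]; field_simp
  have hZ0 : Z 0 = 0 := by simp [hZdef]
  -- The height is normalized so that the curve passes through the neutral element at time `T / 2`.
  set z₀ : ℝ := Z (T / 2) - T / 2 with hz₀
  set c₀ : ℝ → Heis := fun t => ⟨γ' t 0, γ' t 1, z₀ - Z t + t⟩ with hc₀
  have hproj : ∀ t, proj (c₀ t) = γ' t := fun t => by
    ext i; fin_cases i <;> simp [proj, hc₀]
  have hzb : ∀ s ∈ Icc 0 T, ∀ t ∈ Icc 0 T, s ≤ t →
      (t - s) / 2 ≤ ((c₀ s)⁻¹ * c₀ t).z ∧ ((c₀ s)⁻¹ * c₀ t).z ≤ 2 * (t - s) := by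
    intro s hs t ht hst
    have h1 := abs_le.1 (hhalf s t hs.1 hst ht.2)
    have e : ((c₀ s)⁻¹ * c₀ t).z = (t - s) - (Z t - Z s - 2 * planeDet (γ' s) (γ' t)) := by
      simp only [mul_z, inv_x, inv_y, inv_z, hc₀, planeDet]; ring
    rw [e]
    constructor <;> linarith
  have hK : ∀ s ∈ Icc 0 T, ∀ t ∈ Icc 0 T, ‖proj (c₀ t) - proj (c₀ s)‖ ^ 2
      ≤ lam ^ 2 * (2 * ∑' n, 2 ^ n * L n ^ 2) / T * |t - s| := by
    simp only [hproj]; exact hholder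
  obtain ⟨K, hK1, hdist⟩ := IsVerticalParam.exists_dist_sq_le_of_bounds hzb hK
  have hcont : ContinuousOn c₀ (Icc 0 T) := by
    refine (holderOnWith_of_dist_le (Real.sqrt_nonneg K) (by norm_num : (0 : ℝ) ≤ 1 / 2)
      fun s hs t ht => ?_).continuousOn (by simp)
    rw [← Real.sqrt_eq_rpow, ← Real.sqrt_mul (by linarith), Real.dist_eq, abs_sub_comm]
    exact Real.le_sqrt_of_sq_le (hdist s hs t ht)
  -- Time is clamped to `[0, T]`, which makes the curve continuous on the whole line without
  -- enlarging its image.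
  set c : ℝ → Heis := fun t => c₀ (projIcc 0 T hT.le t) with hc
  have hcc₀ : ∀ t ∈ Icc 0 T, c t = c₀ t := fun t ht => by
    simp only [hc, projIcc_of_mem hT.le ht]
  refine ⟨c, ⟨?_, Z, z₀, ?_⟩, ⟨hT, ?_, ?_, ?_, ⟨lam ^ 2 * (2 * ∑' n, 2 ^ n * L n ^ 2) / T, ?_⟩, ?_,
    ?_⟩, ?_⟩
  · exact (IsVerticalParam.continuous_proj.comp_continuousOn hcont).congr fun t _ =>
      (hproj t).symm
  · intro t ht
    refine ⟨hasLevyArea_of_increments hZ0 (fun ε hε => ?_) ht, hcc₀ t ht⟩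
    -- The tails of the series tend to zero, so the local area error is `o(t - s)` uniformly, as the
    -- convergence over all subdivisions requires.
    have htail := ((tendsto_sum_nat_add fun n => 2 ^ n * L n ^ 2).const_mul 22).const_mul
      (lam ^ 2 / T)
    rw [mul_zero, mul_zero] at htail
    obtain ⟨N, hN⟩ := (htail.eventually_le_const hε).exists
    refine ⟨T * (1 / 2) ^ N, by positivity, fun s t hs hst ht hd => ?_⟩
    refine (hincr N s t hs hst ht ?_).trans ?_
    · rw [div_le_iff₀ hT]; linarith
    · have : 0 ≤ t - s := sub_nonneg.2 hst
      gcongr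
  · exact hcont.comp_continuous (by fun_prop) fun t => (projIcc 0 T hT.le t).2
  · exact fun t => ⟨projIcc 0 T hT.le t, (projIcc 0 T hT.le t).2, hcc₀ _ (projIcc 0 T hT.le t).2⟩
  · intro s hs t ht
    rw [hcc₀ s hs, hcc₀ t ht]
    exact hzb s hs t ht
  · intro s hs t ht
    rw [hcc₀ s hs, hcc₀ t ht]
    exact hK s hs t ht
  · intro ε hε
    obtain ⟨δ, hδ, h⟩ := hsmall' ε hε
    refine ⟨δ, hδ, fun s hs t ht hst => ?_⟩
    rw [hcc₀ s hs, hcc₀ t ht, hproj, hproj]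
    exact h s hs t ht hst
  · rw [hcc₀ _ ⟨by linarith, by linarith⟩]
    have h1 : γ' (T / 2) = 0 := by
      simp only [hγ']
      rw [show T / 2 / T = 1 / 2 by field_simp, hmid, smul_zero]
    ext <;> simp [hc₀, h1, hz₀]
  · intro t ht
    rw [hcc₀ t ht, hproj]

end Lift

/-! ### The von Koch curve in the plane -/

namespace Koch

variable {τ : ℕ → ℝ}

/-- The identification of the complex numbers with the plane. -/
noncomputable def toPlane : ℂ ≃ₗᵢ[ℝ] Plane := Complex.orthonormalBasisOneI.repr

lemma toPlane_zero (z : ℂ) : toPlane z 0 = z.re := by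
  simp [toPlane, Complex.orthonormalBasisOneI_repr_apply]

lemma toPlane_one (z : ℂ) : toPlane z 1 = z.im := by
  simp [toPlane, Complex.orthonormalBasisOneI_repr_apply]

/-- The limit curve in the plane, centred at its middle point. -/
noncomputable def planeCurve (τ : ℕ → ℝ) (t : ℝ) : Plane := toPlane (curve τ (-turn τ 0) t)

lemma norm_planeCurve_sub (s t : ℝ) : ‖planeCurve τ t - planeCurve τ s‖
    = ‖curve τ (-turn τ 0) t - curve τ (-turn τ 0) s‖ := by
  rw [planeCurve, planeCurve, ← map_sub, LinearIsometryEquiv.norm_map]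

lemma planeCurve_half (h0 : ∀ n, 0 ≤ τ n) (h1 : ∀ n, τ n < 1) (hm : Monotone τ) :
    planeCurve τ (1 / 2) = 0 := by
  have h := curve_dyadic (a := -turn τ 0) h0 h1 hm 1 1
  -- Starting at `-turn τ 0` puts the first new vertex, reached at time `1/2`, at the origin.
  have hv : vertex τ (-turn τ 0) 1 1 = 0 := by
    simp [vertex]
  rw [hv] at h
  rw [planeCurve, show (1 / 2 : ℝ) = ((1 : ℕ) : ℝ) / 2 ^ 1 by norm_num, h, map_zero]

theorem isKochCurve {h : ℕ → ℝ} (hpos : ∀ n, 0 < τ n) (h1 : ∀ n, τ n < 1) (hm : Monotone τ)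
    (hlen : ∀ n, side τ n = kochLength h n) : IsKochCurve h (planeCurve τ) := by
  have h0 : ∀ n, 0 ≤ τ n := fun n => (hpos n).le
  set a := -turn τ 0 with ha
  refine ⟨fun n i => toPlane (vertex τ a n i), fun n t => toPlane (vertex τ a n ⌊2 ^ n * t⌋₊ +
    edge τ a n ⌊2 ^ n * t⌋₊ * ((2 ^ n * t - ⌊2 ^ n * t⌋₊ : ℝ) : ℂ)), ?_, ?_, ?_, ?_, ?_⟩
  · intro n i _
    rw [LinearIsometryEquiv.dist_map, dist_comm, dist_eq_norm, ← edge, norm_edge, hlen]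
  · intro n i _
    simp only [vertex_even]
  · intro n i _
    have hs : ((-1 : ℝ) ^ n) * (-1) ^ n = 1 := by rw [← mul_pow]; simp
    rw [← map_sub, ← map_sub, ← edge, vertex_odd, add_sub_cancel_left, planeDet, toPlane_zero,
      toPlane_zero, toPlane_one, toPlane_one, Complex.mul_re, Complex.mul_im]
    -- The determinant equals `‖edge‖² · Im (turn)`, whose sign `(-1) ^ n` is the alternation of
    -- sides.
    have e : (-1) ^ n * ((edge τ a n i).re * ((edge τ a n i).re * (turn τ n).im
        + (edge τ a n i).im * (turn τ n).re) - (edge τ a n i).im *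
        ((edge τ a n i).re * (turn τ n).re - (edge τ a n i).im * (turn τ n).im))
        = ‖edge τ a n i‖ ^ 2 * (τ n / 2) := by
      rw [Complex.sq_norm, Complex.normSq_apply, turn]
      linear_combination ((edge τ a n i).re * (edge τ a n i).re
        + (edge τ a n i).im * (edge τ a n i).im) * (τ n / 2) * hs
    rw [e, norm_edge]
    have := side_pos (τ := τ) n
    have := hpos n
    positivity
  · intro n i _ θ hθ
    have e1 : (2 : ℝ) ^ n * ((i + θ) / 2 ^ n) = i + θ := by field_simp
    have e2 : (1 - θ) • toPlane (vertex τ a n i) + θ • toPlane (vertex τ a n (i + 1))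
        = toPlane (vertex τ a n i + edge τ a n i * (θ : ℂ)) := by
      rw [← map_smul, ← map_smul, ← map_add, vertex_succ]
      congr 1
      simp only [Complex.real_smul]
      push_cast
      ring
    simp only
    rw [e1, e2]
    -- For `θ = 1` the floor jumps to the next edge, at its initial vertex.
    rcases hθ.2.eq_or_lt with rfl | hlt
    · have : ⌊(i : ℝ) + 1⌋₊ = i + 1 := by exact_mod_cast Nat.floor_natCast (i + 1)
      rw [this]
      simp [vertex_succ]
    · have : ⌊(i : ℝ) + θ⌋₊ = i := by
        rw [Nat.floor_eq_iff (by linarith [hθ.1, (Nat.cast_nonneg i : (0 : ℝ) ≤ i)])]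
        constructor <;> linarith [hθ.1]
      rw [this, add_sub_cancel_left]
  · rw [Metric.tendstoUniformlyOn_iff]
    intro ε hε
    have ht : Tendsto (fun n => 4 * side τ n) atTop (𝓝 0) := by
      simpa using (tendsto_side h0 h1).const_mul 4
    filter_upwards [ht.eventually_lt_const hε] with n hn t ht
    refine lt_of_le_of_lt ?_ hn
    rw [planeCurve, LinearIsometryEquiv.dist_map, dist_eq_norm]
    have hp := norm_sub_le_of_mem_cell h0 h1 (curve_mem_cell_floor (a := a) h0 h1 hm ht.1 n)
    have hf : (2 ^ n * t - ⌊2 ^ n * t⌋₊ : ℝ) ∈ Icc (0 : ℝ) 1 :=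
      ⟨sub_nonneg.2 (Nat.floor_le (by have := ht.1; positivity)),
        by linarith [Nat.lt_floor_add_one (2 ^ n * t)]⟩
    have hq := norm_sub_le_of_mem_cell h0 h1 (⟨_, ofReal_mem_region h0 h1 n hf, rfl⟩ :
      vertex τ a n ⌊2 ^ n * t⌋₊ + edge τ a n ⌊2 ^ n * t⌋₊ * ((2 ^ n * t - ⌊2 ^ n * t⌋₊ : ℝ) : ℂ)
        ∈ cell τ a n ⌊2 ^ n * t⌋₊)
    have := norm_sub_le_norm_sub_add_norm_sub (curve τ a t) (vertex τ a n ⌊2 ^ n * t⌋₊)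
      (vertex τ a n ⌊2 ^ n * t⌋₊ + edge τ a n ⌊2 ^ n * t⌋₊ * ((2 ^ n * t - ⌊2 ^ n * t⌋₊ : ℝ) : ℂ))
    rw [norm_sub_rev (vertex τ a n ⌊2 ^ n * t⌋₊)] at this
    linarith [hp.1, hq.1]

lemma norm_planeCurve_sub_le (h0 : ∀ n, 0 ≤ τ n) (h1 : ∀ n, τ n < 1) (hm : Monotone τ) (n : ℕ)
    (s t : ℝ) (hs : 0 ≤ s) (hst : s ≤ t) (_ : t ≤ 1) (hn : t - s ≤ (1 / 2) ^ n) :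
    ‖planeCurve τ t - planeCurve τ s‖ ≤ 5 * side τ n := by
  rw [norm_planeCurve_sub]
  exact norm_curve_sub_le h0 h1 hm hs hst hn

/-! ### Constant turning parameter: quasi-helices of exponent `1/β` -/

section SelfSimilar

/-- The contraction ratio of the self-similar curve of dimension `β`. -/
noncomputable def ratio (β : ℝ) : ℝ := (1 / 2 : ℝ) ^ (1 / β)

variable {β : ℝ}

lemma ratio_pos : 0 < ratio β := by unfold ratio; positivity

lemma ratio_pow (n : ℕ) : ratio β ^ n = ((1 / 2 : ℝ) ^ n) ^ (1 / β) := by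
  rw [ratio, ← Real.rpow_natCast, ← Real.rpow_mul (by norm_num), mul_comm, Real.rpow_mul
    (by norm_num), Real.rpow_natCast]

/-- The first bound makes the turning parameter real; the second makes it less than one, and is also
the convergence of `∑ 2ⁿ lₙ²` for `lₙ = ratio β ^ n`. -/
lemma ratio_sq_bounds (hβ₁ : 1 ≤ β) (hβ₂ : β < 2) : 1 ≤ 4 * ratio β ^ 2 ∧ 2 * ratio β ^ 2 < 1 := by
  have hb : 0 < β := by linarith
  have h1 : (1 / 2 : ℝ) ≤ ratio β := by
    have : (1 / 2 : ℝ) ^ (1 : ℝ) ≤ (1 / 2 : ℝ) ^ (1 / β) :=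
      Real.rpow_le_rpow_of_exponent_ge (by norm_num) (by norm_num) ((div_le_one hb).2 hβ₁)
    rwa [Real.rpow_one] at this
  have h2 : ratio β ^ 2 < 1 / 2 := by
    have e : ratio β ^ 2 = (1 / 2 : ℝ) ^ (2 / β) := by
      rw [ratio, ← Real.rpow_natCast, ← Real.rpow_mul (by norm_num)]
      congr 1
      push_cast
      ring
    have : (1 / 2 : ℝ) ^ (2 / β) < (1 / 2 : ℝ) ^ (1 : ℝ) :=
      Real.rpow_lt_rpow_of_exponent_gt (by norm_num) (by norm_num) ((one_lt_div hb).2 hβ₂)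
    rw [e]
    rwa [Real.rpow_one] at this
  constructor <;> nlinarith

/-- The constant turning parameter of the self-similar curve. -/
noncomputable def selfSimilarTurn (β : ℝ) (_ : ℕ) : ℝ := √(4 * ratio β ^ 2 - 1)

lemma side_selfSimilarTurn (hβ₁ : 1 ≤ β) (hβ₂ : β < 2) (n : ℕ) :
    side (selfSimilarTurn β) n = ratio β ^ n := by
  have hr := ratio_pos (β := β)
  induction n with
  | zero => simp [side]
  | succ n ih =>
    rw [side_succ, ih, selfSimilarTurn, Real.sq_sqrt (by linarith [(ratio_sq_bounds hβ₁ hβ₂).1]),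
      show 1 + (4 * ratio β ^ 2 - 1) = (2 * ratio β) ^ 2 by ring, Real.sqrt_sq (by positivity),
      pow_succ]
    ring

lemma selfSimilarTurn_nonneg (n : ℕ) : 0 ≤ selfSimilarTurn β n := Real.sqrt_nonneg _

lemma selfSimilarTurn_lt_one (hβ₁ : 1 ≤ β) (hβ₂ : β < 2) (n : ℕ) : selfSimilarTurn β n < 1 := by
  have := ratio_sq_bounds hβ₁ hβ₂
  rw [selfSimilarTurn, Real.sqrt_lt' one_pos]
  linarith

lemma monotone_selfSimilarTurn : Monotone (selfSimilarTurn β) := fun _ _ _ => le_rfl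

lemma rpow_le_two_mul {x y α : ℝ} (hx : 0 ≤ x) (hα0 : 0 ≤ α) (hα : α ≤ 1) (h : x ≤ 2 * y) :
    x ^ α ≤ 2 * y ^ α := by
  have hy : 0 ≤ y := by linarith
  calc x ^ α ≤ (2 * y) ^ α := by gcongr
    _ = 2 ^ α * y ^ α := Real.mul_rpow zero_le_two hy
    _ ≤ 2 ^ (1 : ℝ) * y ^ α := by gcongr; norm_num
    _ = 2 * y ^ α := by rw [Real.rpow_one]

theorem isQuasiHelix_smul (hβ₁ : 1 ≤ β) (hβ₂ : β < 2) {lam : ℝ} (hlam : 0 < lam) :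
    IsQuasiHelix (1 / β) fun t => lam • planeCurve (selfSimilarTurn β) t := by
  set τ := selfSimilarTurn β with hτ
  have h0 : ∀ n, 0 ≤ τ n := selfSimilarTurn_nonneg
  have h1 : ∀ n, τ n < 1 := selfSimilarTurn_lt_one hβ₁ hβ₂
  have hm : Monotone τ := monotone_selfSimilarTurn
  have hb : 0 < β := by linarith
  have hα0 : 0 ≤ 1 / β := by positivity
  have hα1 : 1 / β ≤ 1 := (div_le_one hb).2 hβ₁
  have hx : 0 < 1 - τ 0 := by linarith [h1 0]
  -- The first term is the upper constant and the second the inverse of the lower one; their sum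
  -- dominates both.
  refine ⟨10 * lam + 16 / ((1 - τ 0) * lam), by positivity, fun s hs t ht => ?_⟩
  wlog hle : s ≤ t generalizing s t
  · have := this t ht s hs (le_of_not_ge hle)
    rwa [abs_sub_comm, norm_sub_rev] at this
  rw [← smul_sub, norm_smul, Real.norm_of_nonneg hlam.le, abs_of_nonneg (sub_nonneg.2 hle)]
  rcases hle.eq_or_lt with rfl | hlt
  · have : (0 : ℝ) ^ (1 / β) = 0 := Real.zero_rpow (by positivity)
    rw [sub_self, sub_self, this]
    simp
  have hpos : 0 < t - s := sub_pos.2 hlt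
  have hpow : 0 ≤ (t - s) ^ (1 / β) := by positivity
  constructor
  · obtain ⟨k, hk1, hk2⟩ := exists_le_norm_curve_sub (a := -turn τ 0) h0 h1 hm hs.1 hlt ht.2
    rw [← norm_planeCurve_sub, hτ, side_selfSimilarTurn hβ₁ hβ₂, ratio_pow, ← hτ] at hk2
    have h2 := rpow_le_two_mul hpos.le hα0 hα1 hk1
    have h3 : (1 - τ 0) / 16 * (t - s) ^ (1 / β) ≤ ‖planeCurve τ t - planeCurve τ s‖ := by
      refine le_trans ?_ hk2
      change (1 - τ 0) / 16 * (t - s) ^ (1 / β) ≤ (1 - τ 0) / 8 * _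
      nlinarith
    have h4 : (10 * lam + 16 / ((1 - τ 0) * lam))⁻¹ ≤ lam * ((1 - τ 0) / 16) := by
      calc (10 * lam + 16 / ((1 - τ 0) * lam))⁻¹ ≤ (16 / ((1 - τ 0) * lam))⁻¹ := by
            gcongr; linarith
        _ = _ := by field_simp
    calc _ ≤ lam * ((1 - τ 0) / 16) * (t - s) ^ (1 / β) := by gcongr
      _ = lam * ((1 - τ 0) / 16 * (t - s) ^ (1 / β)) := by ring
      _ ≤ _ := by gcongr
  · obtain ⟨d, hd1, hd2⟩ := exists_scale hpos (n := 0) (by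
      rw [pow_zero]; linarith [hs.1, ht.2])
    rw [zero_add] at hd1 hd2
    have h2 := norm_planeCurve_sub_le h0 h1 hm d s t hs.1 hle ht.2 hd2
    rw [hτ, side_selfSimilarTurn hβ₁ hβ₂, ratio_pow, ← hτ] at h2
    have h3 := rpow_le_two_mul (x := (1 / 2) ^ d) (by positivity) hα0 hα1
      (by rw [pow_succ] at hd1; linarith : (1 / 2) ^ d ≤ 2 * (t - s))
    have h4 : 0 ≤ 16 / ((1 - τ 0) * lam) := by positivity
    calc _ ≤ lam * (5 * (2 * (t - s) ^ (1 / β))) := by gcongr; linarith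
      _ = 10 * lam * (t - s) ^ (1 / β) := by ring
      _ ≤ _ := by gcongr; linarith

lemma summable_selfSimilar (hβ₁ : 1 ≤ β) (hβ₂ : β < 2) :
    Summable fun n => (2 : ℝ) ^ n * (5 * side (selfSimilarTurn β) n) ^ 2 := by
  have h := (summable_geometric_of_lt_one (r := 2 * ratio β ^ 2) (by positivity)
    (ratio_sq_bounds hβ₁ hβ₂).2).mul_left 25
  refine h.congr fun n => ?_
  rw [side_selfSimilarTurn hβ₁ hβ₂, mul_pow, mul_pow]
  ring

end SelfSimilar

/-! ### The critical curve, with `n hₙ = √n / 4` -/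

section Critical

/-- Exponents for which the limit curve has dimension two without being too irregular. -/
noncomputable def criticalExponent (n : ℕ) : ℝ := 1 / (4 * √(max (n : ℝ) 1))

/-- The increments of `n ↦ n * criticalExponent n`. -/
noncomputable def criticalStep (n : ℕ) : ℝ := (√(n + 1 : ℝ) - √n) / 4

/-- The turning parameters corresponding to `criticalExponent`. -/
noncomputable def criticalTurn (n : ℕ) : ℝ := √((2 : ℝ) ^ (1 - 2 * criticalStep n) - 1)

lemma criticalExponent_mul (n : ℕ) : n * criticalExponent n = √n / 4 := by
  rcases n.eq_zero_or_pos with rfl | hn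
  · simp
  · have h1 : (1 : ℝ) ≤ n := by exact_mod_cast hn
    have h2 : √(n : ℝ) ≠ 0 := by positivity
    rw [criticalExponent, max_eq_left h1]
    field_simp
    rw [Real.sq_sqrt (by positivity)]

lemma antitone_criticalExponent : Antitone criticalExponent := fun m n hmn => by
  have : (m : ℝ) ≤ n := by exact_mod_cast hmn
  unfold criticalExponent
  gcongr

lemma criticalExponent_bounds (n : ℕ) : 0 < criticalExponent n ∧ criticalExponent n < 1 / 2 := by
  have h : 1 ≤ √(max (n : ℝ) 1) := Real.one_le_sqrt.2 (le_max_right _ _)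
  refine ⟨by unfold criticalExponent; positivity, ?_⟩
  rw [criticalExponent, div_lt_div_iff₀ (by positivity) two_pos]
  linarith

lemma tendsto_criticalExponent : Tendsto criticalExponent atTop (𝓝 0) := by
  unfold criticalExponent
  have h1 : Tendsto (fun n : ℕ => max (n : ℝ) 1) atTop atTop :=
    tendsto_atTop_mono (fun n => le_max_left _ _) tendsto_natCast_atTop_atTop
  have h2 := (Real.tendsto_sqrt_atTop.comp h1).const_mul_atTop (by norm_num : (0 : ℝ) < 4)
  exact h2.const_div_atTop 1

lemma criticalStep_eq (n : ℕ) : criticalStep n = 1 / (4 * (√(n + 1 : ℝ) + √n)) := by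
  have h1 : 0 < √(n + 1 : ℝ) := by positivity
  have h2 : 0 ≤ √(n : ℝ) := Real.sqrt_nonneg _
  rw [criticalStep, div_eq_div_iff (by norm_num) (by positivity)]
  have e1 := Real.sq_sqrt (by positivity : (0 : ℝ) ≤ n + 1)
  have e2 := Real.sq_sqrt (by positivity : (0 : ℝ) ≤ n)
  nlinarith

lemma criticalStep_pos (n : ℕ) : 0 < criticalStep n := by rw [criticalStep_eq]; positivity

lemma criticalStep_le (n : ℕ) : criticalStep n ≤ 1 / 4 := by
  have h1 : 1 ≤ √(n + 1 : ℝ) := Real.one_le_sqrt.2 (by linarith [(Nat.cast_nonneg n : (0 : ℝ) ≤ n)])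
  rw [criticalStep_eq]
  gcongr
  linarith [Real.sqrt_nonneg (n : ℝ)]

/-- Concavity of the square root; it makes the turning parameters non-decreasing, as the nesting of
cells requires. -/
lemma antitone_criticalStep : Antitone criticalStep := fun m n hmn => by
  have : (m : ℝ) ≤ n := by exact_mod_cast hmn
  rw [criticalStep_eq, criticalStep_eq]
  gcongr

lemma le_criticalStep (n : ℕ) : 1 / (8 * (n + 1 : ℝ)) ≤ criticalStep n := by
  have h0 : (0 : ℝ) ≤ n := Nat.cast_nonneg n
  have h1 : √(n + 1 : ℝ) ≤ n + 1 := Real.sqrt_le_iff.2 ⟨by positivity, by nlinarith⟩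
  have h2 : √(n : ℝ) ≤ √(n + 1 : ℝ) := Real.sqrt_le_sqrt (by linarith)
  rw [criticalStep_eq]
  exact one_div_le_one_div_of_le (by positivity) (by linarith)

lemma one_lt_two_rpow_criticalStep (n : ℕ) : 1 < (2 : ℝ) ^ (1 - 2 * criticalStep n) :=
  Real.one_lt_rpow one_lt_two (by linarith [criticalStep_le n])

lemma criticalTurn_pos (n : ℕ) : 0 < criticalTurn n :=
  Real.sqrt_pos.2 (by linarith [one_lt_two_rpow_criticalStep n])

lemma criticalTurn_sq (n : ℕ) : criticalTurn n ^ 2 = (2 : ℝ) ^ (1 - 2 * criticalStep n) - 1 :=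
  Real.sq_sqrt (by linarith [one_lt_two_rpow_criticalStep n])

lemma monotone_criticalTurn : Monotone criticalTurn := fun m n hmn => by
  have := antitone_criticalStep hmn
  unfold criticalTurn
  gcongr
  exact one_le_two

/-- As `2 log 2 ≥ 1`, `2^(2b) ≥ 1 + b`, whence `τ² = 2 / 2^(2b) - 1 ≤ 1 - b`; and `1 - τ ≥ (1 - τ²)
/ 2`. So the separation constant decays at most polynomially. -/
lemma criticalStep_div_two_le (n : ℕ) : criticalStep n / 2 ≤ 1 - criticalTurn n := by
  have hb := criticalStep_pos n
  have hb4 := criticalStep_le n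
  set b := criticalStep n with hbdef
  have e1 : (2 : ℝ) ^ (1 - 2 * b) = 2 / (2 : ℝ) ^ (2 * b) := by
    rw [Real.rpow_sub two_pos, Real.rpow_one]
  have e2 : 1 + b ≤ (2 : ℝ) ^ (2 * b) := by
    rw [Real.rpow_def_of_pos two_pos]
    have h1 := Real.add_one_le_exp (Real.log 2 * (2 * b))
    have h2 := Real.log_two_gt_d9
    nlinarith
  have e3 : (2 : ℝ) ^ (1 - 2 * b) ≤ 2 - b := by
    rw [e1, div_le_iff₀ (by positivity)]
    nlinarith
  have e4 := criticalTurn_sq n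
  have e5 := criticalTurn_pos n
  rw [← hbdef] at e4
  nlinarith [sq_nonneg (criticalTurn n - 1)]

lemma criticalTurn_lt_one (n : ℕ) : criticalTurn n < 1 := by
  linarith [criticalStep_div_two_le n, criticalStep_pos n]

/-- Step `n` contracts by `2^(-1/2 - criticalStep n)`, and the steps telescope to `√n / 4`. -/
lemma side_criticalTurn (n : ℕ) :
    side criticalTurn n = (2 : ℝ) ^ (-((n : ℝ) / 2 + √n / 4)) := by
  induction n with
  | zero => simp [side]
  | succ n ih =>
    have e : √(1 + criticalTurn n ^ 2) / 2 = (2 : ℝ) ^ (-(1 / 2 + criticalStep n)) := by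
      rw [criticalTurn_sq, add_sub_cancel, Real.sqrt_eq_rpow, ← Real.rpow_mul zero_le_two]
      rw [show ∀ x : ℝ, x / 2 = x / (2 : ℝ) ^ (1 : ℝ) from fun x => by rw [Real.rpow_one],
        ← Real.rpow_sub two_pos]
      congr 1
      ring
    rw [side_succ, ih, e, ← Real.rpow_add two_pos]
    congr 1
    rw [criticalStep]
    push_cast
    ring

lemma side_eq_kochLength (n : ℕ) : side criticalTurn n = kochLength criticalExponent n := by
  rw [side_criticalTurn, kochLength, mul_add, criticalExponent_mul]
  congr 1
  ring

lemma summable_criticalExponent :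
    Summable fun n : ℕ => (2 : ℝ) ^ (-((n : ℝ) * criticalExponent n)) := by
  set x : ℝ := Real.log 2 / 4 with hx
  have hx0 : 0 < x := by have := Real.log_pos one_lt_two; positivity
  have hs : Summable fun n : ℕ => 24 / x ^ 4 * (1 / (n : ℝ) ^ 2) :=
    (Real.summable_one_div_nat_pow.2 one_lt_two).mul_left _
  refine Summable.of_norm_bounded_eventually_nat hs ?_
  filter_upwards [eventually_ge_atTop 1] with n hn
  have hn0 : (0 : ℝ) < n := by exact_mod_cast hn
  -- The fourth-order term of the exponential at a multiple of `√n` already gives decay in `n⁻²`.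
  have h1 := Real.pow_div_factorial_le_exp (x * √n) (by positivity) 4
  have h2 : (x * √(n : ℝ)) ^ 4 = x ^ 4 * (n : ℝ) ^ 2 := by
    rw [mul_pow, show √(n : ℝ) ^ 4 = (√(n : ℝ) ^ 2) ^ 2 by ring, Real.sq_sqrt hn0.le]
  rw [h2] at h1
  have h3 : (2 : ℝ) ^ (-((n : ℝ) * criticalExponent n)) = (Real.exp (x * √n))⁻¹ := by
    rw [criticalExponent_mul, Real.rpow_def_of_pos two_pos, ← Real.exp_neg, hx]
    congr 1
    ring
  rw [h3, Real.norm_of_nonneg (by positivity)]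
  calc (Real.exp (x * √n))⁻¹ ≤ (x ^ 4 * (n : ℝ) ^ 2 / (Nat.factorial 4 : ℕ))⁻¹ := by gcongr
    _ = _ := by
      rw [show Nat.factorial 4 = 24 from rfl]
      push_cast
      field_simp

lemma summable_critical :
    Summable fun n => (2 : ℝ) ^ n * (5 * side criticalTurn n) ^ 2 := by
  refine Summable.of_nonneg_of_le (fun n => by positivity) (fun n => ?_)
    (summable_criticalExponent.mul_left 25)
  have e : (2 : ℝ) ^ n * (5 * side criticalTurn n) ^ 2
      = 25 * ((2 : ℝ) ^ (n : ℝ) * ((2 : ℝ) ^ (-((n : ℝ) / 2 + √n / 4))) ^ (2 : ℝ)) := by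
    rw [side_criticalTurn, Real.rpow_natCast, Real.rpow_two]; ring
  rw [e, ← Real.rpow_mul zero_le_two, ← Real.rpow_add two_pos, criticalExponent_mul]
  have : 0 ≤ √(n : ℝ) := Real.sqrt_nonneg _
  gcongr
  · exact one_le_two
  · linarith

/-- Subexponential growth of the loss factors. -/
lemma exists_mul_two_rpow_sqrt_le {δ : ℝ} (hδ : 0 < δ) :
    ∃ C > 0, ∀ k : ℕ, (k + 1 : ℝ) * (2 : ℝ) ^ (√k / 4) ≤ C * (2 : ℝ) ^ (δ * k) := by
  -- The available exponent `δ k` is split in two halves, one absorbing the factor `k + 1` and the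
  -- other `2^(√k / 4)`; `m` serves the linear bound of the first half.
  set m := min 1 (δ / 2 * Real.log 2) with hm
  have hlog := Real.log_pos one_lt_two
  have hm0 : 0 < m := lt_min one_pos (by positivity)
  refine ⟨1 / m * (2 : ℝ) ^ (1 / (32 * δ)), by positivity, fun k => ?_⟩
  have hk : (0 : ℝ) ≤ k := Nat.cast_nonneg k
  have h1 : m * (k + 1) ≤ (2 : ℝ) ^ (δ / 2 * k) := by
    rw [Real.rpow_def_of_pos two_pos]
    have h2 := Real.add_one_le_exp (Real.log 2 * (δ / 2 * k))
    have h3 : m ≤ 1 := min_le_left _ _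
    have h4 : m * k ≤ δ / 2 * Real.log 2 * k := by gcongr; exact min_le_right _ _
    linarith
  have h5 : √(k : ℝ) / 4 ≤ δ / 2 * k + 1 / (32 * δ) := by
    have e := Real.sq_sqrt hk
    have h6 : δ / 2 * k + 1 / (32 * δ) - √(k : ℝ) / 4 = (δ * √k - 1 / 4) ^ 2 / (2 * δ) := by
      field_simp
      linear_combination (-512 * δ ^ 2) * e
    have : 0 ≤ (δ * √(k : ℝ) - 1 / 4) ^ 2 / (2 * δ) := by positivity
    linarith
  calc (k + 1 : ℝ) * (2 : ℝ) ^ (√k / 4)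
      ≤ 1 / m * (2 : ℝ) ^ (δ / 2 * k) * (2 : ℝ) ^ (δ / 2 * k + 1 / (32 * δ)) := by
        gcongr
        · rw [one_div_mul_eq_div, le_div_iff₀ hm0]; linarith
        · exact one_le_two
    _ = 1 / m * (2 : ℝ) ^ (1 / (32 * δ)) * ((2 : ℝ) ^ (δ / 2 * k) * (2 : ℝ) ^ (δ / 2 * k)) := by
        rw [Real.rpow_add two_pos]; ring
    _ = _ := by
        rw [← Real.rpow_add two_pos]; ring_nf

/-- The inverse of the limit curve is Hölder for all exponents less than two. -/
lemma exists_abs_sub_le_critical {q : ℝ} (hq : 0 < q) (hq2 : q < 2) :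
    ∃ C > 0, ∀ s ∈ Icc (0 : ℝ) 1, ∀ t ∈ Icc (0 : ℝ) 1,
      |s - t| ≤ C * ‖planeCurve criticalTurn s - planeCurve criticalTurn t‖ ^ q := by
  have hδ : 0 < 1 / q - 1 / 2 := by
    have : 1 / 2 < 1 / q := one_div_lt_one_div_of_lt hq hq2
    linarith
  obtain ⟨C, hC, hCk⟩ := exists_mul_two_rpow_sqrt_le hδ
  refine ⟨2 * (128 * C) ^ q, by positivity, fun s hs t ht => ?_⟩
  wlog hle : s ≤ t generalizing s t
  · rw [abs_sub_comm, norm_sub_rev]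
    exact this t ht s hs (le_of_not_ge hle)
  rcases hle.eq_or_lt with rfl | hlt
  · simp [Real.zero_rpow hq.ne']
  obtain ⟨k, hk1, hk2⟩ := exists_le_norm_curve_sub (a := -turn criticalTurn 0)
    (fun n => (criticalTurn_pos n).le) criticalTurn_lt_one monotone_criticalTurn hs.1 hlt ht.2
  rw [← norm_planeCurve_sub] at hk2
  rw [abs_sub_comm, norm_sub_rev, abs_of_pos (sub_pos.2 hlt)]
  set D := ‖planeCurve criticalTurn t - planeCurve criticalTurn s‖
  have hk0 : (0 : ℝ) < k + 1 := by positivity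
  -- The cone loss is at worst of order `1 / (k + 1)`, and the side falls short of `2^(-k/2)` only
  -- by `2^(√k / 4)`. Both are absorbed by replacing the exponent `1/2` with the larger `1/q`.
  have hturn : 1 / (16 * (k + 1 : ℝ)) ≤ 1 - criticalTurn k := by
    refine le_trans ?_ (criticalStep_div_two_le k)
    have := le_criticalStep k
    calc 1 / (16 * (k + 1 : ℝ)) = 1 / (8 * (k + 1 : ℝ)) / 2 := by field_simp; norm_num
      _ ≤ _ := by gcongr
  have hside : side criticalTurn k = (2 : ℝ) ^ (-((k : ℝ) / 2)) / (2 : ℝ) ^ (√k / 4) := by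
    rw [side_criticalTurn, ← Real.rpow_sub two_pos]; ring_nf
  have hpow : (2 : ℝ) ^ (-((k : ℝ) / q)) ≤ 128 * C * D := by
    have e1 : (2 : ℝ) ^ (-((k : ℝ) / q))
        = (2 : ℝ) ^ (-((k : ℝ) / 2)) / (2 : ℝ) ^ ((1 / q - 1 / 2) * k) := by
      rw [← Real.rpow_sub two_pos]; ring_nf
    have e2 : 1 / (128 * (k + 1 : ℝ)) * side criticalTurn k ≤ D := by
      refine le_trans ?_ hk2
      refine mul_le_mul_of_nonneg_right ?_ (side_pos k).le
      calc 1 / (128 * (k + 1 : ℝ)) = 1 / (16 * (k + 1 : ℝ)) / 8 := by field_simp; norm_num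
        _ ≤ _ := div_le_div_of_nonneg_right hturn (by norm_num)
    rw [hside] at e2
    have hA : (0 : ℝ) < (2 : ℝ) ^ (-((k : ℝ) / 2)) := by positivity
    have hB : (0 : ℝ) < (2 : ℝ) ^ (√(k : ℝ) / 4) := by positivity
    rw [e1, div_le_iff₀ (by positivity)]
    have e3 : (2 : ℝ) ^ (-((k : ℝ) / 2)) ≤ 128 * D * ((k + 1) * (2 : ℝ) ^ (√(k : ℝ) / 4)) := by
      have e4 := mul_le_mul_of_nonneg_right e2
        (by positivity : (0 : ℝ) ≤ 128 * ((k + 1) * (2 : ℝ) ^ (√(k : ℝ) / 4)))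
      calc _ = 1 / (128 * (k + 1 : ℝ)) * ((2 : ℝ) ^ (-((k : ℝ) / 2)) / (2 : ℝ) ^ (√(k : ℝ) / 4))
            * (128 * ((k + 1) * (2 : ℝ) ^ (√(k : ℝ) / 4))) := by field_simp
        _ ≤ _ := e4
        _ = _ := by ring
    calc _ ≤ 128 * D * ((k + 1) * (2 : ℝ) ^ (√(k : ℝ) / 4)) := e3
      _ ≤ 128 * D * (C * (2 : ℝ) ^ ((1 / q - 1 / 2) * k)) := by
        have := hCk k
        gcongr
      _ = _ := by ring
  have hhalf : (1 / 2 : ℝ) ^ k = ((2 : ℝ) ^ (-((k : ℝ) / q))) ^ q := by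
    rw [← Real.rpow_mul zero_le_two, neg_mul, div_mul_cancel₀ _ hq.ne', Real.rpow_neg zero_le_two,
      Real.rpow_natCast, one_div, inv_pow]
  calc t - s ≤ 2 * (1 / 2) ^ k := hk1
    _ ≤ 2 * (128 * C * D) ^ q := by rw [hhalf]; gcongr
    _ = _ := by rw [Real.mul_rpow (by positivity) (norm_nonneg _)]; ring

end Critical

end Koch

/-! ### Vertical curves of prescribed Euclidean dimension -/

section MainTheorem

open Koch

/-- Below the critical dimension, lifts of self-similar quasi-helices. -/
lemma exists_isVerticalCurve_quasiHelix {β : ℝ} (hβ₁ : 1 ≤ β) (hβ₂ : β < 2) :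
    ∃ (γ : ℝ → Plane) (c : ℝ → Heis), IsQuasiHelix (1 / β) γ ∧ IsVerticalLift 1 γ c ∧
      IsVerticalCurve (c '' Icc 0 1) ∧
      dimH (Heis.toEuclid '' (c '' Icc 0 1)) = ENNReal.ofReal β := by
  have hβ0 : 0 < β := by linarith
  have h0 : ∀ n, 0 ≤ selfSimilarTurn β n := fun n => selfSimilarTurn_nonneg n
  have h1 : ∀ n, selfSimilarTurn β n < 1 := fun n => selfSimilarTurn_lt_one hβ₁ hβ₂ n
  have hm : Monotone (selfSimilarTurn β) := monotone_selfSimilarTurn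
  set S : ℝ := ∑' n, (2 : ℝ) ^ n * (5 * side (selfSimilarTurn β) n) ^ 2 with hS
  have hS0 : 0 ≤ S := tsum_nonneg fun n => by positivity
  -- Time must stay in `[0, 1]`, so the area is made small by shrinking the curve, which preserves
  -- quasi-helices.
  set lam : ℝ := 1 / (44 * (S + 1)) with hlam
  have hlam0 : 0 < lam := by positivity
  have hlamS : lam * (44 * (S + 1)) = 1 := by rw [hlam]; field_simp
  have hlam1 : lam ≤ 1 := by nlinarith
  have hsmall : 22 * S * lam ^ 2 ≤ 1 / 2 := by nlinarith
  obtain ⟨c, hlift, hc, hproj⟩ := exists_isVerticalParam (norm_planeCurve_sub_le h0 h1 hm)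
    (summable_selfSimilar hβ₁ hβ₂) (planeCurve_half h0 h1 hm) one_pos hsmall
  simp only [div_one] at hlift hproj
  obtain ⟨κ, hκ, hγ⟩ := isQuasiHelix_smul hβ₁ hβ₂ hlam0
  refine ⟨_, c, ⟨κ, hκ, hγ⟩, hlift, hc.isVerticalCurve, ?_⟩
  rw [image_image]
  refine le_antisymm ?_ ?_
  · obtain ⟨K, hK, hKc⟩ := hc.dist_toEuclid_le (C := κ) (α := 1 / β)
      ((div_le_one hβ0).2 hβ₁) (by positivity) hκ.le fun s hs t ht => by
        rw [hproj s hs, hproj t ht, abs_sub_comm]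
        exact (hγ s hs t ht).2
    have := dimH_image_Icc_le (f := fun t => (c t).toEuclid) one_pos hK (by positivity) hKc
    rwa [one_div_one_div] at this
  · refine le_dimH_image_Icc (C := κ ^ β) one_pos (by positivity) hβ0 fun s hs t ht => ?_
    have e1 : κ⁻¹ * |s - t| ^ (1 / β) ≤ ‖lam • planeCurve (selfSimilarTurn β) s -
        lam • planeCurve (selfSimilarTurn β) t‖ := (hγ t ht s hs).1
    rw [← hproj s hs, ← hproj t ht, ← dist_eq_norm] at e1
    have e2 := e1.trans (IsVerticalParam.dist_proj_le_dist_toEuclid (c s) (c t))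
    rw [inv_mul_le_iff₀ hκ] at e2
    calc |s - t| = (|s - t| ^ (1 / β)) ^ β := by
          rw [← Real.rpow_mul (abs_nonneg _), one_div_mul_cancel hβ0.ne', Real.rpow_one]
      _ ≤ (κ * dist (c s).toEuclid (c t).toEuclid) ^ β := by gcongr
      _ = _ := Real.mul_rpow hκ.le dist_nonneg

/-- If the inverse of a map of an interval is Hölder for all exponents less than `2`, then the
dimension of the image is at least `2`. -/
lemma two_le_dimH_image_Icc {Y : Type*} [MetricSpace Y] {f : ℝ → Y} {T : ℝ} (hT : 0 < T)
    (h : ∀ q : ℝ, 0 < q → q < 2 → ∃ C ≥ 0, ∀ s ∈ Icc 0 T, ∀ t ∈ Icc 0 T,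
      |s - t| ≤ C * dist (f s) (f t) ^ q) : 2 ≤ dimH (f '' Icc 0 T) := by
  -- The bound at the exponent 2 itself is not available, so the dimension is approached from below.
  refine le_of_forall_lt_imp_le_of_dense fun a ha => ?_
  rcases eq_or_ne a 0 with rfl | ha0
  · exact zero_le
  have hat : a ≠ ∞ := ha.ne_top
  have hq : 0 < a.toReal := ENNReal.toReal_pos ha0 hat
  have hq2 : a.toReal < 2 := by simpa using (ENNReal.toReal_lt_toReal hat (by simp)).2 ha
  obtain ⟨C, hC, hf⟩ := h _ hq hq2
  simpa [ENNReal.ofReal_toReal hat] using le_dimH_image_Icc hT hC hq hf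

/-- In the critical dimension, lifts of a curve of von Koch type. -/
lemma exists_isVerticalCurve_koch :
    ∃ (T : ℝ) (c : ℝ → Heis), 0 < T ∧
      IsVerticalLift T (fun t => planeCurve criticalTurn (t / T)) c ∧
      IsVerticalCurve (c '' Icc 0 T) ∧ IsAhlforsRegularCurve 2 T c ∧ dimH (c '' Icc 0 T) = 2 ∧
      dimH (Heis.toEuclid '' (c '' Icc 0 T)) = 2 ∧ dimH (Heis.proj '' (c '' Icc 0 T)) = 2 := by
  have h0 : ∀ n, 0 ≤ criticalTurn n := fun n => (criticalTurn_pos n).le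
  have h1 := criticalTurn_lt_one
  have hm := monotone_criticalTurn
  set S : ℝ := ∑' n, (2 : ℝ) ^ n * (5 * side criticalTurn n) ^ 2 with hS
  have hS0 : 0 ≤ S := tsum_nonneg fun n => by positivity
  -- The side lengths of the von Koch curve are prescribed, so the plane curve cannot be shrunk;
  -- slowing it down makes the area small relative to time.
  set T : ℝ := 44 * S + 1 with hTdef
  have hT : 0 < T := by positivity
  have hsmall : 22 * S * (1 : ℝ) ^ 2 ≤ T / 2 := by linarith
  obtain ⟨c, hlift, hc, hproj⟩ := exists_isVerticalParam (norm_planeCurve_sub_le h0 h1 hm)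
    summable_critical (planeCurve_half h0 h1 hm) hT hsmall
  simp only [one_smul] at hlift hproj
  obtain ⟨K, hK⟩ := hc.holder
  have hup : ∀ s ∈ Icc 0 T, ∀ t ∈ Icc 0 T,
      ‖(c t).proj - (c s).proj‖ ≤ √(max K 0) * |s - t| ^ (1 / 2 : ℝ) := fun s hs t ht => by
    rw [← Real.sqrt_eq_rpow, ← Real.sqrt_mul (le_max_right _ _)]
    refine Real.le_sqrt_of_sq_le ((hK s hs t ht).trans ?_)
    rw [abs_sub_comm]
    gcongr
    exact le_max_left _ _
  have hlow : ∀ q : ℝ, 0 < q → q < 2 → ∃ C ≥ 0, ∀ s ∈ Icc 0 T, ∀ t ∈ Icc 0 T,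
      |s - t| ≤ C * dist (c s).proj (c t).proj ^ q := fun q hq hq2 => by
    obtain ⟨C, hC, h⟩ := exists_abs_sub_le_critical hq hq2
    refine ⟨T * C, by positivity, fun s hs t ht => ?_⟩
    have hdiv : ∀ u ∈ Icc 0 T, u / T ∈ Icc (0 : ℝ) 1 := fun u hu =>
      ⟨div_nonneg hu.1 hT.le, (div_le_one hT).2 hu.2⟩
    have := h _ (hdiv s hs) _ (hdiv t ht)
    rw [← hproj s hs, ← hproj t ht, ← dist_eq_norm, ← sub_div, abs_div, abs_of_pos hT,
      div_le_iff₀ hT] at this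
    linarith
  refine ⟨T, c, hT, hlift, hc.isVerticalCurve, hc.isAhlforsRegularCurve, hc.dimH_image, ?_, ?_⟩
  · rw [image_image]
    refine le_antisymm ?_ (two_le_dimH_image_Icc hT fun q hq hq2 => ?_)
    · obtain ⟨K', hK', hKc⟩ := hc.dist_toEuclid_le (by norm_num) (by norm_num)
        (Real.sqrt_nonneg _) hup
      have := dimH_image_Icc_le (f := fun t => (c t).toEuclid) hT hK' (by norm_num) hKc
      simpa using this
    · obtain ⟨C, hC, h⟩ := hlow q hq hq2
      refine ⟨C, hC, fun s hs t ht => (h s hs t ht).trans ?_⟩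
      have := IsVerticalParam.dist_proj_le_dist_toEuclid (c s) (c t)
      gcongr
  · rw [image_image]
    refine le_antisymm ?_ (two_le_dimH_image_Icc hT hlow)
    have := dimH_image_Icc_le (f := fun t => (c t).proj) (r := 1 / 2) hT
      (Real.sqrt_nonneg (max K 0)) (by norm_num) fun s hs t ht => by
        rw [dist_comm, dist_eq_norm]
        exact hup s hs t ht
    simpa using this

end MainTheorem

theorem mainTheorem8 (β : ℝ) (hβ₁ : 1 ≤ β) (hβ₂ : β ≤ 2) :
    ∃ Γ : Set Heis, IsVerticalCurve Γ ∧ dimH (Heis.toEuclid '' Γ) = ENNReal.ofReal β ∧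
      (β < 2 → ∃ (γ : ℝ → Plane) (c : ℝ → Heis),
        IsQuasiHelix (1 / β) γ ∧ IsVerticalLift 1 γ c ∧ Γ = c '' Icc 0 1) ∧
      (β = 2 → ∃ (h : ℕ → ℝ) (γ : ℝ → Plane) (T : ℝ) (c : ℝ → Heis),
        Antitone h ∧ (∀ n, 0 < h n ∧ h n < 1 / 2) ∧ Tendsto h atTop (𝓝 0) ∧
        Summable (fun n : ℕ => (2 : ℝ) ^ (-((n : ℝ) * h n))) ∧
        IsKochCurve h γ ∧ 0 < T ∧ IsVerticalLift T (fun t => γ (t / T)) c ∧ Γ = c '' Icc 0 T ∧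
        IsAhlforsRegularCurve 2 T c ∧
        dimH Γ = 2 ∧ dimH (Heis.proj '' Γ) = 2) := by
  rcases hβ₂.lt_or_eq with hlt | rfl
  · obtain ⟨γ, c, hγ, hlift, hΓ, hdim⟩ := exists_isVerticalCurve_quasiHelix hβ₁ hlt
    exact ⟨c '' Icc 0 1, hΓ, hdim, fun _ => ⟨γ, c, hγ, hlift, rfl⟩, fun h => absurd h hlt.ne⟩
  · obtain ⟨T, c, hT, hlift, hΓ, hreg, hdim, hdimE, hdimP⟩ := exists_isVerticalCurve_koch
    refine ⟨c '' Icc 0 T, hΓ, by simpa using hdimE, fun h => absurd h (lt_irrefl _), fun _ => ?_⟩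
    exact ⟨Koch.criticalExponent, Koch.planeCurve Koch.criticalTurn, T, c,
      Koch.antitone_criticalExponent, Koch.criticalExponent_bounds,
      Koch.tendsto_criticalExponent, Koch.summable_criticalExponent,
      Koch.isKochCurve Koch.criticalTurn_pos Koch.criticalTurn_lt_one Koch.monotone_criticalTurn
        Koch.side_eq_kochLength, hT, hlift, rfl, hreg, hdim, hdimP⟩
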